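/- Trail Trap is the following two-player game on a finite simple undirected graph $G$. Player 1 chooses an edge $uv$ and moves a token along it, from $u$ to $v$; then Player 2 chooses a different edge and moves a second token along it in the same way. From then on the players alternate, starting with Player 1, and each moves their own token from its current vertex along an edge not yet used by either player to an adjacent vertex. The first player who cannot move loses. The winner of Trail Trap on $G$ is the player who has a winning strategy. Theorem. The winner of Trail Trap on a tree with $n$ vertices can be determined in $O(n^2)$ time. Precisely: there are a single program for a unit-cost random access machine (whose instructions are assignment of constants, copying, addition, truncated subtraction, indirect loading and storing, and comparison of registers for branching and looping) and constants $c, C$ such that, for every tree $T$ with vertex set $\{0,\dots,n-1\}$, and every list of the edges of $T$ (each edge once, in any order and with either orientation), the program, run on the input $n$ followed by this list on a machine with words of $c\,(\lfloor\log_2 n\rfloor+1)$ bits, halts without overflow after at most $C n^2$ steps and outputs which of the two players has a winning strategy on $T$. -/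

import Mathlib

namespace TrailTrap

/-! ### The game -/

section Game

variable {V : Type*}

/-- A move `u → v`: its tail is the first component, its head the second. -/
abbrev Move (V : Type*) := V × V

/-- The undirected edge along which a move runs. -/
def Move.edge (m : Move V) : Sym2 V := s(m.1, m.2)

/-- `Legal G S m`: after the moves `S` (listed with the MOST RECENT MOVE FIRST; the two players
alternate), the player whose turn it is may play `m`. The move runs along an edge of `G` that
neither player has used, and, unless it is that player's first move, it starts at the vertex where
the player's own token stands, which is the head of the last move but one. -/
def Legal (G : SimpleGraph V) (S : List (Move V)) (m : Move V) : Prop :=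
  G.Adj m.1 m.2 ∧ (∀ p ∈ S, Move.edge p ≠ Move.edge m) ∧
    ∀ (last own : Move V) (rest : List (Move V)), S = last :: own :: rest → m.1 = own.2

/-- `MoverWins G S`: after the moves `S`, the player whose turn it is has a winning strategy
(the first player unable to move loses): there is a legal move such that, whatever legal move the
opponent answers with (if there is none, the opponent has lost), the player again has a winning
strategy. -/
inductive MoverWins (G : SimpleGraph V) : List (Move V) → Prop
  | intro (S : List (Move V)) (m : Move V) (hm : Legal G S m)
      (h : ∀ m' : Move V, Legal G (m :: S) m' → MoverWins G (m' :: m :: S)) : MoverWins G S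

/-- Player 1 has a winning strategy in Trail Trap on `G`. -/
def P1Win (G : SimpleGraph V) : Prop := MoverWins G []

/-- Player 2 has a winning strategy in Trail Trap on `G`. -/
def P2Win (G : SimpleGraph V) : Prop := ∀ m : Move V, Legal G [] m → MoverWins G [m]

end Game

/-! ### Random access machines, with a step count

Programs are finite and act on registers `r₀, r₁, …` and on a random access memory, all holding
natural numbers of `w` bits. An instruction and an evaluation of a branching or loop condition
take one step each. -/

/-- Conditions comparing the contents of two registers. -/
inductive Cond
  | lt (a b : ℕ)
  | eq (a b : ℕ)

/-- Programs; the arguments of the instructions are names of registers, except that the second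
argument of `const` is a number. -/
inductive Prog
  /-- do nothing -/
  | skip
  /-- `r_d := k` -/
  | const (d k : ℕ)
  /-- `r_d := r_a` -/
  | move (d a : ℕ)
  /-- `r_d := r_a + r_b` -/
  | add (d a b : ℕ)
  /-- `r_d := max (r_a - r_b) 0` -/
  | sub (d a b : ℕ)
  /-- `r_d := mem[r_a]` -/
  | load (d a : ℕ)
  /-- `mem[r_a] := r_b` -/
  | store (a b : ℕ)
  /-- first `p`, then `q` -/
  | seq (p q : Prog)
  /-- if `c` then `p` else `q` -/
  | branch (c : Cond) (p q : Prog)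
  /-- while `c` do `p` -/
  | loop (c : Cond) (p : Prog)

/-- The contents of the registers and of the memory. -/
structure State where
  reg : ℕ → ℕ
  mem : ℕ → ℕ

/-- The state `s` with the value of register `d` replaced by `x`. -/
def State.setReg (s : State) (d x : ℕ) : State :=
  { s with reg := Function.update s.reg d x }

/-- The state `s` with the value of memory cell `a` replaced by `x`. -/
def State.setMem (s : State) (a x : ℕ) : State :=
  { s with mem := Function.update s.mem a x }

/-- Whether a condition holds in a state. -/
def Cond.Holds (s : State) : Cond → Prop
  | .lt a b => s.reg a < s.reg b
  | .eq a b => s.reg a = s.reg b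

/-- `Exec w p s s' t`: on a machine with words of `w` bits, the program `p`, started in the
state `s`, halts in the state `s'` after exactly `t` steps. A run that produces a number that does
not fit into a word is aborted; it has no final state. -/
inductive Exec (w : ℕ) : Prog → State → State → ℕ → Prop
  | skip (s : State) : Exec w .skip s s 1
  | const (s : State) (d k : ℕ) (hk : k < 2 ^ w) :
      Exec w (.const d k) s (s.setReg d k) 1
  | move (s : State) (d a : ℕ) :
      Exec w (.move d a) s (s.setReg d (s.reg a)) 1
  | add (s : State) (d a b : ℕ) (hk : s.reg a + s.reg b < 2 ^ w) :
      Exec w (.add d a b) s (s.setReg d (s.reg a + s.reg b)) 1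
  | sub (s : State) (d a b : ℕ) :
      Exec w (.sub d a b) s (s.setReg d (s.reg a - s.reg b)) 1
  | load (s : State) (d a : ℕ) :
      Exec w (.load d a) s (s.setReg d (s.mem (s.reg a))) 1
  | store (s : State) (a b : ℕ) :
      Exec w (.store a b) s (s.setMem (s.reg a) (s.reg b)) 1
  | seq (p q : Prog) (s s₁ s₂ : State) (t₁ t₂ : ℕ)
      (hp : Exec w p s s₁ t₁) (hq : Exec w q s₁ s₂ t₂) :
      Exec w (.seq p q) s s₂ (t₁ + t₂)
  | branch_true (c : Cond) (p q : Prog) (s s' : State) (t : ℕ)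
      (hc : c.Holds s) (hp : Exec w p s s' t) :
      Exec w (.branch c p q) s s' (t + 1)
  | branch_false (c : Cond) (p q : Prog) (s s' : State) (t : ℕ)
      (hc : ¬ c.Holds s) (hq : Exec w q s s' t) :
      Exec w (.branch c p q) s s' (t + 1)
  | loop_true (c : Cond) (p : Prog) (s s₁ s₂ : State) (t₁ t₂ : ℕ)
      (hc : c.Holds s) (hp : Exec w p s s₁ t₁) (hl : Exec w (.loop c p) s₁ s₂ t₂) :
      Exec w (.loop c p) s s₂ (t₁ + t₂ + 1)
  | loop_false (c : Cond) (p : Prog) (s : State) (hc : ¬ c.Holds s) :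
      Exec w (.loop c p) s s 1

/-! ### The input -/

/-- `L` lists every edge of `G` exactly once, in any order and with either orientation. -/
def IsEdgeList {V : Type*} (G : SimpleGraph V) (L : List (V × V)) : Prop :=
  (L.map Move.edge).Nodup ∧ ∀ e : Sym2 V, e ∈ L.map Move.edge ↔ e ∈ G.edgeSet

/-- The word sequence `n, a₁, b₁, a₂, b₂, …` for the edge list `(a₁, b₁), (a₂, b₂), …` on the
vertices `0, …, n - 1`. -/
def inputWords (n : ℕ) (L : List (Fin n × Fin n)) : List ℕ :=
  n :: L.flatMap fun e => [(e.1 : ℕ), (e.2 : ℕ)]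

/-- The initial state: the memory starts with the input words and all else is `0`. -/
def initState (n : ℕ) (L : List (Fin n × Fin n)) : State where
  reg := fun _ => 0
  mem := fun i => (inputWords n L).getD i 0

end TrailTrap

/-! Everything depends on how the first two moves `uv` and `xy` lie to each other. Suppose first
that they do not face each other, that is, not both `v` is the next vertex from `u` towards `x` and
`y` the next one from `x` towards `u`. Then a used edge separates the tokens for the rest of the
game. Neither player can disturb the other, so each walks a longest free trail; the player to move
wins exactly if that player's trail is strictly longer (`moverWins_iff_of_not_reach`).

If the moves do face each other, only the path between the tokens is contested. The player to move
either leaves it, after which the tokens are separated and lengths decide, or goes one step on,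
which gives a facing position with the roles exchanged and the distance reduced by one. So the
outcome depends only on the ordered pair `(u, x)` of tails (`moverWins_iff_faceWins`), and
`p1Win_iff` reduces the game to a search through all pairs of first moves.

There are quadratically many pairs, so each must be handled in constant time. The lengths in
question are of two kinds: `branch T u v` (all trails through a given first edge) and `ray T x v a
b` (trails towards `v` that avoid two exits at `v`). A ray either departs from the path before `v`,
which is measured by `between`, or continues from `v` along the best exit not excluded (`ray_eq`).
At most three exits are ever excluded, so the four longest branches at every vertex suffice
(`eval_best`). The numbers `between` obey a one-step recursion along the path (`between_eq_of_ne`,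
`between_eq_of_ne'`). For leaving the path, an exchange argument shows that only a longest exit has
to be tried (`leaveWins_iff`).

Vertices are inserted one by one so that every initial segment of the order is a subtree. All
recursions then refer to entries computed earlier, and the tables can be filled by at most doubly
nested loops. These loops are written in a small language of bounded loops over sixteen tables whose
translation to the machine is proved correct once and for all (`Stmt.exec_compile`), with running
time of order `N` to the power of the nesting depth (`Stmt.exists_cost_le`), where `N = 2n + 2`. -/

namespace TrailTrap

/-! ### A language of loops over tables, and its translation to the machine -/

/-- The contents of sixteen two-dimensional tables. -/
abbrev Tables := Fin 16 → ℕ → ℕ → ℕ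

/-- `A` with the entry `i, j` of table `k` replaced by `x`. -/
def Tables.set (A : Tables) (k : Fin 16) (i j x : ℕ) : Tables :=
  fun k' i' j' => if k' = k ∧ i' = i ∧ j' = j then x else A k' i' j'

/-- Expressions; `var l` is the counter of the loop at nesting level `l`. -/
inductive Expr
  | var (l : ℕ)
  | lit (k : Fin 4)
  | add (a b : Expr)
  | sub (a b : Expr)
  | get (k : Fin 16) (a b : Expr)
  | iflt (a b c d : Expr)
  | ifeq (a b c d : Expr)

/-- The value of an expression; sums that reach `N` are replaced by `0`. -/
def Expr.eval (N : ℕ) (A : Tables) (v : List ℕ) : Expr → ℕ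
  | var l => v.getD l 0
  | lit k => k
  | add a b => if a.eval N A v + b.eval N A v < N then a.eval N A v + b.eval N A v else 0
  | sub a b => a.eval N A v - b.eval N A v
  | get k a b => A k (a.eval N A v) (b.eval N A v)
  | iflt a b c d => if a.eval N A v < b.eval N A v then c.eval N A v else d.eval N A v
  | ifeq a b c d => if a.eval N A v = b.eval N A v then c.eval N A v else d.eval N A v

/-- Statements; a loop runs its counter from `0` up to (excluding) its bound. -/
inductive Stmt
  | assign (k : Fin 16) (i j e : Expr)
  | seq (p q : Stmt)
  | loop (b : Expr) (p : Stmt)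

/-- The effect of a statement on the tables. -/
def Stmt.run (N : ℕ) : Stmt → List ℕ → Tables → Tables
  | assign k i j e, v, A => A.set k (i.eval N A v) (j.eval N A v) (e.eval N A v)
  | seq p q, v, A => q.run N v (p.run N v A)
  | loop b p, v, A => Nat.rec A (fun i B => p.run N (v ++ [i]) B) (b.eval N A v)

/-- The nesting depth of the loops. -/
def Stmt.depth : Stmt → ℕ
  | assign _ _ _ _ => 0
  | seq p q => max p.depth q.depth
  | loop _ p => p.depth + 1

/-- The address of the cell of a table whose row and column are in the registers `t`, `t + 1`. -/
def addrProg (k : Fin 16) (t : ℕ) : Prog :=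
  .seq (.add t t 1) <| .seq (.load t t) <| .seq (.add (t+1) (t+1) (t+1)) <|
  .seq (.add (t+1) (t+1) (t+1)) <| .seq (.add (t+1) (t+1) (t+1)) <|
  .seq (.add (t+1) (t+1) (t+1)) <| .seq (.add t t (t+1)) <| .seq (.const (t+1) k) (.add t t (t+1))

/-- A program that puts the value of an expression at nesting level `d` into register `t`. -/
def Expr.compile (d : ℕ) : Expr → ℕ → Prog
  | var l, t => if l < d then .move t (4 + 2 * l) else .const t 0
  | lit k, t => .const t k
  | add a b, t => .seq (a.compile d t) <| .seq (b.compile d (t+1)) <| .seq (.sub (t+2) 1 t) <|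
      .branch (.lt (t+1) (t+2)) (.add t t (t+1)) (.const t 0)
  | sub a b, t => .seq (a.compile d t) <| .seq (b.compile d (t+1)) (.sub t t (t+1))
  | get k a b, t => .seq (a.compile d t) <| .seq (b.compile d (t+1)) <|
      .seq (addrProg k t) (.load t t)
  | iflt a b c e, t => .seq (a.compile d t) <| .seq (b.compile d (t+1)) <|
      .branch (.lt t (t+1)) (c.compile d t) (e.compile d t)
  | ifeq a b c e, t => .seq (a.compile d t) <| .seq (b.compile d (t+1)) <|
      .branch (.eq t (t+1)) (c.compile d t) (e.compile d t)

/-- A bound for the running time of the translation of an expression. -/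
def Expr.cost : Expr → ℕ
  | var _ => 1
  | lit _ => 1
  | add a b => a.cost + b.cost + 3
  | sub a b => a.cost + b.cost + 1
  | get _ a b => a.cost + b.cost + 10
  | iflt a b c d => a.cost + b.cost + c.cost + d.cost + 1
  | ifeq a b c d => a.cost + b.cost + c.cost + d.cost + 1

/-- The translation of a statement at nesting level `d`. -/
def Stmt.compile : Stmt → ℕ → Prog
  | assign k i j e, d => .seq (i.compile d (4 + 2 * d)) <| .seq (j.compile d (4 + 2 * d + 1)) <|
      .seq (e.compile d (4 + 2 * d + 2)) <| .seq (addrProg k (4 + 2 * d))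
      (.store (4 + 2 * d) (4 + 2 * d + 2))
  | seq p q, d => .seq (p.compile d) (q.compile d)
  | loop b p, d => .seq (b.compile d (4 + 2 * d + 1)) <| .seq (.const (4 + 2 * d) 0) <|
      .loop (.lt (4 + 2 * d) (4 + 2 * d + 1)) (.seq (p.compile (d + 1)) (.add (4 + 2 * d) (4 + 2 * d) 2))

/-- A bound for the running time of the translation of a statement. -/
def Stmt.cost (N : ℕ) : Stmt → ℕ
  | assign _ i j e => i.cost + j.cost + e.cost + 10
  | seq p q => p.cost N + q.cost N
  | loop b p => b.cost + 2 + N * (p.cost N + 2)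

/-! ### Correctness of the translation. -/

/-- The state `s` represents the tables `A` and the loop counters `v`. -/
structure Represents (N : ℕ) (A : Tables) (v : List ℕ) (s : State) : Prop where
  size : s.reg 1 = N
  one : s.reg 2 = 1
  row : ∀ i < N, s.mem (N + i) = 2 * N + 16 * (N * i)
  cell : ∀ (k : Fin 16), ∀ i < N, ∀ j < N, s.mem (2 * N + 16 * (N * i) + 16 * j + k) = A k i j
  counter : ∀ l (h : l < v.length), s.reg (4 + 2 * l) = v[l]

/-- All entries of the tables are less than `N`. -/
def Tables.Bounded (N : ℕ) (A : Tables) : Prop := ∀ k i j, A k i j < N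

/-- Registers from `4 + 2 * v.length` on are scratch space and carry no part of the representation.
-/
theorem Represents.congr {N : ℕ} {A : Tables} {v : List ℕ} {s s' : State}
    (h : Represents N A v s) (hr : ∀ r < 4 + 2 * v.length, s'.reg r = s.reg r)
    (hm : s'.mem = s.mem) : Represents N A v s' where
  size := by rw [hr _ (by omega), h.size]
  one := by rw [hr _ (by omega), h.one]
  row := by rw [hm]; exact h.row
  cell := by rw [hm]; exact h.cell
  counter l hl := by rw [hr _ (by omega), h.counter l hl]

/-- Truncating sums at `N` is what keeps every value below `N`, so that values can serve as row and
column indices. The bound `4 ≤ N` accommodates the literals. -/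
theorem Expr.eval_lt {N : ℕ} {A : Tables} {v : List ℕ} (hN : 4 ≤ N) (hA : A.Bounded N)
    (hv : ∀ x ∈ v, x < N) (e : Expr) : e.eval N A v < N := by
  induction e with
  | var l =>
    simp only [Expr.eval]
    by_cases h : l < v.length
    · rw [List.getD_eq_getElem _ _ h]; exact hv _ (List.getElem_mem h)
    · rw [List.getD_eq_default _ _ (by omega)]; omega
  | lit k => simp only [Expr.eval]; omega
  | add a b iha ihb => simp only [Expr.eval]; split_ifs <;> omega
  | sub a b iha ihb => simp only [Expr.eval]; omega
  | get k a b iha ihb => exact hA _ _ _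
  | iflt a b c d iha ihb ihc ihd => simp only [Expr.eval]; split_ifs <;> omega
  | ifeq a b c d iha ihb ihc ihd => simp only [Expr.eval]; split_ifs <;> omega

theorem Tables.Bounded.set {N : ℕ} {A : Tables} (hA : A.Bounded N) {k : Fin 16} {i j x : ℕ}
    (hx : x < N) : (A.set k i j x).Bounded N := by
  intro k' i' j'
  simp only [Tables.set]
  split_ifs
  exacts [hx, hA _ _ _]

theorem Stmt.run_bounded {N : ℕ} (hN : 4 ≤ N) (p : Stmt) : ∀ {A : Tables} {v : List ℕ},
    A.Bounded N → (∀ x ∈ v, x < N) → (p.run N v A).Bounded N := by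
  induction p with
  | assign k i j e => intro A v hA hv; exact hA.set (e.eval_lt hN hA hv)
  | seq p q ihp ihq => intro A v hA hv; exact ihq (ihp hA hv) hv
  | loop b p ih =>
    intro A v hA hv
    simp only [Stmt.run]
    have hb := b.eval_lt hN hA hv
    generalize b.eval N A v = m at hb
    induction m with
    | zero => exact hA
    | succ m ihm =>
      refine ih (ihm (by omega)) ?_
      intro x hx
      simp only [List.mem_append, List.mem_singleton] at hx
      rcases hx with hx | rfl
      exacts [hv x hx, by omega]

theorem cell_lt {N i j k : ℕ} (hi : i < N) (hj : j < N) (hk : k < 16) :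
    2 * N + 16 * (N * i) + 16 * j + k < 2 * N + 16 * (N * N) := by
  have : N * (i + 1) ≤ N * N := Nat.mul_le_mul_left _ hi
  rw [Nat.mul_add] at this
  omega

/-- The machine cannot multiply. The start of row `i` is therefore looked up in cell `N + i`, and
the factor 16 of the column comes from four doublings. -/
theorem exec_addrProg {N w : ℕ} (hw : 2 * N + 16 * (N * N) < 2 ^ w) {A : Tables} {v : List ℕ}
    {s : State} (h : Represents N A v s) (k : Fin 16) {t : ℕ} (ht : 4 + 2 * v.length ≤ t)
    (hi : s.reg t < N) (hj : s.reg (t + 1) < N) :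
    ∃ s', Exec w (addrProg k t) s s' 9 ∧
      s'.reg t = 2 * N + 16 * (N * s.reg t) + 16 * s.reg (t + 1) + k ∧
      (∀ r, r ≠ t → r ≠ t + 1 → s'.reg r = s.reg r) ∧ s'.mem = s.mem := by
  have hb := cell_lt hi hj k.2
  have hrow := h.row _ hi
  have e1 := h.size
  have h1 : (1 : ℕ) ≠ t := by omega
  have hNN : N ≤ N * N := Nat.le_mul_of_pos_left _ (by omega)
  refine ⟨_, .seq _ _ _ _ _ 1 8 (.add _ _ _ _ ?_) <| .seq _ _ _ _ _ 1 7 (.load _ _ _) <|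
      .seq _ _ _ _ _ 1 6 (.add _ _ _ _ ?_) <| .seq _ _ _ _ _ 1 5 (.add _ _ _ _ ?_) <|
      .seq _ _ _ _ _ 1 4 (.add _ _ _ _ ?_) <| .seq _ _ _ _ _ 1 3 (.add _ _ _ _ ?_) <|
      .seq _ _ _ _ _ 1 2 (.add _ _ _ _ ?_) <| .seq _ _ _ _ _ 1 1 (.const _ _ _ ?_)
        (.add _ _ _ _ ?_), ?_, fun r hr hr' => ?_, rfl⟩
  on_goal 10 => simp [State.setReg, Function.update, hr, hr']
  all_goals try simp [State.setReg, Function.update, e1, Nat.add_comm _ N, hrow]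
  all_goals omega

/-- Registers are used like a stack: evaluation with target `t` leaves everything below `t` intact,
so a first operand in `t` survives the evaluation of a second one in `t + 1`. -/
theorem Expr.exec_compile {N w : ℕ} (hN : 4 ≤ N) (hw : 2 * N + 16 * (N * N) < 2 ^ w) {A : Tables}
    (hA : A.Bounded N) {v : List ℕ} (hv : ∀ x ∈ v, x < N) (e : Expr) :
    ∀ {s : State} {t : ℕ}, Represents N A v s → 4 + 2 * v.length ≤ t →
      ∃ s' c, Exec w (e.compile v.length t) s s' c ∧ c ≤ e.cost ∧ s'.reg t = e.eval N A v ∧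
        (∀ r < t, s'.reg r = s.reg r) ∧ s'.mem = s.mem := by
  have two : ∀ {a b : Expr} {s : State} {t : ℕ},
      (∀ {s : State} {t : ℕ}, Represents N A v s → 4 + 2 * v.length ≤ t →
      ∃ s' c, Exec w (a.compile v.length t) s s' c ∧ c ≤ a.cost ∧ s'.reg t = a.eval N A v ∧
        (∀ r < t, s'.reg r = s.reg r) ∧ s'.mem = s.mem) →
      (∀ {s : State} {t : ℕ}, Represents N A v s → 4 + 2 * v.length ≤ t →
      ∃ s' c, Exec w (b.compile v.length t) s s' c ∧ c ≤ b.cost ∧ s'.reg t = b.eval N A v ∧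
        (∀ r < t, s'.reg r = s.reg r) ∧ s'.mem = s.mem) →
      Represents N A v s → 4 + 2 * v.length ≤ t →
      ∃ s₁ s₂ c₁ c₂, Exec w (a.compile v.length t) s s₁ c₁ ∧
        Exec w (b.compile v.length (t + 1)) s₁ s₂ c₂ ∧ c₁ ≤ a.cost ∧ c₂ ≤ b.cost ∧
        s₂.reg t = a.eval N A v ∧ s₂.reg (t + 1) = b.eval N A v ∧
        (∀ r < t, s₂.reg r = s.reg r) ∧ s₂.mem = s.mem ∧ Represents N A v s₂ := by
    intro a b s t iha ihb h ht
    obtain ⟨s₁, c₁, x₁, l₁, v₁, r₁, m₁⟩ := iha h ht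
    have h₁ := h.congr (fun r hr => r₁ r (by omega)) m₁
    obtain ⟨s₂, c₂, x₂, l₂, v₂, r₂, m₂⟩ := ihb (t := t + 1) h₁ (by omega)
    refine ⟨s₁, s₂, c₁, c₂, x₁, x₂, l₁, l₂, ?_, v₂, ?_, ?_, ?_⟩
    · rw [r₂ _ (by omega), v₁]
    · intro r hr; rw [r₂ _ (by omega), r₁ _ hr]
    · rw [m₂, m₁]
    · exact h₁.congr (fun r hr => r₂ r (by omega)) m₂
  have hpos : ∀ e : Expr, e.eval N A v < 2 ^ w := fun e => by
    have := e.eval_lt hN hA hv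
    omega
  have hlt := fun e : Expr => e.eval_lt hN hA hv
  induction e with
  | var l =>
    intro s t h ht
    simp only [Expr.compile]
    by_cases hl : l < v.length
    · rw [if_pos hl]
      refine ⟨_, _, .move _ _ _, le_rfl, ?_, ?_, rfl⟩
      · simp [State.setReg, Expr.eval, h.counter l hl, hl]
      · intro r hr; simp [State.setReg, Function.update, hr.ne]
    · rw [if_neg hl]
      refine ⟨_, _, .const _ _ _ (by omega), le_rfl, ?_, ?_, rfl⟩
      · simp only [State.setReg, Expr.eval, List.getD_eq_default v 0 (not_lt.1 hl),
          Function.update_self]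
      · intro r hr; simp [State.setReg, Function.update, hr.ne]
  | lit k =>
    intro s t h ht
    refine ⟨_, _, .const _ _ _ (by omega), le_rfl, ?_, ?_, rfl⟩
    · simp [State.setReg, Expr.eval]
    · intro r hr; simp [State.setReg, Function.update, hr.ne]
  | add a b iha ihb =>
    intro s t h ht
    obtain ⟨s₁, s₂, c₁, c₂, x₁, x₂, l₁, l₂, va, vb, r₂, m₂, h₂⟩ := two iha ihb h ht
    have h1 : (1 : ℕ) ≠ t := by omega
    by_cases hab : a.eval N A v + b.eval N A v < N
    · refine ⟨_, _, .seq _ _ _ _ _ c₁ _ x₁ <| .seq _ _ _ _ _ c₂ _ x₂ <| .seq _ _ _ _ _ 1 _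
        (.sub _ _ _ _) <| .branch_true _ _ _ _ _ _ ?_ (.add _ _ _ _ ?_), ?_, ?_, ?_, ?_⟩
      -- The machine tests `b < N - a`, which is equivalent to `a + b < N`.
      · simp [Cond.Holds, State.setReg, Function.update, va, vb, h₂.size]; omega
      · simp [State.setReg, Function.update, va, vb]; omega
      · simp only [Expr.cost]; omega
      · simp [State.setReg, Expr.eval, va, vb, hab]
      · intro r hr; simp [State.setReg, Function.update, hr.ne, r₂ r hr]; omega
      · exact m₂
    · refine ⟨_, _, .seq _ _ _ _ _ c₁ _ x₁ <| .seq _ _ _ _ _ c₂ _ x₂ <| .seq _ _ _ _ _ 1 _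
        (.sub _ _ _ _) <| .branch_false _ _ _ _ _ _ ?_ (.const _ _ _ (by omega)), ?_, ?_, ?_, ?_⟩
      · simp [Cond.Holds, State.setReg, Function.update, va, vb, h₂.size]; omega
      · simp only [Expr.cost]; omega
      · simp [State.setReg, Expr.eval, hab]
      · intro r hr; simp [State.setReg, Function.update, hr.ne, r₂ r hr]; omega
      · exact m₂
  | sub a b iha ihb =>
    intro s t h ht
    obtain ⟨s₁, s₂, c₁, c₂, x₁, x₂, l₁, l₂, va, vb, r₂, m₂, h₂⟩ := two iha ihb h ht
    refine ⟨_, _, .seq _ _ _ _ _ c₁ _ x₁ <| .seq _ _ _ _ _ c₂ _ x₂ (.sub _ _ _ _), ?_, ?_, ?_, ?_⟩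
    · simp only [Expr.cost]; omega
    · simp [State.setReg, Expr.eval, va, vb]
    · intro r hr; simp [State.setReg, Function.update, hr.ne, r₂ r hr]
    · exact m₂
  | get k a b iha ihb =>
    intro s t h ht
    obtain ⟨s₁, s₂, c₁, c₂, x₁, x₂, l₁, l₂, va, vb, r₂, m₂, h₂⟩ := two iha ihb h ht
    obtain ⟨s₃, x₃, v₃, r₃, m₃⟩ := exec_addrProg hw h₂ k ht (by rw [va]; exact hlt a)
      (by rw [vb]; exact hlt b)
    refine ⟨_, _, .seq _ _ _ _ _ c₁ _ x₁ <| .seq _ _ _ _ _ c₂ _ x₂ <| .seq _ _ _ _ _ 9 _ x₃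
      (.load _ _ _), ?_, ?_, ?_, ?_⟩
    · simp only [Expr.cost]; omega
    · simp only [State.setReg, Expr.eval, Function.update_self]
      rw [v₃, m₃, va, vb, h₂.cell _ _ (hlt a) _ (hlt b)]
    · intro r hr
      simp only [State.setReg, Function.update, hr.ne]
      rw [← r₂ r hr, ← r₃ r hr.ne (by omega)]
      simp
    · rw [← m₂, ← m₃]; rfl
  | iflt a b c d iha ihb ihc ihd =>
    intro s t h ht
    obtain ⟨s₁, s₂, c₁, c₂, x₁, x₂, l₁, l₂, va, vb, r₂, m₂, h₂⟩ := two iha ihb h ht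
    by_cases hab : a.eval N A v < b.eval N A v
    · obtain ⟨s₃, c₃, x₃, l₃, v₃, r₃, m₃⟩ := ihc h₂ ht
      refine ⟨_, _, .seq _ _ _ _ _ c₁ _ x₁ <| .seq _ _ _ _ _ c₂ _ x₂ <| .branch_true _ _ _ _ _ _
        ?_ x₃, ?_, ?_, ?_, ?_⟩
      · simpa [Cond.Holds, va, vb] using hab
      · simp only [Expr.cost]; omega
      · simp [Expr.eval, v₃, hab]
      · intro r hr; rw [r₃ r hr, r₂ r hr]
      · rw [m₃, m₂]
    · obtain ⟨s₃, c₃, x₃, l₃, v₃, r₃, m₃⟩ := ihd h₂ ht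
      refine ⟨_, _, .seq _ _ _ _ _ c₁ _ x₁ <| .seq _ _ _ _ _ c₂ _ x₂ <| .branch_false _ _ _ _ _ _
        ?_ x₃, ?_, ?_, ?_, ?_⟩
      · simpa [Cond.Holds, va, vb] using hab
      · simp only [Expr.cost]; omega
      · simp [Expr.eval, v₃, hab]
      · intro r hr; rw [r₃ r hr, r₂ r hr]
      · rw [m₃, m₂]
  | ifeq a b c d iha ihb ihc ihd =>
    intro s t h ht
    obtain ⟨s₁, s₂, c₁, c₂, x₁, x₂, l₁, l₂, va, vb, r₂, m₂, h₂⟩ := two iha ihb h ht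
    by_cases hab : a.eval N A v = b.eval N A v
    · obtain ⟨s₃, c₃, x₃, l₃, v₃, r₃, m₃⟩ := ihc h₂ ht
      refine ⟨_, _, .seq _ _ _ _ _ c₁ _ x₁ <| .seq _ _ _ _ _ c₂ _ x₂ <| .branch_true _ _ _ _ _ _
        ?_ x₃, ?_, ?_, ?_, ?_⟩
      · simpa [Cond.Holds, va, vb] using hab
      · simp only [Expr.cost]; omega
      · simp [Expr.eval, v₃, hab]
      · intro r hr; rw [r₃ r hr, r₂ r hr]
      · rw [m₃, m₂]
    · obtain ⟨s₃, c₃, x₃, l₃, v₃, r₃, m₃⟩ := ihd h₂ ht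
      refine ⟨_, _, .seq _ _ _ _ _ c₁ _ x₁ <| .seq _ _ _ _ _ c₂ _ x₂ <| .branch_false _ _ _ _ _ _
        ?_ x₃, ?_, ?_, ?_, ?_⟩
      · simpa [Cond.Holds, va, vb] using hab
      · simp only [Expr.cost]; omega
      · simp [Expr.eval, v₃, hab]
      · intro r hr; rw [r₃ r hr, r₂ r hr]
      · rw [m₃, m₂]

theorem Represents.setCell {N : ℕ} {A : Tables} {v : List ℕ} {s : State}
    (h : Represents N A v s) (k : Fin 16) {i j : ℕ} (hi : i < N) (hj : j < N) (x : ℕ) :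
    Represents N (A.set k i j x) v (s.setMem (2 * N + 16 * (N * i) + 16 * j + k) x) where
  size := h.size
  one := h.one
  row i' hi' := by
    simp only [State.setMem]
    rw [Function.update_of_ne (by omega), h.row i' hi']
  cell k' i' hi' j' hj' := by
    simp only [State.setMem, Tables.set]
    by_cases e : k' = k ∧ i' = i ∧ j' = j
    · obtain ⟨rfl, rfl, rfl⟩ := e
      simp
    · rw [if_neg e, Function.update_of_ne, h.cell k' i' hi' j' hj']
      intro e'
      apply e
      -- Addresses determine cells: the residue modulo 16 gives the table, and division by `N` then
      -- gives the row.
      have h2 : N * i' + j' = N * i + j ∧ (k' : ℕ) = k := by omega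
      have h3 : i' = i := by
        have := congrArg (· / N) h2.1
        simpa [Nat.mul_add_div (show N > 0 by omega), Nat.div_eq_of_lt hj, Nat.div_eq_of_lt hj']
          using this
      subst h3
      exact ⟨Fin.ext h2.2, rfl, by omega⟩
  counter := h.counter

theorem Stmt.exec_compile {N w : ℕ} (hN : 4 ≤ N) (hw : 2 * N + 16 * (N * N) < 2 ^ w) (p : Stmt) :
    ∀ {A : Tables} {v : List ℕ} {s : State}, A.Bounded N → (∀ x ∈ v, x < N) →
      Represents N A v s → ∃ s' c, Exec w (p.compile v.length) s s' c ∧ c ≤ p.cost N ∧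
        Represents N (p.run N v A) v s' ∧ ∀ r < 4 + 2 * v.length, s'.reg r = s.reg r := by
  induction p with
  | assign k i j e =>
    intro A v s hA hv h
    obtain ⟨s₁, c₁, x₁, l₁, v₁, r₁, m₁⟩ := i.exec_compile hN hw hA hv h le_rfl
    have h₁ := h.congr r₁ m₁
    obtain ⟨s₂, c₂, x₂, l₂, v₂, r₂, m₂⟩ := j.exec_compile hN hw hA hv h₁
      (t := 4 + 2 * v.length + 1) (by omega)
    have h₂ := h₁.congr (fun r hr => r₂ r (by omega)) m₂
    obtain ⟨s₃, c₃, x₃, l₃, v₃, r₃, m₃⟩ := e.exec_compile hN hw hA hv h₂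
      (t := 4 + 2 * v.length + 2) (by omega)
    have h₃ := h₂.congr (fun r hr => r₃ r (by omega)) m₃
    have hi := i.eval_lt hN hA hv
    have hj := j.eval_lt hN hA hv
    have vi : s₃.reg (4 + 2 * v.length) = i.eval N A v := by
      rw [r₃ _ (by omega), r₂ _ (by omega), v₁]
    have vj : s₃.reg (4 + 2 * v.length + 1) = j.eval N A v := by
      rw [r₃ _ (by omega), v₂]
    obtain ⟨s₄, x₄, v₄, r₄, m₄⟩ := exec_addrProg hw h₃ k le_rfl (by rw [vi]; exact hi)
      (by rw [vj]; exact hj)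
    have h₄ := h₃.congr (fun r hr => r₄ r (by omega) (by omega)) m₄
    refine ⟨_, _, .seq _ _ _ _ _ c₁ _ x₁ <| .seq _ _ _ _ _ c₂ _ x₂ <| .seq _ _ _ _ _ c₃ _ x₃ <|
      .seq _ _ _ _ _ 9 _ x₄ (.store _ _ _), ?_, ?_, ?_⟩
    · simp only [Stmt.cost]; omega
    · rw [v₄, vi, vj, r₄ _ (by omega) (by omega), v₃]
      exact h₄.setCell k hi hj _
    · intro r hr
      change s₄.reg r = _
      rw [r₄ _ (by omega) (by omega), r₃ _ (by omega), r₂ _ (by omega), r₁ _ (by omega)]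
  | seq p q ihp ihq =>
    intro A v s hA hv h
    obtain ⟨s₁, c₁, x₁, l₁, h₁, r₁⟩ := ihp hA hv h
    obtain ⟨s₂, c₂, x₂, l₂, h₂, r₂⟩ := ihq (p.run_bounded hN hA hv) hv h₁
    refine ⟨_, _, .seq _ _ _ _ _ c₁ _ x₁ x₂, ?_, h₂, fun r hr => ?_⟩
    · simp only [Stmt.cost]; omega
    · rw [r₂ r hr, r₁ r hr]
  | loop b p ih =>
    intro A v s hA hv h
    obtain ⟨s₁, c₁, x₁, l₁, v₁, r₁, m₁⟩ := b.exec_compile hN hw hA hv h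
      (t := 4 + 2 * v.length + 1) (by omega)
    have h₁ := h.congr (fun r hr => r₁ r (by omega)) m₁
    have hb := b.eval_lt hN hA hv
    simp only [Stmt.run]
    generalize b.eval N A v = m at *
    -- Induction on the number `k` of rounds that remain; `i` rounds are done and have produced the
    -- tables `B`.
    have key : ∀ k i B s, k + i = m → Tables.Bounded N B → Represents N B v s →
        s.reg (4 + 2 * v.length) = i → s.reg (4 + 2 * v.length + 1) = m →
        B = Nat.rec (motive := fun _ => Tables) A (fun i B => p.run N (v ++ [i]) B) i →
        ∃ s' c, Exec w (.loop (.lt (4 + 2 * v.length) (4 + 2 * v.length + 1))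
          (.seq (p.compile (v.length + 1)) (.add (4 + 2 * v.length) (4 + 2 * v.length) 2))) s s' c ∧
          c ≤ 1 + k * (p.cost N + 2) ∧
          Represents N (Nat.rec (motive := fun _ => Tables) A
            (fun i B => p.run N (v ++ [i]) B) m) v s' ∧
          ∀ r < 4 + 2 * v.length, s'.reg r = s.reg r := by
      intro k
      induction k with
      | zero =>
        intro i B s hk hB hs hi hm e
        obtain rfl : i = m := by omega
        refine ⟨s, 1, .loop_false _ _ _ ?_, by omega, e ▸ hs, fun _ _ => rfl⟩
        simp [Cond.Holds, hi, hm]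
      | succ k ihk =>
        intro i B s hk hB hs hi hm e
        have hvi : ∀ x ∈ v ++ [i], x < N := by
          intro x hx
          simp only [List.mem_append, List.mem_singleton] at hx
          rcases hx with hx | rfl
          exacts [hv x hx, by omega]
        -- The register that controls the loop is the one in which the body expects its new counter.
        have hs' : Represents N B (v ++ [i]) s := by
          refine ⟨hs.size, hs.one, hs.row, hs.cell, fun l hl => ?_⟩
          by_cases hl' : l < v.length
          · rw [List.getElem_append_left hl', hs.counter l hl']
          · have : l = v.length := by simp at hl; omega
            subst this
            simpa using hi
        obtain ⟨s₂, c₂, x₂, l₂, h₂, r₂⟩ := ih hB hvi hs'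
        simp only [List.length_append, List.length_singleton] at x₂ r₂
        have e1 : s₂.reg 2 = 1 := h₂.one
        have e2 : s₂.reg (4 + 2 * v.length) = i := by rw [r₂ _ (by omega), hi]
        have e3 : s₂.reg (4 + 2 * v.length + 1) = m := by rw [r₂ _ (by omega), hm]
        obtain ⟨s₃, c₃, x₃, l₃, h₃, r₃⟩ := ihk (i + 1) (p.run N (v ++ [i]) B)
          (s₂.setReg (4 + 2 * v.length) (i + 1)) (by omega) (p.run_bounded hN hB hvi)
          (Represents.congr ⟨h₂.size, h₂.one, h₂.row, h₂.cell, fun l hl => by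
              rw [h₂.counter l (by simp; omega), List.getElem_append_left hl]⟩
            (fun r hr => by simp [State.setReg, Function.update, hr.ne]) rfl)
          (by simp [State.setReg]) (by simp [State.setReg, Function.update, e3]) (by rw [e])
        have x₄ : Exec w (.add (4 + 2 * v.length) (4 + 2 * v.length) 2) s₂
            (s₂.setReg (4 + 2 * v.length) (i + 1)) 1 := by
          have := Exec.add (w := w) s₂ (4 + 2 * v.length) (4 + 2 * v.length) 2
            (by rw [e1, e2]; omega)
          rwa [e1, e2] at this
        refine ⟨s₃, _, .loop_true _ _ _ _ _ _ _ ?_ (.seq _ _ _ _ _ _ _ x₂ x₄) x₃, ?_,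
          h₃, fun r hr => ?_⟩
        · simp only [Cond.Holds, hi, hm]; omega
        · rw [Nat.succ_mul]; omega
        · rw [r₃ r hr, ← r₂ r (by omega)]
          simp [State.setReg, Function.update, hr.ne]
    obtain ⟨s₂, c₂, x₂, l₂, h₂, r₂⟩ := key m 0 A (s₁.setReg (4 + 2 * v.length) 0) rfl hA
      (h₁.congr (fun r hr => by simp [State.setReg, Function.update, hr.ne]) rfl)
      (by simp [State.setReg]) (by simp [State.setReg, Function.update, v₁]) rfl
    refine ⟨s₂, _, .seq _ _ _ _ _ c₁ _ x₁ <| .seq _ _ _ _ _ 1 _ (.const _ _ _ (by omega)) x₂, ?_,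
      h₂, fun r hr => ?_⟩
    · have := Nat.mul_le_mul_right (p.cost N + 2) hb.le
      simp only [Stmt.cost]; omega
    · rw [r₂ r hr, ← r₁ r (by omega)]
      simp [State.setReg, Function.update, hr.ne]

/-! ### Running time of the translation. -/

/-- Loop bounds are values of expressions, hence below `N`, so every nesting level contributes one
factor `N`. -/
theorem Stmt.exists_cost_le (p : Stmt) : ∃ C, ∀ N, 1 ≤ N → p.cost N ≤ C * N ^ p.depth := by
  induction p with
  | assign k i j e => exact ⟨i.cost + j.cost + e.cost + 10, fun N _ => by simp [cost, depth]⟩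
  | seq p q ihp ihq =>
    obtain ⟨C, hC⟩ := ihp
    obtain ⟨D, hD⟩ := ihq
    refine ⟨C + D, fun N hN => ?_⟩
    simp only [cost, depth, add_mul]
    have h1 := Nat.pow_le_pow_right hN (le_max_left p.depth q.depth)
    have h2 := Nat.pow_le_pow_right hN (le_max_right p.depth q.depth)
    exact add_le_add ((hC N hN).trans (Nat.mul_le_mul_left _ h1))
      ((hD N hN).trans (Nat.mul_le_mul_left _ h2))
  | loop b p ih =>
    obtain ⟨C, hC⟩ := ih
    refine ⟨b.cost + 2 + C + 2, fun N hN => ?_⟩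
    simp only [cost, depth, pow_succ]
    have h1 := Nat.one_le_pow p.depth N hN
    have h2 := Nat.mul_le_mul_left N (hC N hN)
    have h3 : N ≤ N ^ p.depth * N := Nat.le_mul_of_pos_left _ h1
    have h4 := Nat.mul_le_mul_left (b.cost + 2) (hN.trans h3)
    nlinarith

end TrailTrap

/-! ### Loading the input into the tables, and the word size. -/

namespace TrailTrap

/-- The tables at the start: column `0` of table `0` holds the input. -/
def inputTables (n : ℕ) (L : List (Fin n × Fin n)) : Tables :=
  fun k i j => if k = 0 ∧ j = 0 then (inputWords n L).getD i 0 else 0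

/-- The body of the loop of `setupProg`. -/
def setupBody : Prog :=
  .seq (.add 6 1 3) <| .seq (.store 6 4) <| .seq (.load 7 3) <| .seq (.store 4 7) <|
  .seq (.add 4 4 5) (.add 3 3 2)

/-- The program that turns the input into a representation of the tables `inputTables`. -/
def setupProg : Prog :=
  .seq (.load 1 0) <| .seq (.const 2 1) <| .seq (.add 1 1 1) <| .seq (.add 1 1 2) <|
  .seq (.add 1 1 2) <| .seq (.add 4 1 1) <| .seq (.add 5 1 1) <| .seq (.add 5 5 5) <|
  .seq (.add 5 5 5) <| .seq (.add 5 5 5) <| .loop (.lt 3 1) setupBody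

theorem exec_setupBody {N w i : ℕ} (hw : 2 * N + 16 * (N * N) < 2 ^ w) {s : State}
    (h1 : s.reg 1 = N) (h2 : s.reg 2 = 1) (h3 : s.reg 3 = i)
    (h4 : s.reg 4 = 2 * N + 16 * (N * i)) (h5 : s.reg 5 = 16 * N) (hi : i < N) :
    ∃ s', Exec w setupBody s s' 6 ∧ s'.reg 1 = N ∧ s'.reg 2 = 1 ∧ s'.reg 3 = i + 1 ∧
      s'.reg 4 = 2 * N + 16 * (N * (i + 1)) ∧ s'.reg 5 = 16 * N ∧
      s'.mem = Function.update (Function.update s.mem (N + i) (2 * N + 16 * (N * i)))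
        (2 * N + 16 * (N * i)) (s.mem i) := by
  have hNN : N * (i + 1) ≤ N * N := Nat.mul_le_mul_left _ hi
  have hm : N ≤ N * N := Nat.le_mul_of_pos_left _ (by omega)
  rw [Nat.mul_add] at hNN ⊢
  refine ⟨_, .seq _ _ _ _ _ 1 5 (.add _ _ _ _ ?_) <| .seq _ _ _ _ _ 1 4 (.store _ _ _) <|
    .seq _ _ _ _ _ 1 3 (.load _ _ _) <| .seq _ _ _ _ _ 1 2 (.store _ _ _) <|
    .seq _ _ _ _ _ 1 1 (.add _ _ _ _ ?_) (.add _ _ _ _ ?_), ?_, ?_, ?_, ?_, ?_, ?_⟩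
  all_goals
    simp [State.setReg, State.setMem, Function.update, h1, h2, h3, h4, h5]
  all_goals try omega
  all_goals
    funext a
    split_ifs <;> omega

/-- Column 0 of table 0 consists of the addresses `2 * N + a` with `a` a multiple of `16 * N`. The
invariant says that beyond `2 * N` exactly the first `i` of these have been filled, and that the
input, which lies below `N`, is still intact. -/
theorem exec_setupLoop {N w : ℕ} (hw : 2 * N + 16 * (N * N) < 2 ^ w) {m : ℕ → ℕ}
    (hm : ∀ i, 2 * N ≤ i → m i = 0) :
    ∀ k i (s : State), k + i = N → s.reg 1 = N → s.reg 2 = 1 → s.reg 3 = i →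
      s.reg 4 = 2 * N + 16 * (N * i) → s.reg 5 = 16 * N →
      (∀ l < N, s.mem l = m l) →
      (∀ l < i, s.mem (N + l) = 2 * N + 16 * (N * l)) →
      (∀ a, s.mem (2 * N + a) = if 16 * N ∣ a ∧ a < 16 * (N * i) then m (a / (16 * N)) else 0) →
      ∃ s', Exec w (.loop (.lt 3 1) setupBody) s s' (7 * k + 1) ∧ s'.reg 1 = N ∧ s'.reg 2 = 1 ∧
        (∀ l < N, s'.mem (N + l) = 2 * N + 16 * (N * l)) ∧
        (∀ a, s'.mem (2 * N + a) =
          if 16 * N ∣ a ∧ a < 16 * (N * N) then m (a / (16 * N)) else 0) := by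
  intro k
  induction k with
  | zero =>
    intro i s hk h1 h2 h3 h4 h5 hin hrow hcell
    obtain rfl : i = N := by omega
    exact ⟨s, .loop_false _ _ _ (by simp [Cond.Holds, h1, h3]), h1, h2, hrow, hcell⟩
  | succ k ih =>
    intro i s hk h1 h2 h3 h4 h5 hin hrow hcell
    obtain ⟨s₁, x₁, h1', h2', h3', h4', h5', hm'⟩ := exec_setupBody hw h1 h2 h3 h4 h5 (by omega)
    have hN : 0 < N := by omega
    have hil : ∀ l, l < i → N * l < N * i := fun l hl => Nat.mul_lt_mul_of_pos_left hl hN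
    obtain ⟨s₂, x₂, r⟩ := ih (i + 1) s₁ (by omega) h1' h2' h3' h4' h5'
      (fun l hl => by
        rw [hm', Function.update_of_ne (by omega), Function.update_of_ne (by omega), hin l hl])
      (fun l hl => by
        rw [hm', Function.update_of_ne (by omega)]
        by_cases e : l = i
        · rw [e, Function.update_self]
        · rw [Function.update_of_ne (by omega), hrow l (by omega)])
      (fun a => by
        rw [hm']
        by_cases e : a = 16 * (N * i)
        · have : a = 16 * N * i := by rw [e, Nat.mul_assoc]
          rw [e, Function.update_self, if_pos ⟨⟨i, by rw [Nat.mul_assoc]⟩, by rw [Nat.mul_add]; omega⟩,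
            hin i (by omega), ← Nat.mul_assoc, Nat.mul_div_cancel_left _ (by omega)]
        · rw [Function.update_of_ne (by omega), Function.update_of_ne (by omega), hcell]
          refine if_congr (and_congr_right ?_) rfl rfl
          rintro ⟨c, rfl⟩
          rw [← Nat.mul_assoc, ← Nat.mul_assoc, Nat.mul_lt_mul_left (by omega),
            Nat.mul_lt_mul_left (by omega)]
          have : c ≠ i := by rintro rfl; exact e (Nat.mul_assoc _ _ _)
          omega)
    refine ⟨s₂, ?_, r⟩
    have := Exec.loop_true (.lt 3 1) _ _ _ _ _ _ (by simp [Cond.Holds, h1, h3]; omega) x₁ x₂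
    rwa [show 6 + (7 * k + 1) + 1 = 7 * (k + 1) + 1 by omega] at this

theorem length_inputWords (n : ℕ) (L : List (Fin n × Fin n)) :
    (inputWords n L).length = 2 * L.length + 1 := by
  simp [inputWords, List.length_flatMap, Nat.mul_comm]

theorem inputWords_le {n x : ℕ} {L : List (Fin n × Fin n)} (h : x ∈ inputWords n L) : x ≤ n := by
  simp only [inputWords, List.mem_cons, List.mem_flatMap, List.not_mem_nil, or_false] at h
  rcases h with rfl | ⟨e, -, rfl | rfl⟩ <;> omega

theorem inputTables_bounded (n : ℕ) (L : List (Fin n × Fin n)) :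
    (inputTables n L).Bounded (2 * n + 2) := by
  intro k i j
  simp only [inputTables]
  split_ifs
  · by_cases h : i < (inputWords n L).length
    · rw [List.getD_eq_getElem _ _ h]
      have := inputWords_le (List.getElem_mem h)
      omega
    · rw [List.getD_eq_default _ _ (by omega)]; omega
  · omega

/-- The choice `N = 2 * n + 2` exceeds the number of input words, every index `2 * j + 2` of such a
word, and every sum of two trail lengths. The loop starts with the first row address `2 * N` in
register 4 and the row stride `16 * N` in register 5. -/
theorem exec_setupProg {n w : ℕ} (hw : 2 * (2 * n + 2) + 16 * ((2 * n + 2) * (2 * n + 2)) < 2 ^ w)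
    {L : List (Fin n × Fin n)} (hL : L.length ≤ n) :
    ∃ s, Exec w setupProg (initState n L) s (10 + (7 * (2 * n + 2) + 1)) ∧
      Represents (2 * n + 2) (inputTables n L) [] s := by
  have hm : 2 * n + 2 ≤ (2 * n + 2) * (2 * n + 2) := Nat.le_mul_of_pos_left _ (by omega)
  have hin : ∀ i, 2 * (2 * n + 2) ≤ i → (inputWords n L).getD i 0 = 0 := fun i hi =>
    List.getD_eq_default _ _ (by rw [length_inputWords]; omega)
  obtain ⟨s', x, h1, h2, hr, hc⟩ := exec_setupLoop hw (m := fun i => (inputWords n L).getD i 0)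
    hin (2 * n + 2) 0
    { reg := fun r => if r = 1 then 2 * n + 2 else if r = 2 then 1 else
        if r = 4 then 2 * (2 * n + 2) else if r = 5 then 16 * (2 * n + 2) else 0
      mem := (initState n L).mem } rfl rfl rfl rfl rfl rfl (fun _ _ => rfl)
    (fun l hl => by omega) (fun a => by
      rw [if_neg (by omega)]
      exact hin _ (by omega))
  refine ⟨s', ?_, h1, h2, hr, ?_, fun l hl => by simp at hl⟩
  · have hn : (inputWords n L).getD 0 0 = n := rfl
    have e0 : 10 + (7 * (2 * n + 2) + 1) = 1 + (1 + (1 + (1 + (1 + (1 + (1 + (1 + (1 + (1 +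
      (7 * (2 * n + 2) + 1)))))))))) := by omega
    rw [e0]
    refine .seq _ _ _ _ _ 1 _ (.load _ _ _) <| .seq _ _ _ _ _ 1 _ (.const _ _ _ ?_) <|
      .seq _ _ _ _ _ 1 _ (.add _ _ _ _ ?_) <| .seq _ _ _ _ _ 1 _ (.add _ _ _ _ ?_) <|
      .seq _ _ _ _ _ 1 _ (.add _ _ _ _ ?_) <| .seq _ _ _ _ _ 1 _ (.add _ _ _ _ ?_) <|
      .seq _ _ _ _ _ 1 _ (.add _ _ _ _ ?_) <| .seq _ _ _ _ _ 1 _ (.add _ _ _ _ ?_) <|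
      .seq _ _ _ _ _ 1 _ (.add _ _ _ _ ?_) <| .seq _ _ _ _ _ 1 _ (.add _ _ _ _ ?_) ?_
    on_goal 10 =>
      convert x using 1
      simp only [State.setReg, initState, hn]
      congr 1
      funext r
      simp only [Function.update]
      by_cases e1 : r = 1
      · simp [e1]; omega
      by_cases e2 : r = 2
      · simp [e2]
      by_cases e4 : r = 4
      · simp [e4]; omega
      by_cases e5 : r = 5
      · simp [e5]; omega
      simp [e1, e2, e4, e5]
    on_goal 1 => omega
    all_goals
      simp only [State.setReg, initState, Function.update, hn]
      simp
      omega
  · intro k i hi j hj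
    rw [Nat.add_assoc, Nat.add_assoc, hc]
    set N := 2 * n + 2
    have hlt := cell_lt hi hj k.2
    have hk := k.2
    have hdvd : 16 * N ∣ 16 * (N * i) + (16 * j + k) ↔ 16 * j + (k : ℕ) = 0 := by
      rw [← Nat.mul_assoc, Nat.dvd_add_right ⟨i, rfl⟩]
      exact ⟨fun h => Nat.eq_zero_of_dvd_of_lt h (by omega), fun h => h ▸ dvd_zero _⟩
    simp only [inputTables]
    have hk0 : (k : ℕ) = 0 ↔ k = 0 := by rw [Fin.ext_iff]; rfl
    by_cases e : k = 0 ∧ j = 0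
    · rw [if_pos e, if_pos ⟨hdvd.2 (by have := hk0.2 e.1; omega), by omega⟩]
      obtain ⟨rfl, rfl⟩ := e
      congr 1
      simp only [Fin.val_zero, Nat.mul_zero, Nat.add_zero]
      rw [← Nat.mul_assoc, Nat.mul_div_cancel_left _ (by omega)]
    · rw [if_neg e, if_neg]
      rintro ⟨h, -⟩
      have := hdvd.1 h
      exact e ⟨hk0.1 (by omega), by omega⟩

/-- With `b` bits for `n`, one has `N ≤ 2 ^ (b + 1)`, so the memory in use ends below `2 ^ (2 * b +
7)`; since `b ≥ 1`, this is at most `2 ^ (12 * b)`. -/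
theorem word_size_sufficient {n : ℕ} (hn : 1 ≤ n) :
    2 * (2 * n + 2) + 16 * ((2 * n + 2) * (2 * n + 2)) < 2 ^ (12 * n.size) := by
  have h1 := Nat.lt_size_self n
  have h2 : 1 ≤ n.size := Nat.size_pos.2 hn
  generalize n.size = b at *
  have h3 : 2 * n + 2 ≤ 2 ^ (b + 1) := by rw [pow_succ]; omega
  have h4 : (2 * n + 2) * (2 * n + 2) ≤ 2 ^ (2 * b + 2) := by
    calc _ ≤ 2 ^ (b + 1) * 2 ^ (b + 1) := Nat.mul_le_mul h3 h3
      _ = 2 ^ (2 * b + 2) := by rw [← pow_add]; congr 1; omega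
  have h5 : 2 ^ (b + 1) ≤ 2 ^ (2 * b + 2) := Nat.pow_le_pow_right (by omega) (by omega)
  have h6 : 2 ^ (2 * b + 7) ≤ 2 ^ (12 * b) := Nat.pow_le_pow_right (by omega) (by omega)
  have h7 : 2 ^ (2 * b + 7) = 32 * 2 ^ (2 * b + 2) := by
    rw [show 2 * b + 7 = 2 * b + 2 + 5 by omega, pow_add]; omega
  have h8 : 1 ≤ 2 ^ (2 * b + 2) := Nat.one_le_two_pow
  omega

/-- Every statement with at most doubly nested loops can be run on the input in quadratic time. -/
theorem Stmt.exists_prog (p : Stmt) (hp : p.depth ≤ 2) (out : Expr) :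
    ∃ (P : Prog) (C : ℕ), ∀ n, 1 ≤ n → ∀ L : List (Fin n × Fin n), L.length ≤ n →
      ∃ s t, Exec (12 * n.size) P (initState n L) s t ∧ t ≤ C * n ^ 2 ∧
        s.reg 0 = out.eval (2 * n + 2) (p.run (2 * n + 2) [] (inputTables n L)) [] := by
  obtain ⟨C, hC⟩ := p.exists_cost_le
  -- The setup takes `14 * n + 25 ≤ 39 * n ^ 2` steps, the statement at most `C * N ^ 2 ≤ 16 * C * n
  -- ^ 2` because `N ≤ 4 * n`, and the final 1 is the copy into the output register.
  refine ⟨.seq setupProg <| .seq (p.compile 0) <| .seq (out.compile 0 4) (.move 0 4),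
    39 + 16 * C + out.cost + 1, fun n hn L hL => ?_⟩
  have hw := word_size_sufficient hn
  have hA := inputTables_bounded n L
  obtain ⟨s₁, x₁, h₁⟩ := exec_setupProg hw hL
  obtain ⟨s₂, c₂, x₂, l₂, h₂, -⟩ := p.exec_compile (by omega) hw hA (by simp) h₁
  obtain ⟨s₃, c₃, x₃, l₃, v₃, -, -⟩ := out.exec_compile (by omega) hw
    (p.run_bounded (by omega) hA (by simp)) (v := []) (by simp) h₂ le_rfl
  refine ⟨_, _, .seq _ _ _ _ _ _ _ x₁ <| .seq _ _ _ _ _ _ _ x₂ <| .seq _ _ _ _ _ _ _ x₃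
    (.move _ _ _), ?_, ?_⟩
  · have h1 : p.cost (2 * n + 2) ≤ C * (16 * n ^ 2) := by
      refine (hC _ (by omega)).trans (Nat.mul_le_mul_left _ ?_)
      refine (Nat.pow_le_pow_right (by omega) hp).trans ?_
      nlinarith
    have h2 : n ≤ n ^ 2 := Nat.le_self_pow (by omega) n
    have h3 : out.cost * 1 ≤ out.cost * n ^ 2 := Nat.mul_le_mul_left _ (by omega)
    nlinarith
  · simp only [State.setReg, Function.update_self]
    exact v₃

end TrailTrap

namespace TrailTrap

/-! ### Directions in a tree -/

section Tree

variable {V : Type*} {T : SimpleGraph V}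

open Classical in
/-- The neighbour of `u` on the way to `v`; it is `u` itself if `u = v`. -/
noncomputable def next (T : SimpleGraph V) (u v : V) : V :=
  if h : ∃ w, T.Adj u w ∧ T.dist w v + 1 = T.dist u v then h.choose else u

theorem next_self (u : V) : next T u u = u := by
  rw [next, dif_neg]
  rintro ⟨w, -, h⟩
  simp at h

theorem adj_next_and_dist_next (hT : T.IsTree) {u v : V} (h : u ≠ v) :
    T.Adj u (next T u v) ∧ T.dist (next T u v) v + 1 = T.dist u v := by
  have : ∃ w, T.Adj u w ∧ T.dist w v + 1 = T.dist u v := by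
    obtain ⟨p, hp⟩ := hT.connected.exists_walk_length_eq_dist u v
    cases p with
    | nil => exact absurd rfl h
    | cons hadj q =>
      refine ⟨_, hadj, ?_⟩
      rw [SimpleGraph.Walk.length_cons] at hp
      have h1 := SimpleGraph.dist_le q
      have h2 := hT.dist_eq_dist_add_one_of_adj v hadj
      rw [SimpleGraph.dist_comm (u := v), SimpleGraph.dist_comm (u := v)] at h2
      omega
  rw [next, dif_pos this]
  exact this.choose_spec

theorem adj_next (hT : T.IsTree) {u v : V} (h : u ≠ v) : T.Adj u (next T u v) :=
  (adj_next_and_dist_next hT h).1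

theorem dist_next (hT : T.IsTree) {u v : V} (h : u ≠ v) :
    T.dist (next T u v) v + 1 = T.dist u v :=
  (adj_next_and_dist_next hT h).2

theorem dist_ne_zero (hT : T.IsTree) {u v : V} (h : u ≠ v) : T.dist u v ≠ 0 := by
  rw [Ne, hT.connected.dist_eq_zero_iff]; exact h

/-- A neighbour of `u` nearer to `v` is the second vertex of a shortest walk, which is a path, and
paths in a tree are unique. -/
theorem next_eq_of_dist (hT : T.IsTree) {u v w : V} (hw : T.Adj u w)
    (h : T.dist w v + 1 = T.dist u v) : next T u v = w := by
  have huv : u ≠ v := by rintro rfl; simp at h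
  have key : ∀ w, T.Adj u w → T.dist w v + 1 = T.dist u v →
      ∃ p : T.Walk u v, p.IsPath ∧ p.snd = w := by
    intro w hw h
    obtain ⟨q, hq⟩ := hT.connected.exists_walk_length_eq_dist w v
    refine ⟨.cons hw q, SimpleGraph.Walk.isPath_of_length_eq_dist _ ?_, by simp⟩
    rw [SimpleGraph.Walk.length_cons, hq, h]
  obtain ⟨p, hp, rfl⟩ := key w hw h
  obtain ⟨q, hq, e⟩ := key _ (adj_next hT huv) (dist_next hT huv)
  rw [← e, (hT.existsUnique_path u v).unique hq hp]

theorem next_eq_iff (hT : T.IsTree) {u w : V} (hw : T.Adj u w) (v : V) :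
    next T u v = w ↔ T.dist w v + 1 = T.dist u v := by
  refine ⟨?_, next_eq_of_dist hT hw⟩
  rintro rfl
  exact dist_next hT fun e => by
    subst e
    rw [next_self] at hw
    exact hw.ne rfl

theorem next_ne_iff (hT : T.IsTree) {u w : V} (hw : T.Adj u w) (v : V) :
    next T u v ≠ w ↔ T.dist w v = T.dist u v + 1 := by
  rw [Ne, next_eq_iff hT hw]
  have h2 := hT.dist_eq_dist_add_one_of_adj v hw
  rw [SimpleGraph.dist_comm (u := v), SimpleGraph.dist_comm (u := v)] at h2
  omega

/-- Every vertex lies on exactly one side of the edge `uw`, since distances to adjacent vertices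
differ by exactly one. Thus `next T u v = w` reads as: `v` is on the side of `w`. -/
theorem next_ne_iff_next_eq (hT : T.IsTree) {u w : V} (hw : T.Adj u w) (v : V) :
    next T u v ≠ w ↔ next T w v = u := by
  rw [next_ne_iff hT hw, next_eq_iff hT hw.symm, eq_comm]

theorem next_of_adj (hT : T.IsTree) {u v : V} (h : T.Adj u v) : next T u v = v := by
  rw [next_eq_iff hT h, SimpleGraph.dist_self, SimpleGraph.dist_eq_one_iff_adj.2 h]

/-- At distance one the two facing moves would run along the same edge. -/
theorem two_le_dist_of_facing (hT : T.IsTree) {u v x y : V} (huv : T.Adj u v)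
    (hne : s(x, y) ≠ s(u, v)) (h1 : v = next T u x) (h2 : y = next T x u) : 2 ≤ T.dist u x := by
  have hux : u ≠ x := by
    rintro rfl
    rw [next_self] at h1
    exact huv.ne h1.symm
  by_contra hd
  have := dist_ne_zero hT hux
  have h3 : T.Adj u x := SimpleGraph.dist_eq_one_iff_adj.1 (by omega)
  rw [next_of_adj hT h3] at h1
  rw [next_of_adj hT h3.symm] at h2
  subst h1 h2
  exact hne Sym2.eq_swap

theorem next_next_ne (hT : T.IsTree) {u v : V} (h : u ≠ v) : next T (next T u v) v ≠ u := by
  intro e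
  exact (next_ne_iff_next_eq hT (adj_next hT h) v).2 e rfl

theorem next_eq_self_iff (hT : T.IsTree) {u v : V} : next T u v = u ↔ u = v := by
  refine ⟨fun h => ?_, fun h => h ▸ next_self u⟩
  by_contra e
  exact (adj_next hT e).ne h.symm

/-- If the ways from `v` to `x` and to `w` start differently, then `v` is between them. -/
theorem dist_eq_add_and_next_eq (hT : T.IsTree) {x v w : V} (h : x ≠ v → next T v w ≠ next T v x) :
    T.dist x w = T.dist x v + T.dist v w ∧ (x ≠ v → next T x w = next T x v) := by
  induction hk : T.dist v x using Nat.strong_induction_on generalizing v w with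
  | _ k ih =>
    by_cases hx : x = v
    · subst hx; simp
    have hvx : v ≠ x := fun e => hx e.symm
    have hadj := adj_next hT hvx
    have hd := dist_next hT hvx
    have hw := (next_ne_iff_next_eq hT hadj w).1 (h hx)
    have hdw := (next_ne_iff hT hadj w).1 (h hx)
    have hnx := next_next_ne hT hvx
    -- Induction along the way from `v` to `x`: the claim is used for the next vertex with target
    -- `w`, and below once more with target `v`.
    have := ih (T.dist (next T v x) x) (by omega) (v := next T v x)
      (fun _ => by rw [hw]; exact hnx.symm) rfl
    have c1 := SimpleGraph.dist_comm (G := T) (u := x) (v := v)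
    have c2 := SimpleGraph.dist_comm (G := T) (u := x) (v := next T v x)
    refine ⟨by omega, fun _ => ?_⟩
    by_cases hp : x = next T v x
    · rw [← hp] at hw hadj
      rw [hw, next_of_adj hT hadj.symm]
    · rw [this.2 hp]
      refine (ih (T.dist (next T v x) x) (by omega) (v := next T v x) (w := v)
        (fun _ => ?_) rfl).2 hp |>.symm
      rw [next_of_adj hT hadj.symm]
      exact hnx.symm

theorem dist_eq_add (hT : T.IsTree) {x v w : V} (h : x ≠ v → next T v w ≠ next T v x) :
    T.dist x w = T.dist x v + T.dist v w :=
  (dist_eq_add_and_next_eq hT h).1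

theorem next_eq_next (hT : T.IsTree) {x v w : V} (hx : x ≠ v) (h : next T v w ≠ next T v x) :
    next T x w = next T x v :=
  (dist_eq_add_and_next_eq hT fun _ => h).2 hx

theorem next_next_eq_next (hT : T.IsTree) {u x : V} (h : u ≠ x) (h' : next T u x ≠ x) :
    next T x (next T u x) = next T x u := by
  refine (next_eq_next hT h'.symm ?_).symm
  rw [next_of_adj hT (adj_next hT h).symm]
  exact (next_next_ne hT h).symm

/-- Only the edge `pp'` separates adjacent vertices `p` and `p'`. -/
theorem eq_of_adj_of_separated (hT : T.IsTree) {p p' a b : V} (hp : T.Adj p p') (hab : T.Adj a b)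
    (h : next T a p = b) (h' : next T a p' ≠ b) : a = p' ∧ b = p := by
  have h1 := (next_eq_iff hT hab p).1 h
  have h2 := (next_ne_iff hT hab p').1 h'
  have h3 : T.dist b p' ≤ T.dist b p + 1 := by
    have := hT.connected.dist_triangle (u := b) (v := p) (w := p')
    rwa [SimpleGraph.dist_eq_one_iff_adj.2 hp] at this
  have h4 : T.dist a p ≤ T.dist a p' + 1 := by
    have := hT.connected.dist_triangle (u := a) (v := p') (w := p)
    rwa [SimpleGraph.dist_eq_one_iff_adj.2 hp.symm] at this
  have ha : a = p' := by
    by_contra e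
    -- The hypotheses force `p` to be one farther from `a` than `p'`. So the first step from `a`
    -- towards `p'` also leads towards `p`, and it must be `b`.
    have hc := adj_next hT e
    have hd := dist_next hT e
    apply h'
    rw [← h, eq_comm]
    apply next_eq_of_dist hT hc
    have := hT.connected.dist_triangle (u := next T a p') (v := p') (w := p)
    rw [SimpleGraph.dist_eq_one_iff_adj.2 hp.symm] at this
    have := hT.connected.dist_triangle (u := a) (v := next T a p') (w := p)
    rw [SimpleGraph.dist_eq_one_iff_adj.2 hc] at this
    have := (hT.dist_eq_dist_add_one_of_adj p hc)
    rw [SimpleGraph.dist_comm (u := p), SimpleGraph.dist_comm (u := p)] at this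
    omega
  refine ⟨ha, ?_⟩
  subst ha
  rw [← h, next_of_adj hT hp.symm]

/-- The left side says that the edge `ab` does not separate `p` from `p'`; the only edge that
separates adjacent vertices is the one joining them. -/
theorem separated_iff (hT : T.IsTree) {p p' a b : V} (hp : T.Adj p p') (hab : T.Adj a b) :
    (next T a p = b ↔ next T a p' = b) ↔ s(a, b) ≠ s(p, p') := by
  constructor
  · intro h e
    rw [Sym2.eq_iff] at e
    rcases e with ⟨rfl, rfl⟩ | ⟨rfl, rfl⟩
    · rw [next_self, next_of_adj hT hp] at h
      exact hp.ne (h.2 rfl)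
    · rw [next_self, next_of_adj hT hab] at h
      exact hab.ne (h.1 rfl)
  · intro h
    by_contra e
    apply h
    rw [Sym2.eq_iff]
    by_cases h1 : next T a p = b
    · obtain ⟨rfl, rfl⟩ := eq_of_adj_of_separated hT hp hab h1 (fun h2 => e ⟨fun _ => h2, fun _ => h1⟩)
      exact .inr ⟨rfl, rfl⟩
    · have h2 : next T a p' = b := by by_contra h2; exact e ⟨fun h => absurd h h1, fun h => absurd h h2⟩
      obtain ⟨rfl, rfl⟩ := eq_of_adj_of_separated hT hp.symm hab h2 h1
      exact .inl ⟨rfl, rfl⟩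

/-- Vertices on the same side of an edge have everything between them on that side. -/
theorem next_ne_of_between (hT : T.IsTree) {c d q a w : V} (hcd : T.Adj c d)
    (hq : next T c q ≠ d) (hw : next T c w ≠ d) (h : T.dist q a + T.dist a w = T.dist q w) :
    next T c a ≠ d := by
  intro ha
  -- Were `a` beyond the edge `cd`, the detour over `a` would cross this edge twice and be too long.
  have key : ∀ q, next T c q ≠ d → T.dist q a = T.dist q c + 1 + T.dist d a := by
    intro q hq
    have h1 := dist_eq_add hT (x := q) (v := c) (w := a) (fun hqc => by
      rw [ha]; exact hq.symm)
    have h2 := (next_eq_iff hT hcd a).1 ha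
    omega
  have h1 := key q hq
  have h2 := key w hw
  have h3 := hT.connected.dist_triangle (u := q) (v := c) (w := w)
  rw [SimpleGraph.dist_comm (u := w) (v := a), SimpleGraph.dist_comm (u := w) (v := c)] at h2
  omega

theorem dist_eq_add_of_separated (hT : T.IsTree) {a b q w : V}
    (h : ¬(next T a q = b ↔ next T a w = b)) : T.dist q w = T.dist q a + T.dist a w := by
  refine dist_eq_add hT fun _ e => h ?_
  rw [e]

/-! ### Independent play -/

/-- No move in `S` runs along an edge between `p` and `w`. -/
def Reach (T : SimpleGraph V) (S : List (Move V)) (p w : V) : Prop :=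
  ∀ m ∈ S, (next T m.1 p = m.2 ↔ next T m.1 w = m.2)

theorem Reach.symm {S : List (Move V)} {p w : V} (h : Reach T S p w) : Reach T S w p :=
  fun m hm => (h m hm).symm

theorem Reach.trans {S : List (Move V)} {p q w : V} (h : Reach T S p q) (h' : Reach T S q w) :
    Reach T S p w := fun m hm => (h m hm).trans (h' m hm)

theorem reach_cons {S : List (Move V)} {p w : V} {m : Move V} :
    Reach T (m :: S) p w ↔ (next T m.1 p = m.2 ↔ next T m.1 w = m.2) ∧ Reach T S p w := by
  simp [Reach]

/-- This translates "the edge has not been used" in the rules into reachability. -/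
theorem reach_iff_of_adj (hT : T.IsTree) {S : List (Move V)} (hS : ∀ m ∈ S, T.Adj m.1 m.2)
    {p p' : V} (hp : T.Adj p p') :
    Reach T S p p' ↔ ∀ m ∈ S, Move.edge m ≠ Move.edge (p, p') :=
  forall₂_congr fun m hm => separated_iff hT hp (hS m hm)

/-- Each of the two sides of a used edge is convex. -/
theorem Reach.of_between (hT : T.IsTree) {S : List (Move V)} (hS : ∀ m ∈ S, T.Adj m.1 m.2)
    {q a w : V} (h : Reach T S q w) (ha : T.dist q w = T.dist q a + T.dist a w) :
    Reach T S q a := by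
  intro m hm
  have hadj := hS m hm
  have h' := h m hm
  by_cases hq : next T m.1 q = m.2
  · have hw := h'.1 hq
    simp only [hq, true_iff]
    have h1 := (next_ne_iff_next_eq hT hadj.symm q).2 hq
    have h2 := (next_ne_iff_next_eq hT hadj.symm w).2 hw
    exact (next_ne_iff_next_eq hT hadj.symm a).1 (next_ne_of_between hT hadj.symm h1 h2 ha.symm)
  · have hw := (not_congr h').1 hq
    simp only [hq, false_iff]
    exact next_ne_of_between hT hadj hq hw ha.symm

/-! ### Lengths of longest free trails. -/

variable [Fintype V]

open Classical in
/-- The largest distance from `x` to a vertex with the property `P`, or `0` if there is none. -/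
noncomputable def far (T : SimpleGraph V) (x : V) (P : V → Prop) : ℕ :=
  Finset.univ.sup fun w => if P w then T.dist x w else 0

theorem lt_far {x : V} {P : V → Prop} {k : ℕ} : k < far T x P ↔ ∃ w, P w ∧ k < T.dist x w := by
  simp only [far, Finset.lt_sup_iff, Finset.mem_univ, true_and]
  refine exists_congr fun w => ?_
  split_ifs with h <;> simp [h]

theorem dist_le_far {x w : V} {P : V → Prop} (h : P w) : T.dist x w ≤ far T x P := by
  by_contra h'
  exact lt_irrefl _ (lt_far.2 ⟨w, h, not_le.1 h'⟩)

/-- The length of a longest trail from `p` that avoids the edges used by `S`. -/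
noncomputable def freeLength (T : SimpleGraph V) (S : List (Move V)) (p : V) : ℕ :=
  far T p (Reach T S p)

theorem lt_freeLength {S : List (Move V)} {p : V} {k : ℕ} :
    k < freeLength T S p ↔ ∃ w, Reach T S p w ∧ k < T.dist p w :=
  lt_far

/-- A move from `p` cannot harm a token at `q`: if the edge `pp'` cut `q` off from a reachable
vertex `w`, then `p` would lie between `q` and `w` and would itself be reachable. -/
theorem freeLength_cons_of_not_reach (hT : T.IsTree) {S : List (Move V)}
    (hS : ∀ m ∈ S, T.Adj m.1 m.2) {p p' q : V} (h : ¬Reach T S p q) :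
    freeLength T ((p, p') :: S) q = freeLength T S q := by
  refine eq_of_forall_lt_iff fun k => ?_
  rw [lt_freeLength, lt_freeLength]
  refine exists_congr fun w => and_congr_left fun _ => ?_
  rw [reach_cons]
  refine ⟨fun h' => h'.2, fun h' => ⟨?_, h'⟩⟩
  by_contra hsep
  exact h (h'.of_between hT hS (dist_eq_add_of_separated hT hsep)).symm

/-- In a tree the first edge of the way to a farthest vertex can be split off. This matches the
recursion for winning positions in `moverWins_iff`. -/
theorem lt_freeLength_iff_exists (hT : T.IsTree) {S : List (Move V)}
    (hS : ∀ m ∈ S, T.Adj m.1 m.2) {p : V} {k : ℕ} :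
    k < freeLength T S p ↔ ∃ p', T.Adj p p' ∧ Reach T S p p' ∧
      k ≤ freeLength T ((p, p') :: S) p' := by
  constructor
  · rw [lt_freeLength]
    rintro ⟨w, hw, hk⟩
    have hpw : p ≠ w := by rintro rfl; simp at hk
    have hadj := adj_next hT hpw
    have hd := dist_next hT hpw
    have hr : Reach T S p (next T p w) := hw.of_between hT hS (by
      rw [SimpleGraph.dist_eq_one_iff_adj.2 hadj]; omega)
    refine ⟨next T p w, hadj, hr, ?_⟩
    -- For `k = 0` there is nothing to prove after the first step; otherwise the vertex `w` remains
    -- reachable at distance reduced by one.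
    rcases Nat.eq_zero_or_pos k with rfl | hk0
    · exact Nat.zero_le _
    · have : k - 1 < freeLength T ((p, next T p w) :: S) (next T p w) := by
        rw [lt_freeLength]
        refine ⟨w, reach_cons.2 ⟨?_, hr.symm.trans hw⟩, by omega⟩
        simp [next_of_adj hT hadj]
      omega
  · rintro ⟨p', hadj, hr, hk⟩
    rw [lt_freeLength]
    rcases Nat.eq_zero_or_pos k with rfl | hk0
    · exact ⟨p', hr, by rw [SimpleGraph.dist_eq_one_iff_adj.2 hadj]; omega⟩
    · obtain ⟨w, hw, hd⟩ := lt_freeLength.1 (show k - 1 < freeLength T ((p, p') :: S) p' by omega)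
      rw [reach_cons] at hw
      refine ⟨w, hr.trans hw.2, ?_⟩
      have := (next_eq_iff hT hadj w).1 (hw.1.1 (next_of_adj hT hadj))
      omega

end Tree

/-! ### The game on finite graphs is determined -/

section Determinacy

variable {V : Type*} {G : SimpleGraph V}

theorem not_moverWins_and_forall {S : List (Move V)} (h : MoverWins G S) :
    ¬∀ m, Legal G S m → MoverWins G (m :: S) := by
  induction h with
  | intro S m hm _ ih =>
    intro h'
    obtain ⟨_, m', hm', h''⟩ := h' m hm
    exact ih m' hm' h''

open Classical in
-- Every legal move uses up an edge, so positions can be handled by induction on the number of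
-- unused edges.
theorem legal_induction [Finite V] {P : List (Move V) → Prop}
    (h : ∀ S, (∀ m, Legal G S m → P (m :: S)) → P S) (S : List (Move V)) : P S := by
  induction hk : {e ∈ G.edgeSet | ∀ p ∈ S, Move.edge p ≠ e}.ncard using Nat.strong_induction_on
    generalizing S with
  | _ k ih =>
    refine h S fun m hm => ih _ ?_ _ rfl
    rw [← hk]
    refine Set.ncard_lt_ncard ⟨fun e he => ⟨he.1, fun p hp => he.2 p (by simp [hp])⟩, fun hsub => ?_⟩
      (Set.toFinite _)
    exact (hsub (a := Move.edge m) ⟨hm.1, hm.2.1⟩).2 m (by simp) rfl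

/-- Turns the inductive notion of a winning strategy into the usual recursion, in which "not winning
for the player to move" is "winning for the other". Finiteness provides the determinacy needed here.
-/
theorem moverWins_iff [Finite V] (S : List (Move V)) :
    MoverWins G S ↔ ∃ m, Legal G S m ∧ ¬MoverWins G (m :: S) := by
  induction S using legal_induction (G := G) with | _ S ih
  constructor
  · rintro ⟨_, m, hm, h⟩
    exact ⟨m, hm, fun h' => not_moverWins_and_forall h' h⟩
  · rintro ⟨m, hm, h⟩
    refine ⟨_, m, hm, fun m' hm' => ?_⟩
    by_contra h'
    exact h ((ih m hm).2 ⟨m', hm', h'⟩)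

theorem p2Win_iff_not_p1Win [Finite V] : P2Win G ↔ ¬P1Win G := by
  rw [P1Win, moverWins_iff, P2Win]
  push Not
  rfl

end Determinacy

/-! ### Play with separated tokens. -/

section Independent

variable {V : Type*} {T : SimpleGraph V}

theorem legal_cons_cons (hT : T.IsTree) {x p u q : V} {S : List (Move V)}
    (hS : ∀ m ∈ (x, q) :: (u, p) :: S, T.Adj m.1 m.2) (m : Move V) :
    Legal T ((x, q) :: (u, p) :: S) m ↔
      m.1 = p ∧ T.Adj p m.2 ∧ Reach T ((x, q) :: (u, p) :: S) p m.2 := by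
  constructor
  · rintro ⟨h1, h2, h3⟩
    have := h3 _ _ _ rfl
    dsimp only at this
    subst this
    exact ⟨rfl, h1, (reach_iff_of_adj hT hS h1).2 h2⟩
  · rintro ⟨rfl, h1, h2⟩
    refine ⟨h1, (reach_iff_of_adj hT hS h1).1 h2, ?_⟩
    rintro _ _ _ ⟨⟩
    rfl

variable [Fintype V]

/-- If the tokens cannot reach each other, the player with the longer trail wins; in a tie, it is
the player who is not to move. -/
theorem moverWins_iff_of_not_reach (hT : T.IsTree) (S : List (Move V)) :
    ∀ x p u q S', S = (x, q) :: (u, p) :: S' → (∀ m ∈ S, T.Adj m.1 m.2) → ¬Reach T S p q →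
      (MoverWins T S ↔ freeLength T S q < freeLength T S p) := by
  induction S using legal_induction (G := T) with | _ S ih
  intro x p u q S' hS hadj hpq
  rw [moverWins_iff, lt_freeLength_iff_exists hT hadj]
  -- A move to `p'` exchanges the roles, keeps the tokens separated and does not change the free
  -- length at `q`.
  have key : ∀ p', T.Adj p p' → Reach T S p p' → (¬MoverWins T ((p, p') :: S) ↔
      freeLength T S q ≤ freeLength T ((p, p') :: S) p') := by
    intro p' hp hr
    have hadj' : ∀ m ∈ (p, p') :: S, T.Adj m.1 m.2 := by
      simpa [hp] using hadj
    have hlegal : Legal T S (p, p') := by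
      subst hS; exact (legal_cons_cons hT hadj _).2 ⟨rfl, hp, hr⟩
    have hS' : (p, p') :: S = (p, p') :: (x, q) :: ((u, p) :: S') := by rw [hS]
    rw [ih (p, p') hlegal p q x p' _ hS' hadj' (fun h => hpq (hr.trans (reach_cons.1 h).2.symm)),
      freeLength_cons_of_not_reach hT hadj hpq, not_lt]
  constructor
  · rintro ⟨m, hm, h⟩
    have hm' : m.1 = p ∧ T.Adj p m.2 ∧ Reach T S p m.2 := by
      subst hS; exact (legal_cons_cons hT hadj _).1 hm
    obtain ⟨m1, m2⟩ := m
    obtain ⟨rfl, h1, h2⟩ := hm'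
    exact ⟨m2, h1, h2, (key m2 h1 h2).1 h⟩
  · rintro ⟨p', h1, h2, h⟩
    refine ⟨(p, p'), ?_, (key p' h1 h2).2 h⟩
    subst hS; exact (legal_cons_cons hT hadj _).2 ⟨rfl, h1, h2⟩

end Independent

end TrailTrap

namespace TrailTrap

/-! ### Tokens that move towards each other -/

section Facing

variable {V : Type*} [Fintype V] {T : SimpleGraph V}

/-- The length of a longest trail that starts with the edge `uv`. -/
noncomputable def branch (T : SimpleGraph V) (u v : V) : ℕ := far T u fun w => next T u w = v

/-- The length of a longest trail from `x` that starts towards `v` and that does not leave `v` to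
one of the vertices `a`, `b`. -/
noncomputable def ray (T : SimpleGraph V) (x v a b : V) : ℕ :=
  far T x fun w => next T x w = next T x v ∧ next T v w ≠ a ∧ next T v w ≠ b

/-- The player whose token has come from `u` and faces the other one, which has come from `x`, wins
by leaving the way to `x` at once. -/
def LeaveWins (T : SimpleGraph V) (u x : V) : Prop :=
  ∃ z, T.Adj (next T u x) z ∧ z ≠ u ∧ z ≠ next T (next T u x) x ∧
    ray T x (next T u x) u z ≤ branch T (next T u x) z

/-- `FaceWins` for tokens at distance `k - 2`. -/
def FaceWinsAt (T : SimpleGraph V) : ℕ → V → V → Prop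
  | 0, _, _ => False
  | k + 1, u, x => LeaveWins T u x ∨ 2 < T.dist u x ∧ ¬FaceWinsAt T k x (next T u x)

/-- The player to move wins if their token has come from `u`, that of the opponent from `x`, and
they face each other. -/
def FaceWins (T : SimpleGraph V) (u x : V) : Prop := FaceWinsAt T (T.dist u x) u x

/-- The recursion closes because `next T u x` is one step nearer to `x`, so the distance counter of
`FaceWinsAt` always agrees with the distance. -/
theorem faceWins_iff (hT : T.IsTree) {u x : V} (h : u ≠ x) : FaceWins T u x ↔
    LeaveWins T u x ∨ 2 < T.dist u x ∧ ¬FaceWins T x (next T u x) := by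
  rw [FaceWins, FaceWins, SimpleGraph.dist_comm (u := x), ← dist_next hT h, FaceWinsAt,
    dist_next hT h]

/-- All vertices in question lie beyond the edge `xq`. The requirement `P q` covers the case in
which the maximum on the right is 0. -/
theorem far_eq_far_add_one (hT : T.IsTree) {x q : V} {P Q : V → Prop} (hx : T.Adj x q)
    (h : ∀ w, Q w ↔ P w) (hP : ∀ w, P w → next T x w = q) (hq : P q) :
    far T x P = far T q Q + 1 := by
  refine eq_of_forall_lt_iff fun k => ?_
  have hd : ∀ w, P w → T.dist q w + 1 = T.dist x w := fun w hw => (next_eq_iff hT hx w).1 (hP w hw)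
  rw [lt_far]
  rcases Nat.eq_zero_or_pos k with rfl | hk
  · have := hd q hq
    exact ⟨fun _ => by omega, fun _ => ⟨q, hq, by omega⟩⟩
  · rw [show k < far T q Q + 1 ↔ k - 1 < far T q Q by omega, lt_far]
    refine exists_congr fun w => ?_
    rw [h]
    refine and_congr_right fun hw => ?_
    have := hd w hw
    omega

/-- The reachability hypothesis says that, of all edges used so far, only `up` and `xq` bound the
region around the tokens. It is preserved when a player goes on, and it makes the outcome
independent of the rest of the history. -/
theorem moverWins_iff_faceWins (hT : T.IsTree) {k : ℕ} :
    ∀ {u x p q : V} {S S' : List (Move V)}, T.dist u x = k → S = (x, q) :: (u, p) :: S' →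
      (∀ m ∈ S, T.Adj m.1 m.2) → 2 ≤ T.dist u x → p = next T u x → q = next T x u →
      (∀ w, Reach T S p w ↔ next T p w ≠ u ∧ next T q w ≠ x) →
      (MoverWins T S ↔ FaceWins T u x) := by
  induction k using Nat.strong_induction_on with
  | _ k ih =>
  intro u x p q S S' hk hS hadj h2 hp hq hreach
  have hux : u ≠ x := by rintro rfl; simp at h2
  have hup : T.Adj u p := hp ▸ adj_next hT hux
  have hxq : T.Adj x q := hq ▸ adj_next hT hux.symm
  have hdp : T.dist p x + 1 = T.dist u x := by rw [hp]; exact dist_next hT hux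
  have hpx : p ≠ x := by rintro rfl; simp at hdp; omega
  have hxp : next T x p = q := by rw [hp, hq]; exact next_next_eq_next hT hux (hp ▸ hpx)
  have hnpx : next T p x ≠ u := by rw [hp]; exact next_next_ne hT hux
  have hnqp : next T q p ≠ x := by rw [← hxp]; exact next_next_ne hT hpx.symm
  have hpq : p ≠ q → next T p q = next T p x := fun e =>
    (next_eq_next hT e (by rw [next_of_adj hT hxq.symm]; exact hnqp.symm)).symm
  have hnpq : next T p q ≠ u := by
    by_cases e : p = q
    · rw [← e, next_self]; exact hup.ne.symm
    · rwa [hpq e]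
  have hRq : Reach T S p q := (hreach q).2 ⟨hnpq, by rw [next_self]; exact hxq.ne.symm⟩
  have hoff : ∀ w, next T p w ≠ next T p x → next T x w = q := fun w hw => by
    rw [next_eq_next hT hpx.symm hw, hxp]
  have hlegal : ∀ m, Legal T S m ↔ m.1 = p ∧ T.Adj p m.2 ∧ Reach T S p m.2 := by
    subst hS; exact legal_cons_cons hT hadj
  -- leaving the way towards the other token
  have leave : ∀ z, T.Adj p z → z ≠ u → z ≠ next T p x → Reach T S p z ∧
      (¬MoverWins T ((p, z) :: S) ↔ ray T x p u z ≤ branch T p z) := by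
    intro z hz hzu hzx
    have hpz := next_of_adj hT hz
    have hside : ∀ w, next T p w = z → next T q w ≠ x := fun w hw =>
      (next_ne_iff_next_eq hT hxq.symm w).2 (hoff w (by rw [hw]; exact hzx))
    have hR : Reach T S p z := (hreach z).2 ⟨by rw [hpz]; exact hzu, hside z hpz⟩
    have hqz : next T p q ≠ z := by
      by_cases e : p = q
      · rw [← e, next_self]; exact hz.ne
      · rw [hpq e]; exact hzx.symm
    refine ⟨hR, ?_⟩
    have hadj' : ∀ m ∈ (p, z) :: S, T.Adj m.1 m.2 := by simpa [hz] using hadj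
    -- The edge `pz` just used now separates the tokens.
    rw [moverWins_iff_of_not_reach hT _ p q x z ((u, p) :: S') (by rw [hS]) hadj'
      (fun h => hqz ((reach_cons.1 h).1.2 hpz)), not_lt]
    -- Measured from `p` and from `x`, both lengths include the last edge already used, so the
    -- additional 1 cancels in the comparison.
    have e1 : branch T p z = freeLength T ((p, z) :: S) z + 1 := by
      refine far_eq_far_add_one hT hz (fun w => ?_) (fun _ => id) hpz
      rw [reach_cons]
      simp only [hpz, true_iff]
      exact ⟨And.left, fun h => ⟨h, hR.symm.trans ((hreach w).2 ⟨by rw [h]; exact hzu, hside w h⟩)⟩⟩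
    have e2 : ray T x p u z = freeLength T ((p, z) :: S) q + 1 := by
      refine far_eq_far_add_one hT hxq (fun w => ?_) (fun w hw => by rw [hw.1, hxp]) ?_
      · rw [reach_cons, hxp, ← next_ne_iff_next_eq hT hxq.symm]
        simp only [hqz, false_iff]
        refine ⟨fun h => ?_, fun h => ⟨h.2.2, hRq.symm.trans ((hreach w).2 ⟨h.2.1, h.1⟩)⟩⟩
        have := (hreach w).1 (hRq.trans h.2)
        exact ⟨this.2, this.1, h.1⟩
      · exact ⟨by rw [next_of_adj hT hxq, hxp], hnpq, hqz⟩
    rw [e1, e2]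
    omega
  -- going on towards the other token
  have advance : 2 < T.dist u x → T.Adj p (next T p x) ∧ Reach T S p (next T p x) ∧
      (MoverWins T ((p, next T p x) :: S) ↔ FaceWins T x p) := by
    intro h3
    have hz := adj_next hT hpx
    have hpz := next_of_adj hT hz
    have hne : next T p x ≠ x := fun e => by
      rw [e] at hz
      rw [SimpleGraph.dist_eq_one_iff_adj.2 hz] at hdp
      omega
    have hR : Reach T S p (next T p x) := by
      refine (hreach _).2 ⟨by rw [hpz]; exact hnpx, ?_⟩
      rw [next_ne_iff_next_eq hT hxq.symm, next_next_eq_next hT hpx hne, hxp]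
    have hepq : p ≠ q := by
      rintro rfl
      rw [SimpleGraph.dist_eq_one_iff_adj.2 hxq.symm] at hdp
      omega
    refine ⟨hz, hR, ?_⟩
    have hcomm := SimpleGraph.dist_comm (G := T) (u := x) (v := p)
    -- The opponent, who has come from `x`, is now to move against a token that has come from `p`.
    refine ih (T.dist p x) (by omega) (u := x) (x := p) (S' := (u, p) :: S') hcomm (by rw [hS]) (by simpa [hz] using hadj)
      (by omega) hxp.symm rfl fun w => ?_
    rw [reach_cons]
    simp only [hpq hepq, true_iff]
    rw [← next_ne_iff_next_eq hT hz.symm]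
    refine ⟨fun h => ⟨((hreach w).1 (hRq.trans h.2)).2, h.1⟩, fun h => ⟨h.2,
      hRq.symm.trans ((hreach w).2 ⟨?_, h.1⟩)⟩⟩
    rw [(next_ne_iff_next_eq hT hz.symm w).1 h.2]
    exact hnpx
  rw [moverWins_iff, faceWins_iff hT hux, LeaveWins, ← hp]
  constructor
  · rintro ⟨⟨m1, z⟩, hm, hw⟩
    obtain ⟨e, hz, hR⟩ := (hlegal _).1 hm
    dsimp only at e hz hR hw
    subst e
    have hzu : z ≠ u := by
      have := ((hreach z).1 hR).1
      rwa [next_of_adj hT hz] at this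
    by_cases hzx : z = next T m1 x
    · subst hzx
      have h3 : 2 < T.dist u x := by
        -- At distance two both tokens stand at the same vertex, and going on would reuse the edge
        -- by which the opponent has come.
        by_contra h3
        have h0 : T.dist m1 x = 1 := by omega
        have h1 : T.Adj m1 x := SimpleGraph.dist_eq_one_iff_adj.1 h0
        have := ((hreach _).1 hR).2
        rw [← hxp, next_of_adj hT h1.symm, next_of_adj hT h1, next_of_adj hT h1] at this
        exact this rfl
      exact .inr ⟨h3, by rwa [← (advance h3).2.2]⟩
    · exact .inl ⟨z, hz, hzu, hzx, (leave z hz hzu hzx).2.1 hw⟩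
  · rintro (⟨z, hz, hzu, hzx, hw⟩ | ⟨h3, hw⟩)
    · obtain ⟨h1, h4⟩ := leave z hz hzu hzx
      exact ⟨(p, z), (hlegal _).2 ⟨rfl, hz, h1⟩, h4.2 hw⟩
    · obtain ⟨hz, h1, h4⟩ := advance h3
      exact ⟨(p, next T p x), (hlegal _).2 ⟨rfl, hz, h1⟩, by rwa [h4]⟩

/-! ### The first moves -/

open Classical in
/-- The number of moves, with the first one, that a player has who starts with `uv` against `xy`,
if the tokens do not face each other. -/
noncomputable def reserve (T : SimpleGraph V) (u v x y : V) : ℕ :=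
  if v = next T u x then ray T u x y y else branch T u v

open Classical in
/-- Player 1 wins if the first moves are `uv` and `xy`. -/
def OpeningWins (T : SimpleGraph V) (u v x y : V) : Prop :=
  if v = next T u x ∧ y = next T x u then FaceWins T u x else reserve T x y u v < reserve T u v x y

/-- If `uv` points towards `x`, then `xy` points away from `u`, and the only obstacle ahead is the
exit from `x` to `y`. If `uv` points away from `x`, the edge `xy` does not cut the branch behind `v`
at all. The additional 1 counts the edge `uv`. -/
theorem reserve_eq (hT : T.IsTree) {u v x y : V} (huv : T.Adj u v) (hxy : T.Adj x y)
    (hne : s(x, y) ≠ s(u, v)) (h : ¬(v = next T u x ∧ y = next T x u)) :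
    reserve T u v x y = freeLength T [(x, y), (u, v)] v + 1 := by
  have hv := next_of_adj hT huv
  have hs := (separated_iff hT huv hxy).2 hne
  have hreach : ∀ w, Reach T [(x, y), (u, v)] v w ↔
      (next T x u = y ↔ next T x w = y) ∧ next T u w = v := by
    intro w
    rw [reach_cons, reach_cons, hv, hs]
    simp [Reach]
  rw [reserve]
  split_ifs with e
  · have hy : next T x u ≠ y := fun h' => h ⟨e, h'.symm⟩
    refine far_eq_far_add_one hT huv (fun w => ?_) (fun w hw => by rw [hw.1, e]) ?_
    · rw [hreach, ← e]
      simp only [hy, false_iff]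
      exact ⟨fun h => ⟨h.2, h.1, h.1⟩, fun h => ⟨h.2.1, h.1⟩⟩
    · have := (not_congr hs).1 hy
      exact ⟨by rw [hv, e], this, this⟩
  · refine far_eq_far_add_one hT huv (fun w => ?_) (fun w hw => hw) hv
    rw [hreach]
    refine ⟨And.right, fun hw => ⟨?_, hw⟩⟩
    by_cases hux : u = x
    · subst hux
      rw [next_self, hw]
      refine ⟨fun h => absurd h hxy.ne, ?_⟩
      rintro rfl
      exact absurd rfl hne
    · rw [next_eq_next hT (w := w) (Ne.symm hux) (by rw [hw]; exact e)]

theorem moverWins_pair_iff (hT : T.IsTree) {u v x y : V} (huv : T.Adj u v) (hxy : T.Adj x y)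
    (hne : s(x, y) ≠ s(u, v)) : MoverWins T [(x, y), (u, v)] ↔ OpeningWins T u v x y := by
  have hadj : ∀ m ∈ [(x, y), (u, v)], T.Adj m.1 m.2 := by simp [huv, hxy]
  have hv := next_of_adj hT huv
  have hs := (separated_iff hT huv hxy).2 hne
  rw [OpeningWins]
  split_ifs with h
  · obtain ⟨h1, h2⟩ := h
    have hd := two_le_dist_of_facing hT huv hne h1 h2
    refine moverWins_iff_faceWins hT (S' := []) rfl rfl hadj hd h1 h2 fun w => ?_
    rw [reach_cons, reach_cons, hv]
    simp only [← hs, ← h2, true_iff]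
    rw [next_ne_iff_next_eq hT huv.symm, next_ne_iff_next_eq hT hxy.symm]
    simp [Reach, and_comm]
  · have hperm : freeLength T [(x, y), (u, v)] y = freeLength T [(u, v), (x, y)] y := by
      simp only [freeLength]
      congr 1
      funext w
      simp only [reach_cons, eq_iff_iff]
      tauto
    rw [reserve_eq hT huv hxy hne h, reserve_eq hT hxy huv hne.symm (fun h' => h h'.symm), ← hperm,
      moverWins_iff_of_not_reach hT _ x v u y [] rfl hadj, Nat.add_lt_add_iff_right]
    -- If the tokens could still reach each other, both moves would point towards the other one.
    intro hr
    simp only [reach_cons, next_of_adj hT huv, next_of_adj hT hxy, iff_true, true_iff] at hr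
    refine h ⟨?_, ?_⟩
    · exact (((separated_iff hT hxy huv).2 hne.symm).2 hr.2.1).symm
    · exact (hs.2 hr.1).symm

theorem p1Win_iff (hT : T.IsTree) : P1Win T ↔ ∃ u v, T.Adj u v ∧
    ∀ x y, T.Adj x y → s(x, y) ≠ s(u, v) → OpeningWins T u v x y := by
  rw [P1Win, moverWins_iff]
  constructor
  · rintro ⟨⟨u, v⟩, hm, h⟩
    refine ⟨u, v, hm.1, fun x y hxy hne => ?_⟩
    by_contra h'
    rw [← moverWins_pair_iff hT hm.1 hxy hne] at h'
    refine h ((moverWins_iff _).2 ⟨(x, y), ⟨hxy, ?_, ?_⟩, h'⟩)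
    · simpa [Move.edge] using hne.symm
    · rintro _ _ _ ⟨⟩
  · rintro ⟨u, v, huv, h⟩
    refine ⟨(u, v), ⟨huv, by simp, by rintro _ _ _ ⟨⟩⟩, fun h' => ?_⟩
    obtain ⟨⟨x, y⟩, ⟨h1, h2, -⟩, h3⟩ := (moverWins_iff _).1 h'
    have hne : s(x, y) ≠ s(u, v) := (h2 (u, v) (by simp)).symm
    exact h3 ((moverWins_pair_iff hT huv h1 hne).2 (h x y h1 hne))

end Facing

end TrailTrap

namespace TrailTrap

/-! ### Recurrences for the lengths of trails -/

section Recurrences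

variable {V : Type*} {T : SimpleGraph V}

/-- A vertex between `x` and `v` hangs off the path either before the neighbour `p` of `v` or at `p`
itself. The exclusion of `v` is repeated so that three exits are named, as `IsBest` expects. -/
theorem between_iff (hT : T.IsTree) {x v p : V} (hp : p = next T v x) (hxv : x ≠ v) (hpx : p ≠ x)
    (w : V) : (next T x w = next T x v ∧ next T v w = next T v x) ↔
      (next T x w = next T x p ∧ next T p w = next T p x) ∨
      (next T p w ≠ v ∧ next T p w ≠ next T p x ∧ next T p w ≠ v) := by
  have hadj : T.Adj v p := hp ▸ adj_next hT hxv.symm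
  have hv : next T x v = next T x p := by
    rw [hp] at hpx ⊢
    exact (next_next_eq_next hT hxv.symm hpx).symm
  have hne : next T p x ≠ v := by rw [hp]; exact next_next_ne hT hxv.symm
  rw [← hp, ← next_ne_iff_next_eq hT hadj.symm, hv]
  by_cases h : next T p w = next T p x
  · simp [h, hne]
  · simp [h, next_eq_next hT hpx.symm h]

variable [Fintype V]

/-- The largest distance from `x` to a vertex that lies in the same direction as `v` from `x` and in
the same direction as `x` from `v`. -/
noncomputable def between (T : SimpleGraph V) (x v : V) : ℕ :=
  far T x fun w => next T x w = next T x v ∧ next T v w = next T v x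

/-- The vertex `z` is a best way to leave `v` among those different from `a`, `b` and `c`. -/
structure IsBest (T : SimpleGraph V) (v a b c z : V) : Prop where
  ne_fst : z ≠ a
  ne_snd : z ≠ b
  ne_trd : z ≠ c
  le : ∀ z', z' ≠ a → z' ≠ b → z' ≠ c → branch T v z' ≤ branch T v z

theorem IsBest.far_eq {v a b c z : V} (h : IsBest T v a b c z) :
    far T v (fun w => next T v w ≠ a ∧ next T v w ≠ b ∧ next T v w ≠ c) = branch T v z := by
  refine eq_of_forall_lt_iff fun k => ⟨fun hk => ?_, fun hk => ?_⟩
  · obtain ⟨w, ⟨h1, h2, h3⟩, hw⟩ := lt_far.1 hk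
    have : T.dist v w ≤ branch T v (next T v w) := dist_le_far rfl
    exact (hw.trans_le this).trans_le (h.le _ h1 h2 h3)
  · obtain ⟨w, hw, hk⟩ := lt_far.1 hk
    refine lt_far.2 ⟨w, ?_, hk⟩
    rw [hw]
    exact ⟨h.ne_fst, h.ne_snd, h.ne_trd⟩

theorem far_or {x : V} {P Q R : V → Prop} (h : ∀ w, R w ↔ P w ∨ Q w) :
    far T x R = max (far T x P) (far T x Q) := by
  refine eq_of_forall_lt_iff fun k => ?_
  simp only [lt_max_iff, lt_far, h]
  rw [← exists_or]
  exact exists_congr fun w => by tauto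

/-- The requirement `P v` guarantees that the distance to `v` itself is attained. -/
theorem far_eq_dist_add {x v : V} {P : V → Prop} (hv : P v)
    (h : ∀ w, P w → T.dist x w = T.dist x v + T.dist v w) :
    far T x P = T.dist x v + far T v P := by
  refine eq_of_forall_lt_iff fun k => ?_
  rcases Nat.lt_or_ge k (T.dist x v) with hk | hk
  · exact iff_of_true (lt_far.2 ⟨v, hv, hk⟩) (by omega)
  · rw [show k < T.dist x v + far T v P ↔ k - T.dist x v < far T v P by omega, lt_far, lt_far]
    refine exists_congr fun w => and_congr_right fun hw => ?_
    have := h w hw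
    omega

/-- The trail either departs from the path before `v` or passes through `v` and takes the best exit
other than `a`, `b` and the way back. -/
theorem ray_eq (hT : T.IsTree) {x v a b z : V} (hxv : x ≠ v) (hva : v ≠ a) (hvb : v ≠ b)
    (ha : a ≠ next T v x) (hb : b ≠ next T v x) (hz : IsBest T v a b (next T v x) z) :
    ray T x v a b = max (between T x v) (T.dist x v + branch T v z) := by
  rw [← hz.far_eq, ← far_eq_dist_add (x := x), ray]
  · refine far_or fun w => ?_
    by_cases h : next T v w = next T v x
    · simp [h, ha.symm, hb.symm]
    · simp [h, next_eq_next hT hxv h]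
  · rw [next_self]
    exact ⟨hva, hvb, (adj_next hT hxv.symm).ne⟩
  · exact fun w hw => dist_eq_add hT fun _ => hw.2.2

theorem between_of_adj (hT : T.IsTree) {x v : V} (h : T.Adj x v) : between T x v = 0 := by
  by_contra h'
  obtain ⟨w, ⟨h1, h2⟩, -⟩ := lt_far.1 (Nat.pos_of_ne_zero h')
  rw [next_of_adj hT h] at h1
  rw [next_of_adj hT h.symm, ← next_ne_iff_next_eq hT h] at h2
  exact h2 h1

theorem between_eq_of_ne (hT : T.IsTree) {x v p z : V} (hp : p = next T v x) (hxv : x ≠ v)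
    (hpx : p ≠ x) (hz : IsBest T p v (next T p x) v z) :
    between T x v = max (between T x p) (T.dist x p + branch T p z) := by
  have hadj : T.Adj v p := hp ▸ adj_next hT hxv.symm
  rw [← hz.far_eq, ← far_eq_dist_add (x := x), between]
  · exact far_or (between_iff hT hp hxv hpx)
  · rw [next_self]
    exact ⟨hadj.ne.symm, (adj_next hT hpx).ne, hadj.ne.symm⟩
  · exact fun w hw => dist_eq_add hT fun _ => hw.2.1

/-- `between` measures the same set of vertices from its first argument and is not symmetric, so
both orders of the arguments need a recursion. Seen from `v`, every vertex of the set lies one step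
beyond `p`. -/
theorem between_eq_of_ne' (hT : T.IsTree) {x v p z : V} (hp : p = next T v x) (hxv : x ≠ v)
    (hpx : p ≠ x) (hz : IsBest T p v (next T p x) v z) :
    between T v x = 1 + max (between T p x) (branch T p z) := by
  have hadj : T.Adj v p := hp ▸ adj_next hT hxv.symm
  have hv : next T x v = next T x p := by
    rw [hp] at hpx ⊢
    exact (next_next_eq_next hT hxv.symm hpx).symm
  rw [← hz.far_eq, Nat.add_comm]
  have : max (between T p x) (far T p fun w => next T p w ≠ v ∧ next T p w ≠ next T p x ∧
      next T p w ≠ v) = far T p fun w => next T v w = next T v x ∧ next T x w = next T x v := by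
    refine (far_or fun w => ?_).symm
    rw [and_comm, between_iff hT hp hxv hpx, and_comm (a := next T x w = _)]
  rw [this]
  refine far_eq_far_add_one hT hadj (fun w => Iff.rfl) (fun w hw => by rw [hw.1, hp]) ?_
  exact ⟨by rw [next_of_adj hT hadj, hp], hv.symm⟩

/-- Vertices that are not neighbours count as branches of length 0. Hence the vertex itself can
stand for "no exit left". -/
theorem adj_of_branch_pos (hT : T.IsTree) {v z : V} (h : 0 < branch T v z) : T.Adj v z := by
  obtain ⟨w, rfl, hw⟩ := lt_far.1 h
  exact adj_next hT fun e => by subst e; simp at hw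

theorem branch_pos (hT : T.IsTree) {v z : V} (h : T.Adj v z) : 0 < branch T v z :=
  lt_far.2 ⟨z, next_of_adj hT h, by rw [SimpleGraph.dist_eq_one_iff_adj.2 h]; omega⟩

theorem branch_self (hT : T.IsTree) (v : V) : branch T v v = 0 := by
  by_contra h
  exact (adj_of_branch_pos hT (Nat.pos_of_ne_zero h)).ne rfl

theorem not_leaveWins (hT : T.IsTree) {u x p : V} (hp : p = next T u x)
    (hz : IsBest T p u (next T p x) (next T p x) p) : ¬LeaveWins T u x := by
  rintro ⟨z', h1, h2, h3, -⟩
  rw [← hp] at h1 h3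
  have := hz.le z' h2 h3 h3
  have := branch_pos hT h1
  have := branch_self hT p
  omega

/-- It suffices to try a longest exit `z`. If some exit `z'` works, replacing it by `z` does not
lengthen the opponent's best trail: a trail that now may enter `z'` is matched by one into `z`,
which was open before and is at least as long. -/
theorem leaveWins_iff (hT : T.IsTree) {u x p z y : V} (hux : u ≠ x) (hp : p = next T u x)
    (hpx : p ≠ x) (hzp : z ≠ p) (hz : IsBest T p u (next T p x) (next T p x) z)
    (hy : IsBest T p u z (next T p x) y) : LeaveWins T u x ↔
      max (between T x p) (T.dist x p + branch T p y) ≤ branch T p z := by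
  have hadj : T.Adj u p := hp ▸ adj_next hT hux
  have hnu : next T p x ≠ u := by rw [hp]; exact next_next_ne hT hux
  have hd := dist_ne_zero hT hpx.symm
  rw [← ray_eq hT hpx.symm hadj.ne.symm (Ne.symm hzp) hnu.symm hz.ne_snd hy, LeaveWins, ← hp]
  constructor
  · rintro ⟨z', h1, h2, h3, h4⟩
    have hle := hz.le z' h2 h3 h3
    refine le_trans ?_ (h4.trans hle)
    refine le_of_forall_lt fun k hk => ?_
    obtain ⟨w, ⟨hw1, hw2, hw3⟩, hk⟩ := lt_far.1 hk
    by_cases hw : next T p w = z'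
    · have hb : 0 < branch T p z := (branch_pos hT h1).trans_le hle
      have e1 := dist_eq_add hT (x := x) (v := p) (w := w) (fun _ => by rw [hw]; exact h3)
      have e2 : T.dist p w ≤ branch T p z' := dist_le_far hw
      obtain ⟨w', hw', hd⟩ := lt_far.1 (show branch T p z - 1 < branch T p z by omega)
      have e3 := dist_eq_add hT (x := x) (v := p) (w := w') (fun _ => by rw [hw']; exact hz.ne_snd)
      refine lt_far.2 ⟨w', ⟨?_, ?_, ?_⟩, by omega⟩
      · exact next_eq_next hT hpx.symm (by rw [hw']; exact hz.ne_snd)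
      · rw [hw']; exact hz.ne_fst
      · rw [hw', ← hw]; exact hw3.symm
    · exact lt_far.2 ⟨w, ⟨hw1, hw2, hw⟩, hk⟩
  · intro h
    -- The opponent can at least walk to `p`, so the inequality forces a nonempty branch and `z` is
    -- a neighbour.
    have h0 : 0 < branch T p z := by
      refine lt_of_lt_of_le (lt_far.2 ⟨p, ⟨rfl, ?_, ?_⟩, Nat.pos_of_ne_zero hd⟩) h
      · rw [next_self]; exact hadj.ne.symm
      · rw [next_self]; exact Ne.symm hzp
    exact ⟨z, adj_of_branch_pos hT h0, hz.ne_fst, hz.ne_snd, h⟩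

end Recurrences

end TrailTrap

namespace TrailTrap

/-! ### Running programs on tables -/

/-- The tables that a statement changes. -/
def Stmt.targets : Stmt → List (Fin 16)
  | assign k _ _ _ => [k]
  | seq p q => p.targets ++ q.targets
  | loop _ p => p.targets

theorem Tables.set_of_ne (A : Tables) {k k' : Fin 16} (h : k' ≠ k) (i j x : ℕ) :
    A.set k i j x k' = A k' := by
  funext i' j'
  simp [Tables.set, h]

theorem Tables.set_same (A : Tables) (k : Fin 16) (i j x i' j' : ℕ) :
    A.set k i j x k i' j' = if i' = i ∧ j' = j then x else A k i' j' := by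
  simp [Tables.set]

/-- The rule for loop invariants. -/
theorem Stmt.run_loop_induct {N : ℕ} {b : Expr} {p : Stmt} {v : List ℕ} {A : Tables} {m : ℕ}
    (P : ℕ → Tables → Prop) (hm : b.eval N A v = m) (h0 : P 0 A)
    (hs : ∀ i < m, ∀ B, P i B → P (i + 1) (p.run N (v ++ [i]) B)) :
    P m ((Stmt.loop b p).run N v A) := by
  simp only [Stmt.run, hm]
  have : ∀ i ≤ m, P i (Nat.rec A (fun i B => p.run N (v ++ [i]) B) i) := by
    intro i
    induction i with
    | zero => exact fun _ => h0
    | succ i ih => exact fun hi => hs i hi _ (ih (by omega))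
  exact this m le_rfl

/-- The frame rule; membership in the list of changed tables is decided by computation. -/
theorem Stmt.run_of_not_mem {N : ℕ} {p : Stmt} : ∀ {v : List ℕ} {A : Tables} {k : Fin 16},
    k ∉ p.targets → p.run N v A k = A k := by
  induction p with
  | assign k i j e =>
    intro v A k' h
    exact Tables.set_of_ne _ (by simpa [targets] using h) _ _ _
  | seq p q ihp ihq =>
    intro v A k h
    simp only [targets, List.mem_append, not_or] at h
    simp only [run]
    rw [ihq h.2, ihp h.1]
  | loop b p ih =>
    intro v A k h
    exact run_loop_induct (fun _ B => B k = A k) rfl rfl fun i _ B hB => by rw [ih h, hB]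

theorem Stmt.run_seq (N : ℕ) (p q : Stmt) (v : List ℕ) (A : Tables) :
    (Stmt.seq p q).run N v A = q.run N v (p.run N v A) := rfl

/-! ### Distances and directions -/

namespace Expr

/-- The number of vertices. -/
def order : Expr := get 0 (lit 0) (lit 0)

/-- The first end of an edge of the input. -/
def edgeFst (j : Expr) : Expr := get 0 (add (add j j) (lit 1)) (lit 0)

/-- The second end of an edge of the input. -/
def edgeSnd (j : Expr) : Expr := get 0 (add (add j j) (lit 2)) (lit 0)

/-- Whether a vertex has been inserted. -/
def marked (u : Expr) : Expr := get 1 u (lit 0)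

/-- The index of an edge with exactly one inserted end. -/
def foundEdge : Expr := get 2 (lit 0) (lit 0)

/-- The end of the found edge that has been inserted. -/
def parent : Expr := get 3 (lit 0) (lit 0)

/-- The end of the found edge that is to be inserted. -/
def leaf : Expr := get 3 (lit 1) (lit 0)

/-- The next vertex from `u` on the way to `v`. -/
def nextV (u v : Expr) : Expr := get 4 u v

/-- The distance of `u` and `v`. -/
def distV (u v : Expr) : Expr := get 5 u v

/-- The vertex inserted in round `i`. -/
def nth (i : Expr) : Expr := get 6 i (lit 0)

end Expr

open TrailTrap.Expr

/-- Look for an edge with exactly one inserted end. -/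
def findEdge : Stmt := .loop (sub order (lit 1)) <| .assign 2 (lit 0) (lit 0) <|
  ifeq (marked (edgeFst (var 1))) (marked (edgeSnd (var 1))) foundEdge (var 1)

/-- Compute the entries of the distance and direction tables for the new vertex. -/
def extendTables : Stmt := .loop (add (var 0) (lit 1)) <|
  .seq (.assign 4 leaf (nth (var 1)) parent) <|
  .seq (.assign 4 (nth (var 1)) leaf
    (ifeq (nth (var 1)) parent leaf (nextV (nth (var 1)) parent))) <|
  .seq (.assign 5 leaf (nth (var 1)) (add (distV (nth (var 1)) parent) (lit 1)))
    (.assign 5 (nth (var 1)) leaf (add (distV (nth (var 1)) parent) (lit 1)))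

/-- Determine the ends of the found edge. -/
def splitEdge : Stmt :=
  .seq (.assign 3 (lit 0) (lit 0) <| ifeq (marked (edgeFst foundEdge)) (lit 0)
    (edgeSnd foundEdge) (edgeFst foundEdge))
  (.assign 3 (lit 1) (lit 0) <| ifeq (marked (edgeFst foundEdge)) (lit 0)
    (edgeFst foundEdge) (edgeSnd foundEdge))

/-- Record the insertion of the new vertex. -/
def markLeaf : Stmt := .seq (.assign 4 leaf leaf leaf) <|
  .seq (.assign 5 leaf leaf (lit 0)) <|
  .seq (.assign 6 (add (var 0) (lit 1)) (lit 0) leaf) (.assign 1 leaf (lit 0) (lit 1))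

/-- Compute distances and directions by inserting the vertices one after the other. -/
def metricStage : Stmt := .seq (.assign 1 (lit 0) (lit 0) (lit 1)) <|
  .loop (sub order (lit 1)) <| .seq findEdge <| .seq splitEdge <| .seq extendTables markLeaf

variable {n : ℕ} {T : SimpleGraph (Fin n)}

/-- Table `0` holds the edges of `T`, given by their ends `a j` and `b j`. -/
structure IsInput (T : SimpleGraph (Fin n)) (a b : ℕ → Fin n) (A : Tables) : Prop where
  size : A 0 0 0 = n
  fst : ∀ j < n - 1, A 0 (2 * j + 1) 0 = a j
  snd : ∀ j < n - 1, A 0 (2 * j + 2) 0 = b j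
  adj : ∀ j < n - 1, T.Adj (a j) (b j)
  exists_index : ∀ u v, T.Adj u v → ∃ j < n - 1, (a j = u ∧ b j = v) ∨ (a j = v ∧ b j = u)

theorem IsInput.congr {a b : ℕ → Fin n} {A B : Tables} (h : IsInput T a b A) (e : B 0 = A 0) :
    IsInput T a b B where
  size := by rw [e, h.size]
  fst := by rw [e]; exact h.fst
  snd := by rw [e]; exact h.snd
  adj := h.adj
  exists_index := h.exists_index

/-- The first `k` vertices in the order `o` have been inserted. -/
structure Grown (T : SimpleGraph (Fin n)) (o : ℕ → Fin n) (k : ℕ) (A : Tables) : Prop where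
  ord : ∀ i < k, A 6 i 0 = o i
  inj : ∀ i < k, ∀ j < k, o i = o j → i = j
  closed : ∀ i < k, ∀ j < k, ∃ l < k, next T (o i) (o j) = o l
  mark : ∀ i < k, A 1 (o i) 0 = 1
  unmark : ∀ v : Fin n, (∀ i < k, o i ≠ v) → A 1 v 0 = 0
  nxt : ∀ i < k, ∀ j < k, A 4 (o i) (o j) = next T (o i) (o j)
  dist : ∀ i < k, ∀ j < k, A 5 (o i) (o j) = T.dist (o i) (o j)

theorem eval_edgeFst {a b : ℕ → Fin n} {A : Tables} {v : List ℕ} {e : Expr} {j : ℕ}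
    (h : IsInput T a b A) (he : e.eval (2 * n + 2) A v = j) (hj : j < n - 1) :
    (edgeFst e).eval (2 * n + 2) A v = a j := by
  have h1 : j + j < 2 * n + 2 := by omega
  have h2 : j + j + 1 < 2 * n + 2 := by omega
  rw [← h.fst j hj, two_mul j]
  simp [edgeFst, Expr.eval, he, h1, h2]

theorem eval_edgeSnd {a b : ℕ → Fin n} {A : Tables} {v : List ℕ} {e : Expr} {j : ℕ}
    (h : IsInput T a b A) (he : e.eval (2 * n + 2) A v = j) (hj : j < n - 1) :
    (edgeSnd e).eval (2 * n + 2) A v = b j := by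
  have h1 : j + j < 2 * n + 2 := by omega
  have h2 : j + j + 2 < 2 * n + 2 := by omega
  rw [← h.snd j hj, two_mul j]
  simp [edgeSnd, Expr.eval, he, h1, h2]

theorem eval_order {a b : ℕ → Fin n} {A : Tables} {v : List ℕ} (h : IsInput T a b A) :
    order.eval (2 * n + 2) A v = n := h.size

/-- There is no early exit from the loop; a later edge that fits overwrites an earlier one. -/
theorem run_findEdge {a b : ℕ → Fin n} {A : Tables} {k : ℕ} (h : IsInput T a b A)
    (hex : ∃ j < n - 1, A 1 (a j) 0 ≠ A 1 (b j) 0) :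
    ∃ f < n - 1, findEdge.run (2 * n + 2) [k] A 2 0 0 = f ∧ A 1 (a f) 0 ≠ A 1 (b f) 0 := by
  have key := Stmt.run_loop_induct (N := 2 * n + 2) (b := sub order (lit 1)) (v := [k]) (A := A)
    (p := .assign 2 (lit 0) (lit 0) <|
      ifeq (marked (edgeFst (var 1))) (marked (edgeSnd (var 1))) foundEdge (var 1)) (m := n - 1)
    (fun i B => B 0 = A 0 ∧ B 1 = A 1 ∧ ((∃ j < i, A 1 (a j) 0 ≠ A 1 (b j) 0) →
      ∃ f < i, B 2 0 0 = f ∧ A 1 (a f) 0 ≠ A 1 (b f) 0))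
    (by simp only [Expr.eval, eval_order h]; rfl) ⟨rfl, rfl, by rintro ⟨j, hj, -⟩; omega⟩
    (by
      rintro i hi B ⟨h0, h1, h2⟩
      have hB := h.congr h0
      have e1 := eval_edgeFst (v := [k, i]) (e := var 1) hB rfl hi
      have e2 := eval_edgeSnd (v := [k, i]) (e := var 1) hB rfl hi
      simp only [Stmt.run, List.singleton_append]
      refine ⟨by rw [Tables.set_of_ne _ (by decide), h0],
        by rw [Tables.set_of_ne _ (by decide), h1], ?_⟩
      rintro ⟨j, hj, hne⟩
      simp only [Expr.eval, marked, e1, e2, Tables.set_same, h1, foundEdge]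
      simp only [Fin.val_zero, and_self, if_true]
      split_ifs with hc
      · obtain ⟨f, hf, h3⟩ := h2 ⟨j, by
          rcases Nat.lt_succ_iff_lt_or_eq.1 hj with hj | rfl
          · exact hj
          · exact absurd hc hne, hne⟩
        exact ⟨f, by omega, h3⟩
      · exact ⟨i, by omega, by simp, hc⟩)
  obtain ⟨f, hf, h1, h2⟩ := key.2.2 hex
  exact ⟨f, hf, h1, h2⟩

theorem dist_lt (hT : T.IsTree) (u v : Fin n) : T.dist u v < n := by
  obtain ⟨p, hp, e⟩ := hT.connected.exists_path_of_dist u v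
  rw [← e]
  simpa using hp.length_lt

/-- Some edge on the way from `v` to `r` crosses the boundary of `P`. -/
theorem exists_adj_of_exists_not (hT : T.IsTree) {P : Fin n → Prop} {r v : Fin n} (hr : P r)
    (hv : ¬P v) : ∃ x y, T.Adj x y ∧ P x ∧ ¬P y := by
  induction hk : T.dist v r using Nat.strong_induction_on generalizing v with
  | _ k ih =>
    have hne : v ≠ r := by rintro rfl; exact hv hr
    by_cases h : P (next T v r)
    · exact ⟨_, _, (adj_next hT hne).symm, h, hv⟩
    · exact ih _ (by have := dist_next hT hne; omega) h rfl

theorem run_extendTables (hT : T.IsTree) {o : ℕ → Fin n} {k : ℕ} {A : Tables} {p v : Fin n}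
    (h : Grown T o (k + 1) A) (hk : k + 1 < n) (hp : A 3 0 0 = p) (hv : A 3 1 0 = v)
    {ip : ℕ} (hip : ip < k + 1) (hop : o ip = p) (hov : ∀ i < k + 1, o i ≠ v)
    (B : Tables) (hB : B = extendTables.run (2 * n + 2) [k] A) :
    (∀ i < k + 1, B 4 v (o i) = p) ∧
    (∀ i < k + 1, B 4 (o i) v = if o i = p then (v : ℕ) else (next T (o i) p : Fin n)) ∧
    (∀ i < k + 1, B 5 v (o i) = T.dist (o i) p + 1) ∧
    (∀ i < k + 1, B 5 (o i) v = T.dist (o i) p + 1) ∧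
    (∀ i < k + 1, ∀ j < k + 1, B 4 (o i) (o j) = A 4 (o i) (o j)) ∧
    (∀ i < k + 1, ∀ j < k + 1, B 5 (o i) (o j) = A 5 (o i) (o j)) := by
  subst hB
  have hvo : ∀ i < k + 1, (v : ℕ) ≠ o i := fun i hi e => hov i hi (Fin.ext e.symm)
  have key := Stmt.run_loop_induct (N := 2 * n + 2) (b := add (var 0) (lit 1)) (v := [k]) (A := A)
    (p := .seq (.assign 4 leaf (nth (var 1)) parent) <|
      .seq (.assign 4 (nth (var 1)) leaf
        (ifeq (nth (var 1)) parent leaf (nextV (nth (var 1)) parent))) <|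
      .seq (.assign 5 leaf (nth (var 1)) (add (distV (nth (var 1)) parent) (lit 1)))
        (.assign 5 (nth (var 1)) leaf (add (distV (nth (var 1)) parent) (lit 1)))) (m := k + 1)
    (fun l B => B 3 = A 3 ∧ B 6 = A 6 ∧
      (∀ i < l, B 4 v (o i) = p) ∧
      (∀ i < l, B 4 (o i) v = if o i = p then (v : ℕ) else (next T (o i) p : Fin n)) ∧
      (∀ i < l, B 5 v (o i) = T.dist (o i) p + 1) ∧
      (∀ i < l, B 5 (o i) v = T.dist (o i) p + 1) ∧
      (∀ i < k + 1, ∀ j < k + 1, B 4 (o i) (o j) = A 4 (o i) (o j)) ∧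
      (∀ i < k + 1, ∀ j < k + 1, B 5 (o i) (o j) = A 5 (o i) (o j)))
    (by simp [Expr.eval]; omega)
    ⟨rfl, rfl, by simp, by simp, by simp, by simp, by simp, by simp⟩
    (by
      rintro l hl B ⟨h3, h6, ha, hb, hc, hd, he, hf⟩
      have e4 : B 4 (o l) p = next T (o l) p := by
        rw [← hop, he l hl ip hip, h.nxt l hl ip hip]
      have e5 : B 5 (o l) p = T.dist (o l) p := by
        rw [← hop, hf l hl ip hip, h.dist l hl ip hip]
      have hlt : T.dist (o l) p + 1 < 2 * n + 2 := by have := dist_lt hT (o l) p; omega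
      have hvp : (p : ℕ) ≠ v := by rw [← hop]; exact (hvo ip hip).symm
      have hvl := hvo l hl
      have hol := h.ord l hl
      -- One round as four explicit updates. They read only entries for pairs of old vertices, and
      -- these are never overwritten because `v` is new.
      have hrun : (Stmt.seq (.assign 4 leaf (nth (var 1)) parent) <|
          .seq (.assign 4 (nth (var 1)) leaf
            (ifeq (nth (var 1)) parent leaf (nextV (nth (var 1)) parent))) <|
          .seq (.assign 5 leaf (nth (var 1)) (add (distV (nth (var 1)) parent) (lit 1)))
            (.assign 5 (nth (var 1)) leaf (add (distV (nth (var 1)) parent) (lit 1)))).run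
          (2 * n + 2) ([k] ++ [l]) B =
          (((B.set 4 v (o l) p).set 4 (o l) v (if o l = p then (v : ℕ) else (next T (o l) p : Fin n))).set
            5 v (o l) (T.dist (o l) p + 1)).set 5 (o l) v (T.dist (o l) p + 1) := by
        simp only [Stmt.run, Expr.eval, leaf, nth, parent, nextV, distV, List.singleton_append]
        simp [Tables.set_of_ne, h3, h6, hp, hv, hol, Tables.set_same, e4, e5, hvl.symm, hlt,
          Fin.ext_iff]
      rw [hrun]
      have hs : ∀ i < l + 1, i < l ∨ i = l := fun i hi => by omega
      refine ⟨by simp [Tables.set_of_ne, h3], by simp [Tables.set_of_ne, h6], fun i hi => ?_,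
        fun i hi => ?_, fun i hi => ?_, fun i hi => ?_, fun i hi j hj => ?_, fun i hi j hj => ?_⟩
      · rcases hs i hi with hi | rfl
        · simp [Tables.set_of_ne, Tables.set_same, hvl, ha i hi]
        · simp [Tables.set_of_ne, Tables.set_same, hvl]
      · rcases hs i hi with hi | rfl
        · simp only [Tables.set_of_ne _ (show (4 : Fin 16) ≠ 5 by decide), Tables.set_same]
          rw [hb i hi]
          by_cases c : o i = o l
          · simp [c]
          · simp [hvl, Fin.val_inj, c]
        · simp [Tables.set_of_ne, Tables.set_same]
      · rcases hs i hi with hi | rfl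
        · simp only [Tables.set_same]
          rw [Tables.set_of_ne _ (by decide), Tables.set_of_ne _ (by decide), hc i hi]
          simp only [hvl, false_and, if_false, true_and, ← Fin.ext_iff]
          split_ifs with c <;> simp_all
        · simp [Tables.set_same, hvl]
      · rcases hs i hi with hi | rfl
        · simp only [Tables.set_same]
          rw [Tables.set_of_ne _ (by decide), Tables.set_of_ne _ (by decide), hd i hi]
          have := (hvo i (by omega)).symm
          simp only [this, false_and, if_false, and_true, ← Fin.ext_iff]
          split_ifs with c <;> simp_all
        · simp [Tables.set_same]
      · have h1 := hvo i hi
        have h2 := hvo j hj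
        simp [Tables.set_of_ne, Tables.set_same, h1.symm, h2.symm, he i hi j hj]
      · have h1 := hvo i hi
        have h2 := hvo j hj
        simp [Tables.set_of_ne, Tables.set_same, h1.symm, h2.symm, hf i hi j hj])
  exact key.2.2

theorem run_splitEdge {a b : ℕ → Fin n} {A : Tables} {k f : ℕ} (h : IsInput T a b A)
    (hf : f < n - 1) (hA : A 2 0 0 = f) (hne : A 1 (a f) 0 ≠ A 1 (b f) 0)
    (h01 : ∀ v : Fin n, A 1 v 0 = 0 ∨ A 1 v 0 = 1) :
    ∃ p v : Fin n, T.Adj p v ∧ A 1 p 0 = 1 ∧ A 1 v 0 = 0 ∧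
      splitEdge.run (2 * n + 2) [k] A 3 0 0 = p ∧ splitEdge.run (2 * n + 2) [k] A 3 1 0 = v := by
  have e1 : ∀ B, B 0 = A 0 → B 2 = A 2 → (edgeFst foundEdge).eval (2 * n + 2) B [k] = a f :=
    fun B h0 h2 => eval_edgeFst (h.congr h0) (by simp [foundEdge, Expr.eval, h2, hA]) hf
  have e2 : ∀ B, B 0 = A 0 → B 2 = A 2 → (edgeSnd foundEdge).eval (2 * n + 2) B [k] = b f :=
    fun B h0 h2 => eval_edgeSnd (h.congr h0) (by simp [foundEdge, Expr.eval, h2, hA]) hf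
  have hadj := h.adj f hf
  simp only [splitEdge, Stmt.run, Expr.eval, marked, e1 _ rfl rfl, e2 _ rfl rfl]
  rw [e1 _ (Tables.set_of_ne _ (by decide) _ _ _) (Tables.set_of_ne _ (by decide) _ _ _),
    e2 _ (Tables.set_of_ne _ (by decide) _ _ _) (Tables.set_of_ne _ (by decide) _ _ _)]
  rcases h01 (a f) with ha | ha
  · have hb : A 1 (b f) 0 = 1 := (h01 _).resolve_left fun hb => hne (by rw [ha, hb])
    exact ⟨b f, a f, hadj.symm, hb, ha, by simp [Tables.set_same, ha],
      by simp [Tables.set_same, Tables.set_of_ne, ha]⟩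
  · have hb : A 1 (b f) 0 = 0 := (h01 _).resolve_right fun hb => hne (by rw [ha, hb])
    exact ⟨a f, b f, hadj, ha, hb, by simp [Tables.set_same, ha],
      by simp [Tables.set_same, Tables.set_of_ne, ha]⟩

theorem Grown.mark_eq {o : ℕ → Fin n} {k : ℕ} {A : Tables} (h : Grown T o k A) (v : Fin n) :
    A 1 v 0 = 0 ∧ (∀ i < k, o i ≠ v) ∨ A 1 v 0 = 1 ∧ ∃ i < k, o i = v := by
  by_cases hv : ∀ i < k, o i ≠ v
  · exact .inl ⟨h.unmark v hv, hv⟩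
  · push Not at hv
    obtain ⟨i, hi, rfl⟩ := hv
    exact .inr ⟨h.mark i hi, i, hi, rfl⟩

theorem Grown.congr {o : ℕ → Fin n} {k : ℕ} {A B : Tables} (h : Grown T o k A) (h1 : B 1 = A 1)
    (h4 : B 4 = A 4) (h5 : B 5 = A 5) (h6 : B 6 = A 6) : Grown T o k B where
  ord := by rw [h6]; exact h.ord
  inj := h.inj
  closed := h.closed
  mark := by rw [h1]; exact h.mark
  unmark := by rw [h1]; exact h.unmark
  nxt := by rw [h4]; exact h.nxt
  dist := by rw [h5]; exact h.dist

theorem exists_not_mem_range {o : ℕ → Fin n} {k : ℕ} (hk : k < n) : ∃ v, ∀ i < k, o i ≠ v := by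
  by_contra! h
  have : (Finset.univ : Finset (Fin n)) ⊆ (Finset.range k).image o := fun v _ => by
    obtain ⟨i, hi, e⟩ := h v
    exact Finset.mem_image.2 ⟨i, Finset.mem_range.2 hi, e⟩
  have := (Finset.card_le_card this).trans Finset.card_image_le
  simp at this
  omega

/-- The inserted vertices form a subtree to which `v` is attached as a leaf at `p`. So the way from
`v` to any of them starts with `p`, and the entries for `v` follow from those for `p`. -/
theorem grown_insert (hT : T.IsTree) {o : ℕ → Fin n} {k : ℕ} {A : Tables} {p v : Fin n}
    (h : Grown T o (k + 1) A) (hk : k + 1 < n) (hp : A 3 0 0 = p) (hv : A 3 1 0 = v)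
    {ip : ℕ} (hip : ip < k + 1) (hop : o ip = p) (hov : ∀ i < k + 1, o i ≠ v) (hpv : T.Adj p v) :
    Grown T (Function.update o (k + 1) v) (k + 2)
      (markLeaf.run (2 * n + 2) [k] (extendTables.run (2 * n + 2) [k] A)) := by
  obtain ⟨ha, hb, hc, hd, he, hf⟩ := run_extendTables hT h hk hp hv hip hop hov _ rfl
  have f1 : extendTables.run (2 * n + 2) [k] A 1 = A 1 := Stmt.run_of_not_mem (by decide)
  have f3 : extendTables.run (2 * n + 2) [k] A 3 = A 3 := Stmt.run_of_not_mem (by decide)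
  have f6 : extendTables.run (2 * n + 2) [k] A 6 = A 6 := Stmt.run_of_not_mem (by decide)
  generalize extendTables.run (2 * n + 2) [k] A = B at *
  have hlt : k + 1 < 2 * n + 2 := by omega
  have hrun : markLeaf.run (2 * n + 2) [k] B =
      (((B.set 4 v v v).set 5 v v 0).set 6 (k + 1) 0 v).set 1 v 0 1 := by
    simp [markLeaf, Stmt.run, Expr.eval, leaf, Tables.set_of_ne, f3, hv, hlt]
  rw [hrun]
  set o' := Function.update o (k + 1) v with ho'
  have ov : o' (k + 1) = v := Function.update_self _ _ _
  have oo : ∀ i < k + 1, o' i = o i := fun i hi => Function.update_of_ne (by omega) _ _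
  have hs : ∀ i < k + 2, i < k + 1 ∨ i = k + 1 := fun i hi => by omega
  have hvo : ∀ i < k + 1, (v : ℕ) ≠ o i := fun i hi e => hov i hi (Fin.ext e.symm)
  -- directions and distances for the new vertex
  have hpn : ∀ i < k + 1, next T p (o i) ≠ v := by
    intro i hi
    obtain ⟨l, hl, e⟩ := h.closed ip hip i hi
    rw [← hop, e]
    exact hov l hl
  have n1 : ∀ i < k + 1, next T v (o i) = p := fun i hi =>
    (next_ne_iff_next_eq hT hpv _).1 (hpn i hi)
  have n2 : ∀ i < k + 1, next T (o i) v = if o i = p then v else next T (o i) p := by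
    intro i hi
    split_ifs with e
    · rw [e, next_of_adj hT hpv]
    · refine next_eq_next hT e ?_
      rw [next_of_adj hT hpv]
      exact (hpn i hi).symm
  have n3 : ∀ i < k + 1, T.dist v (o i) = T.dist (o i) p + 1 := fun i hi => by
    rw [(next_ne_iff hT hpv _).1 (hpn i hi), SimpleGraph.dist_comm]
  refine ⟨fun i hi => ?_, fun i hi j hj => ?_, fun i hi j hj => ?_, fun i hi => ?_,
    fun u hu => ?_, fun i hi j hj => ?_, fun i hi j hj => ?_⟩
  · rcases hs i hi with hi | rfl
    · have : i ≠ k + 1 := by omega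
      simp [Tables.set_of_ne, Tables.set_same, oo i hi, f6, h.ord i hi, this]
    · simp [Tables.set_of_ne, Tables.set_same, ov]
  · rcases hs i hi with hi | rfl <;> rcases hs j hj with hj | rfl
    · rw [oo i hi, oo j hj]; exact h.inj i hi j hj
    · rw [oo i hi, ov]; exact fun e => absurd e (hov i hi)
    · rw [oo j hj, ov]; exact fun e => absurd e.symm (hov j hj)
    · exact fun _ => rfl
  · rcases hs i hi with hi | rfl <;> rcases hs j hj with hj | rfl
    · obtain ⟨l, hl, e⟩ := h.closed i hi j hj
      exact ⟨l, by omega, by rw [oo i hi, oo j hj, oo l hl, e]⟩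
    · rw [oo i hi, ov, n2 i hi]
      split_ifs with e
      · exact ⟨k + 1, by omega, ov.symm⟩
      · obtain ⟨l, hl, e⟩ := h.closed i hi ip hip
        exact ⟨l, by omega, by rw [oo l hl, ← e, hop]⟩
    · exact ⟨ip, by omega, by rw [oo j hj, ov, oo ip hip, n1 j hj, hop]⟩
    · exact ⟨k + 1, by omega, by rw [next_self]⟩
  · rcases hs i hi with hi | rfl
    · simp [Tables.set_of_ne, Tables.set_same, oo i hi, f1, h.mark i hi]
    · simp [Tables.set_same, ov]
  · have hu1 : u ≠ v := fun e => hu (k + 1) (by omega) (by rw [ov, e])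
    have := h.unmark u fun i hi => by rw [← oo i hi]; exact hu i (by omega)
    simp [Tables.set_of_ne, Tables.set_same, f1, this, Fin.val_inj, hu1]
  · simp only [Tables.set_of_ne _ (show (4 : Fin 16) ≠ 1 by decide),
      Tables.set_of_ne _ (show (4 : Fin 16) ≠ 6 by decide),
      Tables.set_of_ne _ (show (4 : Fin 16) ≠ 5 by decide), Tables.set_same]
    rcases hs i hi with hi | rfl <;> rcases hs j hj with hj | rfl
    · rw [oo i hi, oo j hj, he i hi j hj, h.nxt i hi j hj, if_neg (fun e => hvo i hi e.1.symm)]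
    · rw [oo i hi, ov, hb i hi, n2 i hi, if_neg (fun e => hvo i hi e.1.symm)]
      split_ifs <;> rfl
    · rw [oo j hj, ov, ha j hj, n1 j hj, if_neg (fun e => hvo j hj e.2.symm)]
    · rw [ov, next_self]; simp
  · simp only [Tables.set_of_ne _ (show (5 : Fin 16) ≠ 1 by decide),
      Tables.set_of_ne _ (show (5 : Fin 16) ≠ 6 by decide), Tables.set_same,
      Tables.set_of_ne _ (show (5 : Fin 16) ≠ 4 by decide)]
    rcases hs i hi with hi | rfl <;> rcases hs j hj with hj | rfl
    · rw [oo i hi, oo j hj, hf i hi j hj, h.dist i hi j hj, if_neg (fun e => hvo i hi e.1.symm)]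
    · rw [oo i hi, ov, hd i hi, SimpleGraph.dist_comm (v := v), n3 i hi,
        if_neg (fun e => hvo i hi e.1.symm)]
    · rw [oo j hj, ov, hc j hj, n3 j hj, if_neg (fun e => hvo j hj e.2.symm)]
    · rw [ov, SimpleGraph.dist_self]; simp

/-- Tables `4`, `5` and `6` hold the directions, the distances and an order of the vertices. -/
structure IsMetric (T : SimpleGraph (Fin n)) (o : ℕ → Fin n) (A : Tables) : Prop where
  size : A 0 0 0 = n
  ord : ∀ i < n, A 6 i 0 = o i
  inj : ∀ i < n, ∀ j < n, o i = o j → i = j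
  surj : ∀ v, ∃ i < n, o i = v
  closed : ∀ k ≤ n, ∀ i < k, ∀ j < k, ∃ l < k, next T (o i) (o j) = o l
  nxt : ∀ u v : Fin n, A 4 u v = next T u v
  dist : ∀ u v : Fin n, A 5 u v = T.dist u v

/-- The subtree grows from vertex 0, with a scan of all edges in each round. The invariant also
records that all earlier initial segments were closed, since the later stages process the vertices
in this order. -/
theorem exists_isMetric_run (hT : T.IsTree) {a b : ℕ → Fin n} {A : Tables} (h : IsInput T a b A)
    (hA : ∀ k, k ≠ 0 → ∀ i j, A k i j = 0) :
    ∃ o, IsMetric T o (metricStage.run (2 * n + 2) [] A) := by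
  obtain ⟨r⟩ := hT.connected.nonempty
  have hn : 0 < n := r.pos
  obtain ⟨o, -, h2, h3⟩ := Stmt.run_loop_induct (N := 2 * n + 2) (b := sub order (lit 1)) (v := [])
    (A := A.set 1 0 0 1) (p := .seq findEdge <| .seq splitEdge <| .seq extendTables markLeaf)
    (m := n - 1)
    (fun k B => ∃ o : ℕ → Fin n, B 0 = A 0 ∧ Grown T o (k + 1) B ∧
      ∀ l ≤ k + 1, ∀ i < l, ∀ j < l, ∃ m < l, next T (o i) (o j) = o m)
    (by
      have : (A.set 1 0 0 1) 0 0 0 = n := by rw [Tables.set_of_ne _ (by decide), h.size]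
      simp [Expr.eval, order, this])
    (by
      -- For the single vertex 0 the initial zeros are already the correct direction and distance.
      have h00 : ∀ i < 0 + 1, i = 0 := fun i hi => by omega
      refine ⟨fun _ => ⟨0, hn⟩, Tables.set_of_ne _ (by decide) _ _ _, ⟨?_, ?_, ?_, ?_, ?_, ?_, ?_⟩,
        ?_⟩
      · intro i hi
        rw [Tables.set_of_ne _ (by decide), hA _ (by decide)]
      · intro i hi j hj _
        rw [h00 i hi, h00 j hj]
      · exact fun i hi j hj => ⟨0, by omega, next_self _⟩
      · intro i hi; simp [Tables.set_same]
      · intro v hv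
        have : (v : ℕ) ≠ 0 := fun e => hv 0 (by omega) (Fin.ext e.symm)
        simp [Tables.set_same, this, hA]
      · intro i hi j hj
        rw [next_self, Tables.set_of_ne _ (by decide), hA _ (by decide)]
      · intro i hi j hj
        rw [SimpleGraph.dist_self, Tables.set_of_ne _ (by decide), hA _ (by decide)]
      · exact fun l hl i hi j hj => ⟨0, by omega, next_self _⟩)
    (by
      rintro k hk B ⟨o, h0, hg, hcl⟩
      have hB := h.congr h0
      simp only [List.nil_append, Stmt.run_seq]
      obtain ⟨w, hw⟩ := exists_not_mem_range (o := o) (k := k + 1) (by omega)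
      obtain ⟨x, y, hxy, ⟨ix, hix, hx⟩, hy⟩ := exists_adj_of_exists_not hT
        (P := fun v => ∃ i < k + 1, o i = v) (r := o 0) (v := w) ⟨0, by omega, rfl⟩
        (by rintro ⟨i, hi, e⟩; exact hw i hi e)
      have mx : B 1 x 0 = 1 := by rw [← hx]; exact hg.mark ix hix
      have my : B 1 y 0 = 0 := hg.unmark y fun i hi e => hy ⟨i, hi, e⟩
      have hex : ∃ j < n - 1, B 1 (a j) 0 ≠ B 1 (b j) 0 := by
        obtain ⟨j, hj, ⟨e1, e2⟩ | ⟨e1, e2⟩⟩ := h.exists_index x y hxy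
        · exact ⟨j, hj, by rw [e1, e2, mx, my]; decide⟩
        · exact ⟨j, hj, by rw [e1, e2, mx, my]; decide⟩
      obtain ⟨f, hf, hf1, hf2⟩ := run_findEdge (k := k) hB hex
      have fr : ∀ t, t ≠ 2 → findEdge.run (2 * n + 2) [k] B t = B t := fun t ht =>
        Stmt.run_of_not_mem (by simpa [findEdge, Stmt.targets] using ht)
      have hg1 : Grown T o (k + 1) (findEdge.run (2 * n + 2) [k] B) :=
        hg.congr (fr _ (by decide)) (fr _ (by decide)) (fr _ (by decide)) (fr _ (by decide))
      have hB1 := hB.congr (fr 0 (by decide))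
      rw [← fr 1 (by decide)] at hf2
      have z0 := fr 0 (by decide)
      generalize findEdge.run (2 * n + 2) [k] B = B1 at *
      obtain ⟨p, v, hpv, mp, mv, hp, hv⟩ := run_splitEdge (k := k) hB1 hf hf1 hf2 (fun v => by
        rcases hg1.mark_eq v with h | h
        exacts [.inl h.1, .inr h.1])
      have fr : ∀ t, t ≠ 3 → splitEdge.run (2 * n + 2) [k] B1 t = B1 t := fun t ht =>
        Stmt.run_of_not_mem (by simpa [splitEdge, Stmt.targets] using ht)
      have hg2 : Grown T o (k + 1) (splitEdge.run (2 * n + 2) [k] B1) :=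
        hg1.congr (fr _ (by decide)) (fr _ (by decide)) (fr _ (by decide)) (fr _ (by decide))
      have z1 := fr 0 (by decide)
      have z2 := fr 1 (by decide)
      generalize splitEdge.run (2 * n + 2) [k] B1 = B2 at *
      rw [← z2] at mp mv
      obtain ⟨ip, hip, hop⟩ : ∃ i < k + 1, o i = p := by
        rcases hg2.mark_eq p with h | h
        · omega
        · exact h.2
      have hov : ∀ i < k + 1, o i ≠ v := by
        rcases hg2.mark_eq v with h | h
        · exact h.2
        · omega
      have hg3 := grown_insert hT hg2 (by omega) hp hv hip hop hov hpv
      refine ⟨_, ?_, hg3, ?_⟩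
      · rw [Stmt.run_of_not_mem (p := markLeaf) (by decide),
          Stmt.run_of_not_mem (p := extendTables) (by decide), z1, z0, h0]
      · intro l hl i hi j hj
        rcases Nat.lt_or_ge l (k + 2) with hl' | hl'
        · obtain ⟨m, hm, e⟩ := hcl l (by omega) i hi j hj
          refine ⟨m, hm, ?_⟩
          rw [Function.update_of_ne (by omega), Function.update_of_ne (by omega),
            Function.update_of_ne (by omega), e]
        · obtain rfl : l = k + 2 := by omega
          exact hg3.closed i hi j hj)
  rw [Nat.sub_add_cancel hn] at h2 h3
  have hsurj : ∀ v, ∃ i < n, o i = v := by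
    intro v
    have hinj : Function.Injective fun i : Fin n => o i := fun i j e =>
      Fin.ext (h2.inj i i.2 j j.2 e)
    obtain ⟨i, hi⟩ := (Finite.injective_iff_surjective.1 hinj) v
    exact ⟨i, i.2, hi⟩
  have hm : ∀ u v, ∃ i < n, ∃ j < n, o i = u ∧ o j = v := fun u v => by
    obtain ⟨i, hi, e⟩ := hsurj u
    obtain ⟨j, hj, e'⟩ := hsurj v
    exact ⟨i, hi, j, hj, e, e'⟩
  refine ⟨o, ?_⟩
  have hr : metricStage.run (2 * n + 2) [] A = (Stmt.loop (sub order (lit 1)) <|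
      .seq findEdge <| .seq splitEdge <| .seq extendTables markLeaf).run (2 * n + 2) []
      (A.set 1 0 0 1) := rfl
  refine ⟨?_, hr ▸ h2.ord, h2.inj, hsurj, h3, fun u v => ?_, fun u v => ?_⟩
  · rw [Stmt.run_of_not_mem (by decide), h.size]
  · obtain ⟨i, hi, j, hj, rfl, rfl⟩ := hm u v
    exact hr ▸ h2.nxt i hi j hj
  · obtain ⟨i, hi, j, hj, rfl, rfl⟩ := hm u v
    exact hr ▸ h2.dist i hi j hj

end TrailTrap

namespace TrailTrap

open TrailTrap.Expr

variable {n : ℕ} {T : SimpleGraph (Fin n)}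

/-! ### Lengths of branches -/

/-- Compute the lengths of the branches at every vertex. -/
def branchStage : Stmt := .loop order <| .loop order <|
  .assign 7 (var 0) (nextV (var 0) (var 1)) <|
    iflt (get 7 (var 0) (nextV (var 0) (var 1))) (distV (var 0) (var 1))
      (distV (var 0) (var 1)) (get 7 (var 0) (nextV (var 0) (var 1)))

theorem IsMetric.congr {o : ℕ → Fin n} {A B : Tables} (h : IsMetric T o A) (h0 : B 0 = A 0)
    (h4 : B 4 = A 4) (h5 : B 5 = A 5) (h6 : B 6 = A 6) : IsMetric T o B where
  size := by rw [h0, h.size]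
  ord := by rw [h6]; exact h.ord
  inj := h.inj
  surj := h.surj
  closed := h.closed
  nxt := by rw [h4]; exact h.nxt
  dist := by rw [h5]; exact h.dist

theorem run_branchLoop {o : ℕ → Fin n} {A : Tables} (h : IsMetric T o A) (u : Fin n)
    (h0 : ∀ z, A 7 u z = 0) (B : Tables)
    (hB : B = (Stmt.loop order <| .assign 7 (var 0) (nextV (var 0) (var 1)) <|
      iflt (get 7 (var 0) (nextV (var 0) (var 1))) (distV (var 0) (var 1))
      (distV (var 0) (var 1)) (get 7 (var 0) (nextV (var 0) (var 1)))).run (2 * n + 2) [(u : ℕ)] A) :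
    (∀ u', u' ≠ (u : ℕ) → B 7 u' = A 7 u') ∧ ∀ z : Fin n, B 7 u z = branch T u z := by
  subst hB
  have key := Stmt.run_loop_induct (N := 2 * n + 2) (b := order) (v := [(u : ℕ)]) (A := A)
    (p := .assign 7 (var 0) (nextV (var 0) (var 1)) <|
      iflt (get 7 (var 0) (nextV (var 0) (var 1))) (distV (var 0) (var 1))
      (distV (var 0) (var 1)) (get 7 (var 0) (nextV (var 0) (var 1)))) (m := n)
    -- The maximum over the vertices seen so far is described through the numbers below it, which
    -- avoids a separate treatment of empty branches.
    (fun w' B => B 4 = A 4 ∧ B 5 = A 5 ∧ (∀ u', u' ≠ (u : ℕ) → B 7 u' = A 7 u') ∧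
      ∀ z : Fin n, ∀ k, k < B 7 u z ↔ ∃ w : Fin n, w < w' ∧ next T u w = z ∧ k < T.dist u w)
    h.size ⟨rfl, rfl, fun _ _ => rfl, fun z k => by rw [h0]; simp⟩
    (by
      rintro w' hw' B ⟨h4, h5, ho, hz⟩
      have e4 : B 4 u w' = next T u ⟨w', hw'⟩ := by rw [h4]; exact h.nxt u ⟨w', hw'⟩
      have e5 : B 5 u w' = T.dist u ⟨w', hw'⟩ := by rw [h5]; exact h.dist u ⟨w', hw'⟩
      have hrun : (Stmt.assign 7 (var 0) (nextV (var 0) (var 1)) <|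
          iflt (get 7 (var 0) (nextV (var 0) (var 1))) (distV (var 0) (var 1))
          (distV (var 0) (var 1)) (get 7 (var 0) (nextV (var 0) (var 1)))).run (2 * n + 2)
          ([(u : ℕ)] ++ [w']) B = B.set 7 u (next T u ⟨w', hw'⟩ : Fin n)
          (max (B 7 u (next T u ⟨w', hw'⟩ : Fin n)) (T.dist u ⟨w', hw'⟩)) := by
        simp [Stmt.run, Expr.eval, nextV, distV, e4, e5, max_def_lt]
      rw [hrun]
      refine ⟨by rw [Tables.set_of_ne _ (by decide), h4], by rw [Tables.set_of_ne _ (by decide), h5],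
        fun u' hu' => ?_, fun z k => ?_⟩
      · rw [← ho u' hu']
        funext z
        simp [Tables.set_same, hu']
      · simp only [Tables.set_same, true_and, Fin.val_inj]
        have hsplit : (∃ w : Fin n, (w : ℕ) < w' + 1 ∧ next T u w = z ∧ k < T.dist u w) ↔
            (∃ w : Fin n, (w : ℕ) < w' ∧ next T u w = z ∧ k < T.dist u w) ∨
            (next T u ⟨w', hw'⟩ = z ∧ k < T.dist u ⟨w', hw'⟩) := by
          constructor
          · rintro ⟨w, hw, h⟩
            rcases Nat.lt_succ_iff_lt_or_eq.1 hw with hw | hw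
            · exact .inl ⟨w, hw, h⟩
            · obtain rfl : w = ⟨w', hw'⟩ := Fin.ext hw
              exact .inr h
          · rintro (⟨w, hw, h⟩ | h)
            · exact ⟨w, by omega, h⟩
            · exact ⟨⟨w', hw'⟩, by simp, h⟩
        rw [hsplit, ← hz z k]
        split_ifs with hc
        · subst hc; simp
        · simp [Ne.symm hc])
  refine ⟨key.2.2.1, fun z => eq_of_forall_lt_iff fun k => ?_⟩
  rw [key.2.2.2 z k, branch, lt_far]
  simp

theorem run_branchStage {o : ℕ → Fin n} {A : Tables} (h : IsMetric T o A)
    (h0 : ∀ u z, A 7 u z = 0) (u z : Fin n) :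
    branchStage.run (2 * n + 2) [] A 7 u z = branch T u z := by
  have key := Stmt.run_loop_induct (N := 2 * n + 2) (b := order) (v := []) (A := A)
    (p := .loop order <| .assign 7 (var 0) (nextV (var 0) (var 1)) <|
      iflt (get 7 (var 0) (nextV (var 0) (var 1))) (distV (var 0) (var 1))
      (distV (var 0) (var 1)) (get 7 (var 0) (nextV (var 0) (var 1)))) (m := n)
    (fun k B => IsMetric T o B ∧ (∀ u : ℕ, k ≤ u → ∀ z, B 7 u z = 0) ∧
      ∀ u z : Fin n, u < k → B 7 u z = branch T u z)
    h.size ⟨h, fun u _ z => h0 u z, fun u z hu => by omega⟩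
    (by
      rintro k hk B ⟨hm, hz, hb⟩
      obtain ⟨h1, h2⟩ := run_branchLoop hm ⟨k, hk⟩ (hz k le_rfl) _ rfl
      refine ⟨hm.congr (Stmt.run_of_not_mem (by decide)) (Stmt.run_of_not_mem (by decide))
        (Stmt.run_of_not_mem (by decide)) (Stmt.run_of_not_mem (by decide)), fun u hu z => ?_,
        fun u z hu => ?_⟩
      · exact (congrFun (h1 u (show u ≠ k by omega)) z).trans (hz u (by omega) z)
      · rcases Nat.lt_succ_iff_lt_or_eq.1 hu with hu | hu
        · exact (congrFun (h1 u (show (u : ℕ) ≠ k by omega)) z).trans (hb u z hu)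
        · obtain rfl : u = ⟨k, hk⟩ := Fin.ext hu
          exact h2 z)
  exact key.2.2 u z u.2

/-! ### The four longest branches at a vertex -/

/-- The entry of rank `i` in the list of the longest branches at `v`. -/
def Expr.top (i : Fin 4) (v : Expr) : Expr := get 8 (lit i) v

/-- The length of the branch at `u` that starts with the edge `uv`. -/
def Expr.branchV (u v : Expr) : Expr := get 7 u v

/-- Replace the entry of rank `i` by `var 1` if this gives a longer branch and is not one of the
entries with ranks in `l`. -/
def topChoice (i : Fin 4) (l : List (Fin 4)) : Expr :=
  l.foldr (fun j e => ifeq (var 1) (top j (var 0)) (top i (var 0)) e)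
    (iflt (branchV (var 0) (top i (var 0))) (branchV (var 0) (var 1)) (var 1) (top i (var 0)))

/-- Find a longest branch at `var 0` other than those with ranks in `l`. -/
def topSearch (i : Fin 4) (l : List (Fin 4)) : Stmt := .seq (.assign 8 (lit i) (var 0) (var 0)) <|
  .loop order <| .assign 8 (lit i) (var 0) (topChoice i l)

/-- Find four longest branches at every vertex. -/
def topStage : Stmt := .loop order <| .seq (topSearch 0 []) <| .seq (topSearch 1 [0]) <|
  .seq (topSearch 2 [0, 1]) (topSearch 3 [0, 1, 2])

theorem eval_topChoice {N : ℕ} {A : Tables} (i : Fin 4) (l : List (Fin 4)) (v z : ℕ) :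
    (topChoice i l).eval N A [v, z] = if ∃ j ∈ l, z = A 8 j v then A 8 i v else
      if A 7 v (A 8 i v) < A 7 v z then z else A 8 i v := by
  induction l with
  | nil => simp [topChoice, Expr.eval, top, branchV]
  | cons j l ih =>
    rw [topChoice] at ih ⊢
    simp only [List.foldr_cons, Expr.eval] at ih ⊢
    rw [ih]
    simp only [top, Expr.eval, List.mem_cons, exists_eq_or_imp]
    by_cases h : z = A 8 j v
    · simp [h]
    · simp [h]

/-- `z` is a longest branch at `v` other than those in `l`, or `v` if there is none. -/
def IsTop (T : SimpleGraph (Fin n)) (v : Fin n) (l : List (Fin n)) (z : Fin n) : Prop :=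
  (z = v ∨ z ∉ l) ∧ ∀ z' ∉ l, branch T v z' ≤ branch T v z

/-- The search starts with `v` itself, a branch of length 0, which remains if no other vertex gives
a positive length. Only one cell is written, so the other ranks and vertices are unaffected. -/
theorem run_topSearch {A : Tables} (hA0 : A 0 0 0 = n)
    (h : ∀ u z : Fin n, A 7 u z = branch T u z) (v : Fin n) {i : Fin 4} {l : List (Fin 4)}
    (hi : i ∉ l) {t : Fin 4 → Fin n} (ht : ∀ j ∈ l, A 8 j v = t j) (B : Tables)
    (hB : B = (topSearch i l).run (2 * n + 2) [(v : ℕ)] A) :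
    (∃ z : Fin n, B 8 i v = z ∧ IsTop T v (l.map t) z) ∧
      ∀ i' v', i' ≠ (i : ℕ) ∨ v' ≠ (v : ℕ) → B 8 i' v' = A 8 i' v' := by
  subst hB
  have key := Stmt.run_loop_induct (N := 2 * n + 2) (b := order) (v := [(v : ℕ)])
    (A := A.set 8 i v v) (p := .assign 8 (lit i) (var 0) (topChoice i l)) (m := n)
    (fun k B => B 7 = A 7 ∧ (∃ z : Fin n, B 8 i v = z ∧ (z = v ∨ z ∉ l.map t) ∧
      ∀ z' : Fin n, z' < k → z' ∉ l.map t → branch T v z' ≤ branch T v z) ∧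
      ∀ i' v', i' ≠ (i : ℕ) ∨ v' ≠ (v : ℕ) → B 8 i' v' = A 8 i' v')
    (by simpa [order, Expr.eval, Tables.set_of_ne] using hA0)
    ⟨Tables.set_of_ne _ (by decide) _ _ _, ⟨v, by simp [Tables.set_same], .inl rfl,
      fun _ h => absurd h (Nat.not_lt_zero _)⟩, fun i' v' h => by
        rw [Tables.set_same, if_neg (by tauto)]⟩
    (by
      rintro k hk B ⟨h7, ⟨z, hz, hz1, hz2⟩, hf⟩
      have hex : (∃ j ∈ l, k = B 8 j v) ↔ (⟨k, hk⟩ : Fin n) ∈ l.map t := by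
        rw [List.mem_map]
        refine exists_congr fun j => and_congr_right fun hj => ?_
        rw [hf j v (.inl fun e => hi (Fin.ext e ▸ hj)), ht j hj, Fin.ext_iff, eq_comm]
      have e1 : B 7 v z = branch T v z := by rw [h7, h]
      have e2 : B 7 v k = branch T v ⟨k, hk⟩ := by rw [h7, ← h v ⟨k, hk⟩]
      have hrun : (Stmt.assign 8 (lit i) (var 0) (topChoice i l)).run (2 * n + 2)
          ([(v : ℕ)] ++ [k]) B = B.set 8 i v (if (⟨k, hk⟩ : Fin n) ∈ l.map t then z else
          if branch T v z < branch T v ⟨k, hk⟩ then ⟨k, hk⟩ else z : Fin n) := by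
        simp only [Stmt.run, List.singleton_append, eval_topChoice, hex, hz, e1, e2]
        simp only [Expr.eval]
        congr 1
        split_ifs <;> rfl
      rw [hrun]
      refine ⟨by rw [Tables.set_of_ne _ (by decide), h7], ⟨_, by rw [Tables.set_same, if_pos ⟨rfl, rfl⟩], ?_, ?_⟩,
        fun i' v' h' => by rw [Tables.set_same, if_neg (by tauto), hf i' v' h']⟩
      · split_ifs with c1 c2
        exacts [hz1, .inr c1, hz1]
      · intro z' hz' hl
        rcases Nat.lt_succ_iff_lt_or_eq.1 hz' with hz' | hz'
        · have := hz2 z' hz' hl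
          split_ifs <;> omega
        · obtain rfl : z' = ⟨k, hk⟩ := Fin.ext hz'
          rw [if_neg hl]
          split_ifs <;> omega)
  obtain ⟨-, ⟨z, hz, hz1, hz2⟩, hf⟩ := key
  exact ⟨⟨z, hz, hz1, fun z' => hz2 z' z'.2⟩, hf⟩

/-- Table `8` holds four longest branches at every vertex. -/
def HasTops (T : SimpleGraph (Fin n)) (A : Tables) (v : Fin n) : Prop :=
  ∃ t₀ t₁ t₂ t₃ : Fin n, A 8 0 v = t₀ ∧ A 8 1 v = t₁ ∧ A 8 2 v = t₂ ∧ A 8 3 v = t₃ ∧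
    IsTop T v [] t₀ ∧ IsTop T v [t₀] t₁ ∧ IsTop T v [t₀, t₁] t₂ ∧ IsTop T v [t₀, t₁, t₂] t₃

theorem run_topStage {A : Tables} (hA0 : A 0 0 0 = n)
    (h : ∀ u z : Fin n, A 7 u z = branch T u z) (v : Fin n) :
    HasTops T (topStage.run (2 * n + 2) [] A) v := by
  have key := Stmt.run_loop_induct (N := 2 * n + 2) (b := order) (v := []) (A := A)
    (p := .seq (topSearch 0 []) <| .seq (topSearch 1 [0]) <|
      .seq (topSearch 2 [0, 1]) (topSearch 3 [0, 1, 2])) (m := n)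
    (fun k B => B 0 = A 0 ∧ B 7 = A 7 ∧ ∀ v : Fin n, v < k → HasTops T B v)
    hA0 ⟨rfl, rfl, fun v hv => absurd hv (Nat.not_lt_zero _)⟩
    (by
      rintro k hk B ⟨h0, h7, ht⟩
      have fr : ∀ (i : Fin 4) (l : List (Fin 4)) (C : Tables) (s : Fin 16), s ≠ 8 →
          (topSearch i l).run (2 * n + 2) [k] C s = C s := fun i l C s hs =>
        Stmt.run_of_not_mem (by simpa [topSearch, Stmt.targets] using hs)
      simp only [Stmt.run_seq, List.nil_append]
      refine ⟨by simp [fr, h0], by simp [fr, h7], ?_⟩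
      obtain ⟨⟨z0, e0, p0⟩, f0⟩ := run_topSearch (A := B) (by rw [h0, hA0]) (by rw [h7]; exact h)
        ⟨k, hk⟩ (i := 0) (l := []) (by simp) (t := fun _ => ⟨k, hk⟩) (by simp) _ rfl
      dsimp only at e0 f0
      have g0 := fr 0 [] B 0 (by decide)
      have g7 := fr 0 [] B 7 (by decide)
      generalize (topSearch 0 []).run (2 * n + 2) [k] B = B1 at *
      obtain ⟨⟨z1, e1, p1⟩, f1⟩ := run_topSearch (A := B1) (by rw [g0, h0, hA0])
        (by rw [g7, h7]; exact h) ⟨k, hk⟩ (i := 1) (l := [0]) (by simp) (t := fun _ => z0)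
        (by simpa using e0) _ rfl
      dsimp only at e1 f1
      have g0' := fr 1 [0] B1 0 (by decide)
      have g7' := fr 1 [0] B1 7 (by decide)
      generalize (topSearch 1 [0]).run (2 * n + 2) [k] B1 = B2 at *
      have e02 : B2 8 0 k = z0 := by rw [f1 0 k (.inl (by decide))]; exact e0
      obtain ⟨⟨z2, e2, p2⟩, f2⟩ := run_topSearch (A := B2) (by rw [g0', g0, h0, hA0])
        (by rw [g7', g7, h7]; exact h) ⟨k, hk⟩ (i := 2) (l := [0, 1]) (by decide)
        (t := fun j => if j = 0 then z0 else z1)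
        (by simpa using ⟨e02, e1⟩) _ rfl
      dsimp only at e2 f2
      have g0'' := fr 2 [0, 1] B2 0 (by decide)
      have g7'' := fr 2 [0, 1] B2 7 (by decide)
      generalize (topSearch 2 [0, 1]).run (2 * n + 2) [k] B2 = B3 at *
      have e03 : B3 8 0 k = z0 := by rw [f2 0 k (.inl (by decide))]; exact e02
      have e13 : B3 8 1 k = z1 := by rw [f2 1 k (.inl (by decide))]; exact e1
      obtain ⟨⟨z3, e3, p3⟩, f3⟩ := run_topSearch (A := B3) (by rw [g0'', g0', g0, h0, hA0])
        (by rw [g7'', g7', g7, h7]; exact h) ⟨k, hk⟩ (i := 3) (l := [0, 1, 2]) (by decide)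
        (t := fun j => if j = 0 then z0 else if j = 1 then z1 else z2)
        (by simpa using ⟨e03, e13, e2⟩) _ rfl
      dsimp only at e3 f3
      generalize (topSearch 3 [0, 1, 2]).run (2 * n + 2) [k] B3 = B4 at *
      intro v hv
      by_cases hvk : (v : ℕ) = k
      · obtain rfl : v = ⟨k, hk⟩ := Fin.ext hvk
        refine ⟨z0, z1, z2, z3, ?_, ?_, ?_, e3, p0, by simpa using p1, by simpa using p2,
          by simpa using p3⟩
        · exact (f3 0 k (.inl (by decide))).trans e03
        · exact (f3 1 k (.inl (by decide))).trans e13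
        · exact (f3 2 k (.inl (by decide))).trans e2
      · have hB : ∀ i : ℕ, B4 8 i v = B 8 i v := fun i => by
          rw [f3 i v (.inr hvk), f2 i v (.inr hvk), f1 i v (.inr hvk), f0 i v (.inr hvk)]
        simpa only [HasTops, hB] using ht v (by omega))
  exact key.2.2 v v.2

/-! ### Expressions for the best ways to leave a vertex -/

/-- `e` if `z` is none of `a`, `b`, `c`, and `e'` otherwise. -/
def Expr.ifAvoids (z a b c e e' : Expr) : Expr := ifeq z a e' (ifeq z b e' (ifeq z c e' e))

/-- A best way to leave `v` among those different from `a`, `b` and `c`. -/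
def Expr.best (v a b c : Expr) : Expr :=
  ifAvoids (top 0 v) a b c (top 0 v) <| ifAvoids (top 1 v) a b c (top 1 v) <|
    ifAvoids (top 2 v) a b c (top 2 v) (top 3 v)

theorem eval_ifAvoids {N : ℕ} {A : Tables} {v : List ℕ} {z a b c e e' : Expr} {z' a' b' c' : Fin n}
    (hz : z.eval N A v = z') (ha : a.eval N A v = a') (hb : b.eval N A v = b')
    (hc : c.eval N A v = c') : (ifAvoids z a b c e e').eval N A v =
      if z' ∉ [a', b', c'] then e.eval N A v else e'.eval N A v := by
  simp only [ifAvoids, Expr.eval, hz, ha, hb, hc, Fin.val_inj, List.mem_cons, List.not_mem_nil,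
    or_false]
  split_ifs <;> tauto

/-- Even where the exclusions make no sense, the value is a vertex; this is used when the best exit
turns out to be the vertex itself. -/
theorem exists_eval_best {N : ℕ} {A : Tables} {l : List ℕ} {v a b c : Expr} {v' a' b' c' : Fin n}
    (hv : v.eval N A l = v') (ha : a.eval N A l = a') (hb : b.eval N A l = b')
    (hc : c.eval N A l = c') (h : HasTops T A v') :
    ∃ z : Fin n, (best v a b c).eval N A l = z := by
  obtain ⟨t₀, t₁, t₂, t₃, e0, e1, e2, e3, -⟩ := h
  have w0 : (top 0 v).eval N A l = t₀ := by simpa [top, Expr.eval, hv] using e0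
  have w1 : (top 1 v).eval N A l = t₁ := by simpa [top, Expr.eval, hv] using e1
  have w2 : (top 2 v).eval N A l = t₂ := by simpa [top, Expr.eval, hv] using e2
  have w3 : (top 3 v).eval N A l = t₃ := by simpa [top, Expr.eval, hv] using e3
  rw [best, eval_ifAvoids w0 ha hb hc, eval_ifAvoids w1 ha hb hc, eval_ifAvoids w2 ha hb hc,
    w0, w1, w2, w3]
  split_ifs
  exacts [⟨_, rfl⟩, ⟨_, rfl⟩, ⟨_, rfl⟩, ⟨_, rfl⟩]

/-- Three exclusions cannot rule out four different exits. Repetitions occur only for the entry `v`,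
which is never excluded. -/
theorem eval_best {N : ℕ} {A : Tables} {l : List ℕ} {v a b c : Expr} {v' a' b' c' : Fin n}
    (hv : v.eval N A l = v') (ha : a.eval N A l = a') (hb : b.eval N A l = b')
    (hc : c.eval N A l = c') (h : HasTops T A v') (hva : v' ≠ a') (hvb : v' ≠ b') (hvc : v' ≠ c') :
    ∃ z : Fin n, (best v a b c).eval N A l = z ∧ IsBest T v' a' b' c' z := by
  obtain ⟨t₀, t₁, t₂, t₃, e0, e1, e2, e3, ⟨-, p0⟩, ⟨q1, p1⟩, ⟨q2, p2⟩, ⟨q3, p3⟩⟩ := h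
  have w0 : (top 0 v).eval N A l = t₀ := by simpa [top, Expr.eval, hv] using e0
  have w1 : (top 1 v).eval N A l = t₁ := by simpa [top, Expr.eval, hv] using e1
  have w2 : (top 2 v).eval N A l = t₂ := by simpa [top, Expr.eval, hv] using e2
  have w3 : (top 3 v).eval N A l = t₃ := by simpa [top, Expr.eval, hv] using e3
  rw [best, eval_ifAvoids w0 ha hb hc, eval_ifAvoids w1 ha hb hc, eval_ifAvoids w2 ha hb hc,
    w0, w1, w2, w3]
  simp only [List.mem_cons, List.not_mem_nil, or_false, not_or] at *
  split_ifs with c0 c1 c2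
  · exact ⟨t₀, rfl, c0.1, c0.2.1, c0.2.2, fun z' _ _ _ => p0 z' (by simp)⟩
  · refine ⟨t₁, rfl, c1.1, c1.2.1, c1.2.2, fun z' h1 h2 h3 => p1 z' ?_⟩
    rintro rfl; exact c0 ⟨h1, h2, h3⟩
  · refine ⟨t₂, rfl, c2.1, c2.2.1, c2.2.2, fun z' h1 h2 h3 => p2 z' ⟨?_, ?_⟩⟩
    · rintro rfl; exact c0 ⟨h1, h2, h3⟩
    · rintro rfl; exact c1 ⟨h1, h2, h3⟩
  · have n1 : t₁ ≠ v' := by rintro rfl; exact c1 ⟨hva, hvb, hvc⟩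
    have n2 : t₂ ≠ v' := by rintro rfl; exact c2 ⟨hva, hvb, hvc⟩
    have q1 := q1.resolve_left n1
    have q2 := q2.resolve_left n2
    have hz : t₃ ≠ a' ∧ t₃ ≠ b' ∧ t₃ ≠ c' := by
      rcases q3 with rfl | q3
      · exact ⟨hva, hvb, hvc⟩
      · grind
    refine ⟨t₃, rfl, hz.1, hz.2.1, hz.2.2, fun z' h1 h2 h3 => p3 z' ⟨?_, ?_, ?_⟩⟩
    · rintro rfl; exact c0 ⟨h1, h2, h3⟩
    · rintro rfl; exact c1 ⟨h1, h2, h3⟩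
    · rintro rfl; exact c2 ⟨h1, h2, h3⟩

end TrailTrap

namespace TrailTrap

open TrailTrap.Expr

variable {n : ℕ} {T : SimpleGraph (Fin n)}

/-! ### Trails towards another vertex -/

/-- The tables `4` to `8` have been computed. -/
structure HasBranches (T : SimpleGraph (Fin n)) (o : ℕ → Fin n) (A : Tables) : Prop
    extends IsMetric T o A where
  branch : ∀ u v : Fin n, A 7 u v = branch T u v
  tops : ∀ v : Fin n, HasTops T A v

theorem HasBranches.congr {o : ℕ → Fin n} {A B : Tables} (h : HasBranches T o A) (h0 : B 0 = A 0)
    (h4 : B 4 = A 4) (h5 : B 5 = A 5) (h6 : B 6 = A 6) (h7 : B 7 = A 7) (h8 : B 8 = A 8) :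
    HasBranches T o B where
  toIsMetric := h.toIsMetric.congr h0 h4 h5 h6
  branch := by rw [h7]; exact h.branch
  tops v := by simpa only [HasTops, h8] using h.tops v

theorem HasBranches.set {o : ℕ → Fin n} {A : Tables} (h : HasBranches T o A) {k : Fin 16}
    (hk : 9 ≤ k) (i j x : ℕ) : HasBranches T o (A.set k i j x) :=
  h.congr (Tables.set_of_ne _ (by omega) _ _ _) (Tables.set_of_ne _ (by omega) _ _ _)
    (Tables.set_of_ne _ (by omega) _ _ _) (Tables.set_of_ne _ (by omega) _ _ _)
    (Tables.set_of_ne _ (by omega) _ _ _) (Tables.set_of_ne _ (by omega) _ _ _)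

/-- With all lengths below `n`, the sums that occur stay below `2 * n + 2` and are never truncated.
-/
theorem far_lt (hT : T.IsTree) (x : Fin n) (P : Fin n → Prop) : far T x P < n := by
  by_contra h
  have hn := x.pos
  obtain ⟨w, -, hw⟩ := lt_far.1 (show n - 1 < far T x P by omega)
  have := dist_lt hT x w
  omega

namespace Expr

/-- The larger one of two numbers. -/
def maxV (a b : Expr) : Expr := iflt a b b a

/-- The entry of the table for `between`. -/
def betweenV (u v : Expr) : Expr := get 9 u v

/-- The length of a longest trail from `x` towards `v` that does not leave `v` to `a` or `b`. -/
def rayV (x v a b : Expr) : Expr :=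
  maxV (betweenV x v) (add (distV x v) (branchV v (best v a b (nextV v x))))

end Expr

theorem eval_maxV {N : ℕ} {A : Tables} {l : List ℕ} (a b : Expr) :
    (maxV a b).eval N A l = max (a.eval N A l) (b.eval N A l) := by
  simp only [maxV, Expr.eval, max_def_lt]

theorem eval_nextV {o : ℕ → Fin n} {N : ℕ} {A : Tables} {l : List ℕ} (h : IsMetric T o A)
    {u v : Expr} {u' v' : Fin n} (hu : u.eval N A l = u') (hv : v.eval N A l = v') :
    (nextV u v).eval N A l = (next T u' v' : Fin n) := by
  simp only [nextV, Expr.eval, hu, hv, h.nxt]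

theorem eval_distV {o : ℕ → Fin n} {N : ℕ} {A : Tables} {l : List ℕ} (h : IsMetric T o A)
    {u v : Expr} {u' v' : Fin n} (hu : u.eval N A l = u') (hv : v.eval N A l = v') :
    (distV u v).eval N A l = T.dist u' v' := by
  simp only [distV, Expr.eval, hu, hv, h.dist]

theorem eval_branchV {o : ℕ → Fin n} {N : ℕ} {A : Tables} {l : List ℕ} (h : HasBranches T o A)
    {u v : Expr} {u' v' : Fin n} (hu : u.eval N A l = u') (hv : v.eval N A l = v') :
    (branchV u v).eval N A l = branch T u' v' := by
  simp only [branchV, Expr.eval, hu, hv, h.branch]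

theorem eval_dist_add_branch (hT : T.IsTree) {o : ℕ → Fin n} {A : Tables} {l : List ℕ}
    (h : HasBranches T o A) {x v w z : Expr} {x' v' w' z' : Fin n}
    (hx : x.eval (2 * n + 2) A l = x') (hv : v.eval (2 * n + 2) A l = v')
    (hw : w.eval (2 * n + 2) A l = w') (hz : z.eval (2 * n + 2) A l = z') :
    (add (distV x v) (branchV w z)).eval (2 * n + 2) A l = T.dist x' v' + branch T w' z' := by
  rw [Expr.eval, eval_distV h.toIsMetric hx hv, eval_branchV h hw hz, if_pos]
  have := dist_lt hT x' v'
  have : branch T w' z' < n := far_lt hT _ _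
  omega

/-- An expression for the vertex inserted in the round given by a loop counter. -/
theorem eval_nth {o : ℕ → Fin n} {N : ℕ} {A : Tables} {l : List ℕ} (h : IsMetric T o A)
    {e : Expr} {i : ℕ} (he : e.eval N A l = i) (hi : i < n) : (nth e).eval N A l = o i := by
  simp only [nth, Expr.eval, he]
  exact h.ord i hi

/-- The new entry for `x` and `v` in the table for `between`. -/
def towards (x v : Expr) : Expr := ifeq (nextV v x) x (lit 0) <|
  maxV (betweenV x (nextV v x)) (add (distV x (nextV v x))
    (branchV (nextV v x) (best (nextV v x) v (nextV (nextV v x) x) v)))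

/-- The new entry for `v` and `x` in the table for `between`. -/
def awayFrom (x v : Expr) : Expr := ifeq (nextV v x) x (lit 0) <|
  add (lit 1) (maxV (betweenV (nextV v x) x)
    (branchV (nextV v x) (best (nextV v x) v (nextV (nextV v x) x) v)))

/-- Compute the table for `between`. -/
def betweenStage : Stmt := .loop order <| .loop (var 0) <|
  .seq (.assign 9 (nth (var 1)) (nth (var 0)) (towards (nth (var 1)) (nth (var 0))))
    (.assign 9 (nth (var 0)) (nth (var 1)) (awayFrom (nth (var 1)) (nth (var 0))))

theorem exists_eval_best_next (hT : T.IsTree) {o : ℕ → Fin n} {N : ℕ} {A : Tables} {l : List ℕ}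
    (h : HasBranches T o A) {x v : Expr} {x' v' : Fin n} (hx : x.eval N A l = x')
    (hv : v.eval N A l = v') (hxv : x' ≠ v') (hp : next T v' x' ≠ x') :
    ∃ z : Fin n, (best (nextV v x) v (nextV (nextV v x) x) v).eval N A l = z ∧
      IsBest T (next T v' x') v' (next T (next T v' x') x') v' z := by
  have ep := eval_nextV h.toIsMetric hv hx
  have hadj := adj_next hT hxv.symm
  exact eval_best ep hv (eval_nextV h.toIsMetric ep hx) hv (h.tops _) hadj.ne.symm
    (adj_next hT hp).ne hadj.ne.symm

theorem eval_towards (hT : T.IsTree) {o : ℕ → Fin n} {A : Tables} {l : List ℕ}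
    (h : HasBranches T o A) {x v : Expr} {x' v' : Fin n} (hx : x.eval (2 * n + 2) A l = x')
    (hv : v.eval (2 * n + 2) A l = v') (hxv : x' ≠ v')
    (hA : A 9 x' (next T v' x' : Fin n) = between T x' (next T v' x')) :
    (towards x v).eval (2 * n + 2) A l = between T x' v' := by
  have ep := eval_nextV h.toIsMetric hv hx
  rw [towards, Expr.eval, ep, hx]
  by_cases hp : next T v' x' = x'
  · have : T.Adj x' v' := by
      have := adj_next hT hxv.symm
      rw [hp] at this
      exact this.symm
    simp [hp, between_of_adj hT this, Expr.eval]
  · obtain ⟨z, hz, hb⟩ := exists_eval_best_next hT h hx hv hxv hp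
    rw [if_neg (by rwa [Fin.val_inj]), eval_maxV, eval_dist_add_branch hT h hx ep ep hz,
      between_eq_of_ne hT rfl hxv hp hb, betweenV, Expr.eval, hx, ep, hA]

theorem eval_awayFrom (hT : T.IsTree) {o : ℕ → Fin n} {A : Tables} {l : List ℕ}
    (h : HasBranches T o A) {x v : Expr} {x' v' : Fin n} (hx : x.eval (2 * n + 2) A l = x')
    (hv : v.eval (2 * n + 2) A l = v') (hxv : x' ≠ v')
    (hA : A 9 (next T v' x' : Fin n) x' = between T (next T v' x') x') :
    (awayFrom x v).eval (2 * n + 2) A l = between T v' x' := by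
  have ep := eval_nextV h.toIsMetric hv hx
  rw [awayFrom, Expr.eval, ep, hx]
  by_cases hp : next T v' x' = x'
  · have : T.Adj v' x' := by
      have := adj_next hT hxv.symm
      rwa [hp] at this
    simp [hp, between_of_adj hT this, Expr.eval]
  · obtain ⟨z, hz, hb⟩ := exists_eval_best_next hT h hx hv hxv hp
    have e1 : (maxV (betweenV (nextV v x) x) (branchV (nextV v x)
        (best (nextV v x) v (nextV (nextV v x) x) v))).eval (2 * n + 2) A l =
        max (between T (next T v' x') x') (branch T (next T v' x') z) := by
      rw [eval_maxV, eval_branchV h ep hz, betweenV, Expr.eval, hx, ep, hA]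
    have h1 : between T (next T v' x') x' < n := far_lt hT _ _
    have h2 : branch T (next T v' x') z < n := far_lt hT _ _
    rw [if_neg (by rwa [Fin.val_inj]), Expr.eval, e1, between_eq_of_ne' hT rfl hxv hp hb]
    exact if_pos (by simp only [Expr.eval]; omega)

theorem between_self (hT : T.IsTree) (x : Fin n) : between T x x = 0 := by
  by_contra h
  obtain ⟨w, ⟨h1, -⟩, hd⟩ := lt_far.1 (Nat.pos_of_ne_zero h)
  rw [next_self, next_eq_self_iff hT] at h1
  subst h1
  simp at hd

theorem set_eq_of_eq {A : Tables} {k : Fin 16} {i j x i' j' y : ℕ} (h : A k i' j' = y)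
    (hx : i' = i → j' = j → x = y) : A.set k i j x k i' j' = y := by
  rw [Tables.set_same]
  split_ifs with e
  exacts [hx e.1 e.2, h]

/-- The entries for the newest vertex `o k` and an older `x` need only those for `x` and the
neighbour of `o k` towards `x`, which is older too because initial segments are closed. -/
theorem run_betweenStage (hT : T.IsTree) {o : ℕ → Fin n} {A : Tables} (h : HasBranches T o A)
    (h0 : ∀ i j, A 9 i j = 0) (u v : Fin n) :
    betweenStage.run (2 * n + 2) [] A 9 u v = between T u v := by
  have key := Stmt.run_loop_induct (N := 2 * n + 2) (b := order) (v := []) (A := A)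
    (p := .loop (var 0) <|
      .seq (.assign 9 (nth (var 1)) (nth (var 0)) (towards (nth (var 1)) (nth (var 0))))
      (.assign 9 (nth (var 0)) (nth (var 1)) (awayFrom (nth (var 1)) (nth (var 0))))) (m := n)
    (fun k B => HasBranches T o B ∧ (∀ u : Fin n, B 9 u u = between T u u) ∧
      ∀ i < k, ∀ j < k, B 9 (o i) (o j) = between T (o i) (o j))
    h.size ⟨h, fun u => by rw [h0, between_self hT], fun i hi => absurd hi (Nat.not_lt_zero _)⟩
    (by
      rintro k hk B ⟨hB, hd, hold⟩
      have inner := Stmt.run_loop_induct (N := 2 * n + 2) (b := var 0) (v := [k]) (A := B)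
        (p := .seq (.assign 9 (nth (var 1)) (nth (var 0)) (towards (nth (var 1)) (nth (var 0))))
          (.assign 9 (nth (var 0)) (nth (var 1)) (awayFrom (nth (var 1)) (nth (var 0))))) (m := k)
        (fun l B => HasBranches T o B ∧ (∀ u : Fin n, B 9 u u = between T u u) ∧
          (∀ i < k, ∀ j < k, B 9 (o i) (o j) = between T (o i) (o j)) ∧
          ∀ i < l, B 9 (o i) (o k) = between T (o i) (o k) ∧
            B 9 (o k) (o i) = between T (o k) (o i))
        rfl ⟨hB, hd, hold, fun i hi => absurd hi (Nat.not_lt_zero _)⟩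
        (by
          rintro l hl B ⟨hB, hd, hold, hnew⟩
          have hxv : o l ≠ o k := fun e => by
            have := hB.inj l (by omega) k hk e
            omega
          obtain ⟨m, hm, hom⟩ := hB.closed (k + 1) (by omega) k (by omega) l (by omega)
          have hmk : m < k := by
            have : m ≠ k := by
              rintro rfl
              exact (adj_next hT hxv.symm).ne hom.symm
            omega
          have w1 : ∀ {C}, HasBranches T o C →
              (nth (var 1)).eval (2 * n + 2) C ([k] ++ [l]) = o l := fun hC =>
            eval_nth hC.toIsMetric rfl (by omega)
          have w0 : ∀ {C}, HasBranches T o C →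
              (nth (var 0)).eval (2 * n + 2) C ([k] ++ [l]) = o k := fun hC =>
            eval_nth hC.toIsMetric rfl hk
          have e1 := eval_towards hT hB (w1 hB) (w0 hB) hxv (by rw [hom]; exact hold l hl m hmk)
          have hC := hB.set (k := 9) le_rfl (o l) (o k) (between T (o l) (o k))
          have e2 := eval_awayFrom hT hC (w1 hC) (w0 hC) hxv (by
            rw [hom]
            exact set_eq_of_eq (hold m hmk l hl) fun _ e => absurd (Fin.ext e) hxv)
          simp only [Stmt.run, w0 hB, w1 hB, e1]
          simp only [w0 hC, w1 hC, e2]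
          -- Only correct values are written, so entries that were correct remain so.
          have ok : ∀ u v : Fin n, B 9 u v = between T u v ∨ (u = o l ∧ v = o k) ∨
              (u = o k ∧ v = o l) → (((B.set 9 (o l) (o k) (between T (o l) (o k))).set 9 (o k) (o l)
              (between T (o k) (o l))) 9 u v) = between T u v := by
            rintro u v (h | ⟨rfl, rfl⟩ | ⟨rfl, rfl⟩)
            · exact set_eq_of_eq (set_eq_of_eq h fun e e' => by rw [Fin.ext e, Fin.ext e'])
                fun e e' => by rw [Fin.ext e, Fin.ext e']
            · exact set_eq_of_eq (by simp [Tables.set_same]) fun e e' => by rw [Fin.ext e, ← Fin.ext e]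
            · simp [Tables.set_same]
          refine ⟨hC.set le_rfl _ _ _, fun u => ok _ _ (.inl (hd u)),
            fun i hi j hj => ok _ _ (.inl (hold i hi j hj)), fun i hi => ?_⟩
          rcases Nat.lt_succ_iff_lt_or_eq.1 hi with hi | rfl
          · exact ⟨ok _ _ (.inl (hnew i hi).1), ok _ _ (.inl (hnew i hi).2)⟩
          · exact ⟨ok _ _ (.inr (.inl ⟨rfl, rfl⟩)), ok _ _ (.inr (.inr ⟨rfl, rfl⟩))⟩)
      obtain ⟨h1, h2, h3, h4⟩ := inner
      refine ⟨h1, h2, fun i hi j hj => ?_⟩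
      rcases Nat.lt_succ_iff_lt_or_eq.1 hi with hi | rfl <;>
        rcases Nat.lt_succ_iff_lt_or_eq.1 hj with hj | rfl
      exacts [h3 i hi j hj, (h4 i hi).1, (h4 j hj).2, h2 _])
  obtain ⟨-, -, h3⟩ := key
  obtain ⟨i, hi, rfl⟩ := h.surj u
  obtain ⟨j, hj, rfl⟩ := h.surj v
  exact h3 i hi j hj

/-! ### Tokens that face each other -/

/-- The tables `4` to `9` have been computed. -/
structure HasRays (T : SimpleGraph (Fin n)) (o : ℕ → Fin n) (A : Tables) : Prop
    extends HasBranches T o A where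
  between : ∀ u v : Fin n, A 9 u v = between T u v

theorem HasRays.set {o : ℕ → Fin n} {A : Tables} (h : HasRays T o A) {k : Fin 16}
    (hk : 10 ≤ k) (i j x : ℕ) : HasRays T o (A.set k i j x) where
  toHasBranches := h.toHasBranches.set (by omega) _ _ _
  between := by rw [Tables.set_of_ne _ (by omega)]; exact h.between

theorem eval_rayV_of_best (hT : T.IsTree) {o : ℕ → Fin n} {A : Tables} {l : List ℕ}
    (h : HasRays T o A) {x v a b : Expr} {x' v' z : Fin n} (hx : x.eval (2 * n + 2) A l = x')
    (hv : v.eval (2 * n + 2) A l = v')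
    (hz : (best v a b (nextV v x)).eval (2 * n + 2) A l = z) : (rayV x v a b).eval (2 * n + 2) A l =
      max (TrailTrap.between T x' v') (T.dist x' v' + TrailTrap.branch T v' z) := by
  rw [rayV, eval_maxV, eval_dist_add_branch hT h.toHasBranches hx hv hv hz, betweenV, Expr.eval, hx,
    hv, h.between]

theorem eval_rayV (hT : T.IsTree) {o : ℕ → Fin n} {A : Tables} {l : List ℕ}
    (h : HasRays T o A) {x v a b : Expr} {x' v' a' b' : Fin n}
    (hx : x.eval (2 * n + 2) A l = x') (hv : v.eval (2 * n + 2) A l = v')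
    (ha : a.eval (2 * n + 2) A l = a') (hb : b.eval (2 * n + 2) A l = b')
    (hxv : x' ≠ v') (hva : v' ≠ a') (hvb : v' ≠ b') :
    ∃ z, IsBest T v' a' b' (next T v' x') z ∧ (rayV x v a b).eval (2 * n + 2) A l =
      max (TrailTrap.between T x' v') (T.dist x' v' + TrailTrap.branch T v' z) := by
  obtain ⟨z, hz, hbest⟩ := eval_best hv ha hb (eval_nextV h.toIsMetric hv hx) (h.tops v') hva hvb
    (adj_next hT hxv.symm).ne
  exact ⟨z, hbest, eval_rayV_of_best hT h hx hv hz⟩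

/-- Whether the player to move wins if their token has come from `u`, that of the opponent from `x`,
and they face each other. -/
def faceV (u x : Expr) : Expr :=
  iflt (branchV (nextV u x)
      (best (nextV u x) u (nextV (nextV u x) x) (nextV (nextV u x) x)))
    (rayV x (nextV u x) u (best (nextV u x) u (nextV (nextV u x) x) (nextV (nextV u x) x)))
    (iflt (lit 2) (distV u x) (sub (lit 1) (get 10 x (nextV u x))) (lit 0)) (lit 1)

/-- Compute the table of the outcomes for tokens that face each other. -/
def faceStage : Stmt := .loop order <|
  .seq (.loop (var 0) <| .assign 10 (nth (var 0)) (nth (var 1)) (faceV (nth (var 0)) (nth (var 1))))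
    (.loop (var 0) <| .assign 10 (nth (var 1)) (nth (var 0)) (faceV (nth (var 1)) (nth (var 0))))

/-- The number `x` is `1` if `P` holds and `0` otherwise. -/
def Decides (x : ℕ) (P : Prop) : Prop := x = 1 ∧ P ∨ x = 0 ∧ ¬P

/-- The first comparison decides whether leaving at once wins; if not, the entry for the position
after going on is negated. -/
theorem eval_faceV (hT : T.IsTree) {o : ℕ → Fin n} {A : Tables} {l : List ℕ}
    (h : HasRays T o A) {u x : Expr} {u' x' : Fin n}
    (hu : u.eval (2 * n + 2) A l = u') (hx : x.eval (2 * n + 2) A l = x')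
    (hd : 2 ≤ T.dist u' x')
    (hA : 2 < T.dist u' x' → Decides (A 10 x' (next T u' x' : Fin n)) (FaceWins T x' (next T u' x'))) :
    Decides ((faceV u x).eval (2 * n + 2) A l) (FaceWins T u' x') := by
  have hux : u' ≠ x' := by rintro rfl; simp at hd
  have hadj := adj_next hT hux
  have hpx : next T u' x' ≠ x' := fun e => by
    rw [e] at hadj
    rw [SimpleGraph.dist_eq_one_iff_adj.2 hadj] at hd
    omega
  have ep := eval_nextV h.toIsMetric hu hx
  have eq := eval_nextV h.toIsMetric ep hx
  have hpq := (adj_next hT hpx).ne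
  obtain ⟨z, ez, hz⟩ := eval_best ep hu eq eq (h.tops _) hadj.ne.symm hpq hpq
  obtain ⟨y, ey, hy⟩ : ∃ y, (rayV x (nextV u x) u (best (nextV u x) u (nextV (nextV u x) x)
      (nextV (nextV u x) x))).eval (2 * n + 2) A l = max (TrailTrap.between T x' (next T u' x'))
      (T.dist x' (next T u' x') + TrailTrap.branch T (next T u' x') y) ∧
      (LeaveWins T u' x' ↔ ¬TrailTrap.branch T (next T u' x') z <
        max (TrailTrap.between T x' (next T u' x'))
      (T.dist x' (next T u' x') + TrailTrap.branch T (next T u' x') y)) := by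
    -- If there is no exit at all, its length is 0, and the comparison fails as it should because
    -- the ray has at least the length of the way to this vertex.
    by_cases hzp : z = next T u' x'
    · obtain ⟨y, hy⟩ := exists_eval_best ep hu ez (eval_nextV h.toIsMetric ep hx) (h.tops _)
      refine ⟨y, eval_rayV_of_best hT h hx ep hy, iff_of_false ?_ (not_not.2 ?_)⟩
      · rw [hzp] at hz
        exact not_leaveWins hT rfl hz
      · rw [hzp, branch_self hT]
        have := dist_ne_zero hT hpx.symm
        omega
    · obtain ⟨y, hy, ey⟩ := eval_rayV hT h hx ep hu ez hpx.symm hadj.ne.symm (Ne.symm hzp)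
      exact ⟨y, ey, by rw [leaveWins_iff hT hux rfl hpx hzp hz hy, not_lt]⟩
  rw [faceWins_iff hT hux, faceV, Expr.eval, eval_branchV h.toHasBranches ep ez, ey, hy]
  by_cases hc : branch T (next T u' x') z <
      max (TrailTrap.between T x' (next T u' x')) (T.dist x' (next T u' x') + branch T (next T u' x') y)
  · simp only [hc, not_true, false_or, if_true]
    rw [Expr.eval, eval_distV h.toIsMetric hu hx]
    simp only [Expr.eval, ep, hx, Fin.isValue]
    by_cases h2 : 2 < T.dist u' x'
    · rw [if_pos (by exact h2)]
      rcases hA h2 with ⟨e, hw⟩ | ⟨e, hw⟩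
      · exact .inr ⟨by simp [e], by tauto⟩
      · exact .inl ⟨by simp [e], by tauto⟩
    · rw [if_neg (by exact h2)]
      exact .inr ⟨rfl, by tauto⟩
  · exact .inl ⟨by simp [hc, Expr.eval], .inl hc⟩

/-- The table of outcomes is correct for `u` and `x`. -/
def FaceCorrect (T : SimpleGraph (Fin n)) (A : Tables) (u x : Fin n) : Prop :=
  2 ≤ T.dist u x → Decides (A 10 u x) (FaceWins T u x)

theorem FaceCorrect.set {A : Tables} {u x a b : Fin n} {y : ℕ}
    (hy : 2 ≤ T.dist a b → Decides y (FaceWins T a b))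
    (h : FaceCorrect T A u x ∨ u = a ∧ x = b) : FaceCorrect T (A.set 10 a b y) u x := by
  intro hd
  rw [Tables.set_same]
  split_ifs with e
  · obtain ⟨rfl, rfl⟩ : u = a ∧ x = b := ⟨Fin.ext e.1, Fin.ext e.2⟩
    exact hy hd
  · rcases h with h | ⟨rfl, rfl⟩
    · exact h hd
    · exact absurd ⟨rfl, rfl⟩ e

/-- For the newest vertex `o k`, the pairs `(o k, o l)` come first, as they refer to pairs of older
vertices. The pairs `(o l, o k)` refer to pairs that begin with `o k`, hence the second loop. -/
theorem run_faceStage (hT : T.IsTree) {o : ℕ → Fin n} {A : Tables} (h : HasRays T o A)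
    (u v : Fin n) : FaceCorrect T (faceStage.run (2 * n + 2) [] A) u v := by
  have key := Stmt.run_loop_induct (N := 2 * n + 2) (b := order) (v := []) (A := A)
    (p := .seq (.loop (var 0) <| .assign 10 (nth (var 0)) (nth (var 1))
        (faceV (nth (var 0)) (nth (var 1))))
      (.loop (var 0) <| .assign 10 (nth (var 1)) (nth (var 0))
        (faceV (nth (var 1)) (nth (var 0))))) (m := n)
    (fun k B => HasRays T o B ∧ ∀ i < k, ∀ j < k, FaceCorrect T B (o i) (o j))
    h.size ⟨h, fun i hi => absurd hi (Nat.not_lt_zero _)⟩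
    (by
      rintro k hk B ⟨hB, hold⟩
      have w1 : ∀ {C : Tables} {l : ℕ}, HasRays T o C → l < n →
          (nth (var 1)).eval (2 * n + 2) C ([k] ++ [l]) = o l := fun hC hl =>
        eval_nth hC.toIsMetric rfl hl
      have w0 : ∀ {C : Tables} {l : ℕ}, HasRays T o C →
          (nth (var 0)).eval (2 * n + 2) C ([k] ++ [l]) = o k := fun hC =>
        eval_nth hC.toIsMetric rfl hk
      have hne : ∀ l < k, o l ≠ o k := fun l hl e => by
        have := hB.inj l (by omega) k hk e
        omega
      have first := Stmt.run_loop_induct (N := 2 * n + 2) (b := var 0) (v := [k]) (A := B)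
        (p := .assign 10 (nth (var 0)) (nth (var 1)) (faceV (nth (var 0)) (nth (var 1)))) (m := k)
        (fun l B => HasRays T o B ∧ (∀ i < k, ∀ j < k, FaceCorrect T B (o i) (o j)) ∧
          ∀ i < l, FaceCorrect T B (o k) (o i))
        rfl ⟨hB, hold, fun i hi => absurd hi (Nat.not_lt_zero _)⟩
        (by
          rintro l hl B ⟨hB, hold, hnew⟩
          have hval : 2 ≤ T.dist (o k) (o l) → Decides ((faceV (nth (var 0)) (nth (var 1))).eval
              (2 * n + 2) B ([k] ++ [l])) (FaceWins T (o k) (o l)) := by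
            intro hd
            refine eval_faceV hT hB (w0 hB) (w1 hB (by omega)) hd fun hd' => ?_
            obtain ⟨m, hm, hom⟩ := hB.closed (k + 1) (by omega) k (by omega) l (by omega)
            have hmk : m ≠ k := by
              rintro rfl
              exact (adj_next hT (hne l hl).symm).ne hom.symm
            have hdn := dist_next hT (hne l hl).symm
            rw [hom] at hdn ⊢
            exact hold l hl m (by omega) (by rw [SimpleGraph.dist_comm]; omega)
          simp only [Stmt.run, w0 hB, w1 hB (show l < n by omega)]
          refine ⟨hB.set le_rfl _ _ _, fun i hi j hj => .set hval (.inl (hold i hi j hj)),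
            fun i hi => .set hval ?_⟩
          rcases Nat.lt_succ_iff_lt_or_eq.1 hi with hi | rfl
          exacts [.inl (hnew i hi), .inr ⟨rfl, rfl⟩])
      rw [List.nil_append, Stmt.run_seq]
      generalize (Stmt.loop (var 0) <| .assign 10 (nth (var 0)) (nth (var 1))
        (faceV (nth (var 0)) (nth (var 1)))).run (2 * n + 2) [k] B = B' at *
      obtain ⟨hB', hold', hnew'⟩ := first
      have second := Stmt.run_loop_induct (N := 2 * n + 2) (b := var 0) (v := [k]) (A := B')
        (p := .assign 10 (nth (var 1)) (nth (var 0)) (faceV (nth (var 1)) (nth (var 0)))) (m := k)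
        (fun l B => HasRays T o B ∧ (∀ i < k, ∀ j < k, FaceCorrect T B (o i) (o j)) ∧
          (∀ i < k, FaceCorrect T B (o k) (o i)) ∧ ∀ i < l, FaceCorrect T B (o i) (o k))
        rfl ⟨hB', hold', hnew', fun i hi => absurd hi (Nat.not_lt_zero _)⟩
        (by
          rintro l hl B ⟨hB, hold, hnew, hnew2⟩
          have hval : 2 ≤ T.dist (o l) (o k) → Decides ((faceV (nth (var 1)) (nth (var 0))).eval
              (2 * n + 2) B ([k] ++ [l])) (FaceWins T (o l) (o k)) := by
            intro hd
            refine eval_faceV hT hB (w1 hB (by omega)) (w0 hB) hd fun hd' => ?_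
            obtain ⟨m, hm, hom⟩ := hB.closed (k + 1) (by omega) l (by omega) k (by omega)
            have hdn := dist_next hT (hne l hl)
            -- At distance more than two, the next vertex from `o l` is not yet `o k`.
            have hmk : m ≠ k := by
              rintro rfl
              rw [hom, SimpleGraph.dist_self] at hdn
              omega
            rw [hom] at hdn ⊢
            exact hnew m (by omega) (by rw [SimpleGraph.dist_comm]; omega)
          simp only [Stmt.run, w0 hB, w1 hB (show l < n by omega)]
          refine ⟨hB.set le_rfl _ _ _, fun i hi j hj => .set hval (.inl (hold i hi j hj)),
            fun i hi => .set hval (.inl (hnew i hi)), fun i hi => .set hval ?_⟩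
          rcases Nat.lt_succ_iff_lt_or_eq.1 hi with hi | rfl
          exacts [.inl (hnew2 i hi), .inr ⟨rfl, rfl⟩])
      obtain ⟨h1, h2, h3, h4⟩ := second
      refine ⟨h1, fun i hi j hj => ?_⟩
      rcases Nat.lt_succ_iff_lt_or_eq.1 hi with hi | rfl <;>
        rcases Nat.lt_succ_iff_lt_or_eq.1 hj with hj | rfl
      · exact h2 i hi j hj
      · exact h4 i hi
      · exact h3 j hj
      · intro hd; simp at hd)
  obtain ⟨i, hi, rfl⟩ := h.surj u
  obtain ⟨j, hj, rfl⟩ := h.surj v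
  exact key.2 i hi j hj

end TrailTrap

namespace TrailTrap

open TrailTrap.Expr

variable {n : ℕ} {T : SimpleGraph (Fin n)}

/-! ### The first moves -/

theorem Decides.congr {x : ℕ} {P Q : Prop} (h : Decides x P) (e : P ↔ Q) : Decides x Q := by
  rwa [← e]

/-- The tables `4` to `10` have been computed. -/
structure HasFaces (T : SimpleGraph (Fin n)) (o : ℕ → Fin n) (A : Tables) : Prop
    extends HasRays T o A where
  face : ∀ u x : Fin n, FaceCorrect T A u x

theorem HasFaces.set {o : ℕ → Fin n} {A : Tables} (h : HasFaces T o A) {k : Fin 16}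
    (hk : 11 ≤ k) (i j x : ℕ) : HasFaces T o (A.set k i j x) where
  toHasRays := h.toHasRays.set (by omega) _ _ _
  face := by
    unfold FaceCorrect
    rw [Tables.set_of_ne _ (by omega)]
    exact h.face

namespace Expr

/-- The tail of the move with a given index. -/
def tailV (i : Expr) : Expr := iflt i order i (nextV (sub i order) (lit 0))

/-- The head of the move with a given index. -/
def headV (i : Expr) : Expr := iflt i order (nextV i (lit 0)) (sub i order)

/-- The value of `reserve`. -/
def reserveV (u v x y : Expr) : Expr := ifeq v (nextV u x) (rayV u x y y) (branchV u v)

/-- Whether Player 1 wins after two given first moves. -/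
def openingV (u v x y : Expr) : Expr :=
  ifeq v (nextV u x)
    (ifeq y (nextV x u) (get 10 u x)
      (iflt (reserveV x y u v) (reserveV u v x y) (lit 1) (lit 0)))
    (iflt (reserveV x y u v) (reserveV u v x y) (lit 1) (lit 0))

/-- Whether no answer found so far refutes a first move. -/
def flag : Expr := get 11 (lit 0) (lit 0)

/-- Whether a winning first move has been found. -/
def result : Expr := get 12 (lit 0) (lit 0)

/-- The new value of `flag` after the answer `xy` to the first move `uv`. -/
def updateFlag (u v x y : Expr) : Expr :=
  ifeq x y flag <|
    ifeq u x (ifeq v y flag (ifeq (openingV u v x y) (lit 1) flag (lit 0))) <|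
    ifeq u y (ifeq v x flag (ifeq (openingV u v x y) (lit 1) flag (lit 0)))
    (ifeq (openingV u v x y) (lit 1) flag (lit 0))

end Expr

/-- Try all answers to a first move. -/
def answerStage : Stmt := .loop (add order order) <| .assign 11 (lit 0) (lit 0) <|
  updateFlag (tailV (var 0)) (headV (var 0)) (tailV (var 1)) (headV (var 1))

/-- Try all first moves. -/
def openingStage : Stmt := .loop (add order order) <| .seq (.assign 11 (lit 0) (lit 0) (lit 1)) <|
  .seq answerStage <| .assign 12 (lit 0) (lit 0) <|
  ifeq (tailV (var 0)) (headV (var 0)) result (ifeq flag (lit 1) (lit 1) result)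

/-- The move with a given index: it leads from a vertex towards `r` or back. -/
noncomputable def arc (T : SimpleGraph (Fin n)) (r : Fin n) (i : ℕ) : Fin n × Fin n :=
  if h : i < n then (⟨i, h⟩, next T ⟨i, h⟩ r) else
    if h : i - n < n then (next T ⟨i - n, h⟩ r, ⟨i - n, h⟩) else (r, r)

theorem adj_arc (hT : T.IsTree) {r : Fin n} {i : ℕ} (h : (arc T r i).1 ≠ (arc T r i).2) :
    T.Adj (arc T r i).1 (arc T r i).2 := by
  unfold arc at h ⊢
  split_ifs at h ⊢ with h1 h2
  · exact adj_next hT fun e => h (next_eq_self_iff hT |>.2 e).symm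
  · exact (adj_next hT fun e => h (next_eq_self_iff hT |>.2 e)).symm
  · exact absurd rfl h

/-- In the tree rooted at `r`, an edge joins some vertex to its parent; `2 * n` indices cover both
directions. The two indices of the root give the degenerate pair `(r, r)`, which the program skips.
-/
theorem exists_arc_eq (hT : T.IsTree) (r : Fin n) {u v : Fin n} (h : T.Adj u v) :
    ∃ i < 2 * n, arc T r i = (u, v) := by
  by_cases e : next T u r = v
  · exact ⟨u, by omega, by simp [arc, e]⟩
  · rw [← Ne, next_ne_iff_next_eq hT h] at e
    exact ⟨n + v, by omega, by simp [arc, e]⟩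

theorem IsMetric.eval_order {o : ℕ → Fin n} {N : ℕ} {A : Tables} {l : List ℕ} (h : IsMetric T o A) :
    order.eval N A l = n := h.size

theorem eval_arc {o : ℕ → Fin n} {N : ℕ} {A : Tables} {l : List ℕ} (h : IsMetric T o A)
    {r : Fin n} (hr : (r : ℕ) = 0) {e : Expr} {i : ℕ} (he : e.eval N A l = i) (hi : i < 2 * n) :
    (tailV e).eval N A l = (arc T r i).1 ∧ (headV e).eval N A l = (arc T r i).2 := by
  have hz : (lit 0).eval N A l = r := hr.symm
  have hs : (sub e order).eval N A l = i - n := by rw [Expr.eval, he, h.eval_order]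
  unfold arc
  rw [tailV, headV, Expr.eval, Expr.eval, he, h.eval_order]
  by_cases h1 : i < n
  · rw [dif_pos h1, if_pos h1, if_pos h1, eval_nextV h (u' := ⟨i, h1⟩) he hz]
    exact ⟨rfl, rfl⟩
  · have h2 : i - n < n := by omega
    rw [dif_neg h1, dif_pos h2, if_neg h1, if_neg h1, eval_nextV h (u' := ⟨i - n, h2⟩) hs hz]
    exact ⟨rfl, hs⟩

theorem eval_reserveV (hT : T.IsTree) {o : ℕ → Fin n} {A : Tables} {l : List ℕ}
    (h : HasRays T o A) {u v x y : Expr} {u' v' x' y' : Fin n}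
    (hu : u.eval (2 * n + 2) A l = u') (hv : v.eval (2 * n + 2) A l = v')
    (hx : x.eval (2 * n + 2) A l = x') (hy : y.eval (2 * n + 2) A l = y') (huv : T.Adj u' v')
    (hxy : T.Adj x' y') (hn : ¬(v' = next T u' x' ∧ y' = next T x' u')) :
    (reserveV u v x y).eval (2 * n + 2) A l = reserve T u' v' x' y' := by
  rw [reserveV, Expr.eval, hv, eval_nextV h.toIsMetric hu hx, reserve]
  by_cases e : v' = next T u' x'
  · have hux : u' ≠ x' := by
      rintro rfl
      rw [next_self] at e
      exact huv.ne e.symm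
    have hne : y' ≠ next T x' u' := fun e' => hn ⟨e, e'⟩
    obtain ⟨z, hz, ez⟩ := eval_rayV hT h hu hx hy hy hux hxy.ne hxy.ne
    rw [if_pos (congrArg _ e), if_pos e, ez, ray_eq hT hux hxy.ne hxy.ne hne hne hz]
  · rw [if_neg (by rwa [Fin.val_inj]), if_neg e, eval_branchV h.toHasBranches hu hv]

theorem eval_openingV (hT : T.IsTree) {o : ℕ → Fin n} {A : Tables} {l : List ℕ}
    (h : HasFaces T o A) {u v x y : Expr} {u' v' x' y' : Fin n}
    (hu : u.eval (2 * n + 2) A l = u') (hv : v.eval (2 * n + 2) A l = v')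
    (hx : x.eval (2 * n + 2) A l = x') (hy : y.eval (2 * n + 2) A l = y') (huv : T.Adj u' v')
    (hxy : T.Adj x' y') (hne : s(x', y') ≠ s(u', v')) :
    Decides ((openingV u v x y).eval (2 * n + 2) A l) (OpeningWins T u' v' x' y') := by
  rw [OpeningWins]
  by_cases hf : v' = next T u' x' ∧ y' = next T x' u'
  · rw [if_pos hf]
    obtain ⟨h1, h2⟩ := hf
    have hd := two_le_dist_of_facing hT huv hne h1 h2
    rw [openingV, Expr.eval, hv, eval_nextV h.toIsMetric hu hx, if_pos (congrArg _ h1), Expr.eval,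
      hy, eval_nextV h.toIsMetric hx hu, if_pos (congrArg _ h2), Expr.eval, hu, hx]
    exact h.face _ _ hd
  · have e : (openingV u v x y).eval (2 * n + 2) A l =
        if reserve T x' y' u' v' < reserve T u' v' x' y' then 1 else 0 := by
      rw [← eval_reserveV hT h.toHasRays hu hv hx hy huv hxy hf,
        ← eval_reserveV hT h.toHasRays hx hy hu hv hxy huv fun e => hf ⟨e.2, e.1⟩]
      rw [openingV, Expr.eval, hv, eval_nextV h.toIsMetric hu hx, Expr.eval]
      by_cases h1 : (v' : ℕ) = next T u' x'
      · rw [if_pos h1, Expr.eval, hy, eval_nextV h.toIsMetric hx hu,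
          if_neg fun h2 => hf ⟨Fin.ext h1, Fin.ext h2⟩]
        rfl
      · rw [if_neg h1]
        rfl
    rw [if_neg hf, e, Decides]
    split_ifs <;> simp [*]

/-- The answer `m` does not refute the first move `uv`. -/
def Survives (T : SimpleGraph (Fin n)) (u v : Fin n) (m : Fin n × Fin n) : Prop :=
  m.1 ≠ m.2 → s(m.1, m.2) ≠ s(u, v) → OpeningWins T u v m.1 m.2

/-- Degenerate answers and answers along the edge of the first move are not legal and must leave the
flag as it is; the nested tests sort them out in both orientations. -/
theorem eval_updateFlag (hT : T.IsTree) {o : ℕ → Fin n} {A : Tables} {l : List ℕ}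
    (h : HasFaces T o A) {u v x y : Expr} {u' v' x' y' : Fin n}
    (hu : u.eval (2 * n + 2) A l = u') (hv : v.eval (2 * n + 2) A l = v')
    (hx : x.eval (2 * n + 2) A l = x') (hy : y.eval (2 * n + 2) A l = y') (huv : T.Adj u' v')
    (hxy : x' ≠ y' → T.Adj x' y') {P : Prop} (hP : Decides (A 11 0 0) P) :
    Decides ((updateFlag u v x y).eval (2 * n + 2) A l) (P ∧ Survives T u' v' (x', y')) := by
  have hflag : flag.eval (2 * n + 2) A l = A 11 0 0 := rfl
  have keep : Survives T u' v' (x', y') → Decides (A 11 0 0) (P ∧ Survives T u' v' (x', y')) := by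
    intro hs
    rwa [and_iff_left hs]
  have test : x' ≠ y' → s(x', y') ≠ s(u', v') →
      Decides ((ifeq (openingV u v x y) (lit 1) flag (lit 0)).eval (2 * n + 2) A l)
        (P ∧ Survives T u' v' (x', y')) := by
    intro h1 h2
    have hs : Survives T u' v' (x', y') ↔ OpeningWins T u' v' x' y' :=
      ⟨fun hs => hs h1 h2, fun hs _ _ => hs⟩
    rw [hs]
    rcases eval_openingV hT h hu hv hx hy huv (hxy h1) h2 with ⟨e, hw⟩ | ⟨e, hw⟩
    · rw [and_iff_left hw, Expr.eval, e, if_pos (by rfl)]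
      exact hP
    · rw [Expr.eval, e, if_neg (by simp [Expr.eval])]
      exact .inr ⟨rfl, fun hw' => hw hw'.2⟩
  rw [updateFlag, Expr.eval, hx, hy]
  split_ifs with h1
  · exact keep fun h' => absurd (Fin.ext h1) h'
  · rw [Fin.val_inj] at h1
    rw [Expr.eval, hu, hx]
    split_ifs with h2
    · obtain rfl := Fin.ext h2
      rw [Expr.eval, hv, hy]
      split_ifs with h3
      · obtain rfl := Fin.ext h3
        exact keep fun _ h' => absurd rfl h'
      · rw [Fin.val_inj] at h3
        exact test h1 fun e => by simp at e; grind
    · rw [Fin.val_inj] at h2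
      rw [Expr.eval, hu, hy]
      split_ifs with h3
      · obtain rfl := Fin.ext h3
        rw [Expr.eval, hv, hx]
        split_ifs with h4
        · obtain rfl := Fin.ext h4
          exact keep fun _ h' => absurd Sym2.eq_swap h'
        · rw [Fin.val_inj] at h4
          exact test h1 fun e => by simp at e; grind
      · rw [Fin.val_inj] at h3
        exact test h1 fun e => by simp at e; grind

theorem eval_twice_order {o : ℕ → Fin n} {A : Tables} {l : List ℕ} (h : IsMetric T o A) :
    (add order order).eval (2 * n + 2) A l = 2 * n := by
  rw [Expr.eval, h.eval_order, if_pos (by omega)]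
  omega

theorem run_answerStage (hT : T.IsTree) {o : ℕ → Fin n} {A : Tables} (h : HasFaces T o A)
    {r : Fin n} (hr : (r : ℕ) = 0) {i : ℕ} (hi : i < 2 * n)
    (huv : T.Adj (arc T r i).1 (arc T r i).2) (hA : A 11 0 0 = 1) :
    Decides (answerStage.run (2 * n + 2) [i] A 11 0 0) (∀ x y, T.Adj x y →
      s(x, y) ≠ s((arc T r i).1, (arc T r i).2) → OpeningWins T (arc T r i).1 (arc T r i).2 x y) := by
  have key := Stmt.run_loop_induct (N := 2 * n + 2) (b := add order order) (v := [i]) (A := A)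
    (p := .assign 11 (lit 0) (lit 0) <|
      updateFlag (tailV (var 0)) (headV (var 0)) (tailV (var 1)) (headV (var 1))) (m := 2 * n)
    (fun k B => HasFaces T o B ∧
      Decides (B 11 0 0) (∀ j < k, Survives T (arc T r i).1 (arc T r i).2 (arc T r j)))
    (eval_twice_order h.toIsMetric)
    ⟨h, .inl ⟨hA, fun j hj => absurd hj (Nat.not_lt_zero _)⟩⟩
    (by
      rintro j hj B ⟨hB, hd⟩
      obtain ⟨e1, e2⟩ := eval_arc (e := var 0) (i := i) (N := 2 * n + 2) (l := [i] ++ [j]) hB.toIsMetric hr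
        rfl hi
      obtain ⟨e3, e4⟩ := eval_arc (e := var 1) (i := j) (N := 2 * n + 2) (l := [i] ++ [j]) hB.toIsMetric hr
        rfl hj
      have := eval_updateFlag hT hB e1 e2 e3 e4 huv (adj_arc hT) hd
      refine ⟨hB.set le_rfl _ _ _, ?_⟩
      rw [Stmt.run, Tables.set_same, if_pos ⟨rfl, rfl⟩]
      refine this.congr ?_
      simp only [Nat.lt_succ_iff_lt_or_eq, or_imp, forall_and, forall_eq])
  refine key.2.congr ⟨fun h x y hxy hne => ?_, fun h j _ hne => h _ _ (adj_arc hT hne)⟩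
  obtain ⟨j, hj, e⟩ := exists_arc_eq hT r hxy
  have := h j hj
  rw [e] at this
  exact this hxy.ne hne

theorem HasFaces.run_answerStage {o : ℕ → Fin n} {A : Tables} {N : ℕ} {l : List ℕ}
    (h : HasFaces T o A) : HasFaces T o (answerStage.run N l A) :=
  Stmt.run_loop_induct (fun _ B => HasFaces T o B) rfl h fun _ _ _ hB => hB.set le_rfl _ _ _

/-- The flag is reset for each first move and ends as a conjunction over all answers; the result is
a disjunction over all first moves. -/
theorem run_openingStage (hT : T.IsTree) {o : ℕ → Fin n} {A : Tables} (h : HasFaces T o A)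
    {r : Fin n} (hr : (r : ℕ) = 0) (hA : A 12 0 0 = 0) :
    Decides (openingStage.run (2 * n + 2) [] A 12 0 0) (P1Win T) := by
  have key := Stmt.run_loop_induct (N := 2 * n + 2) (b := add order order) (v := []) (A := A)
    (p := .seq (.assign 11 (lit 0) (lit 0) (lit 1)) <|
      .seq answerStage <| .assign 12 (lit 0) (lit 0) <|
      ifeq (tailV (var 0)) (headV (var 0)) result (ifeq flag (lit 1) (lit 1) result)) (m := 2 * n)
    (fun k B => HasFaces T o B ∧
      Decides (B 12 0 0) (∃ i < k, T.Adj (arc T r i).1 (arc T r i).2 ∧ ∀ x y, T.Adj x y →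
        s(x, y) ≠ s((arc T r i).1, (arc T r i).2) → OpeningWins T (arc T r i).1 (arc T r i).2 x y))
    (eval_twice_order h.toIsMetric)
    ⟨h, .inr ⟨hA, by rintro ⟨i, hi, -⟩; exact Nat.not_lt_zero _ hi⟩⟩
    (by
      rintro i hi B ⟨hB, hd⟩
      have hC := hB.set (k := 11) le_rfl 0 0 1
      have hD := hC.run_answerStage (N := 2 * n + 2) (l := [i])
      have h12 : answerStage.run (2 * n + 2) [i] (B.set 11 0 0 1) 12 = B 12 := by
        rw [Stmt.run_of_not_mem (by decide), Tables.set_of_ne _ (by decide)]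
      have hans := TrailTrap.run_answerStage hT hC hr hi
      obtain ⟨e1, e2⟩ := eval_arc (e := var 0) (i := i) (N := 2 * n + 2) (l := [i]) hD.toIsMetric hr rfl hi
      rw [List.nil_append, Stmt.run_seq, Stmt.run_seq]
      change HasFaces T o ((Stmt.assign _ _ _ _).run _ _
        (answerStage.run (2 * n + 2) [i] (B.set 11 0 0 1))) ∧ Decides ((Stmt.assign _ _ _ _).run _ _
        (answerStage.run (2 * n + 2) [i] (B.set 11 0 0 1)) _ _ _) _
      generalize answerStage.run (2 * n + 2) [i] (B.set 11 0 0 1) = D at *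
      refine ⟨hD.set (by decide) _ _ _, ?_⟩
      rw [Stmt.run, Tables.set_same, if_pos ⟨rfl, rfl⟩, Expr.eval, e1, e2]
      have hres : result.eval (2 * n + 2) D [i] = B 12 0 0 := by rw [← h12]; rfl
      have hflag : flag.eval (2 * n + 2) D [i] = D 11 0 0 := rfl
      simp only [Nat.lt_succ_iff_lt_or_eq, or_and_right, exists_or, exists_eq_left]
      split_ifs with he
      · rw [or_iff_left fun h' => h'.1.ne (Fin.ext he), hres]
        exact hd
      · have hadj := adj_arc hT (r := r) (i := i) fun e => he (congrArg _ e)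
        rw [Expr.eval, hflag, hres]
        rcases hans hadj (by simp [Tables.set_same]) with ⟨e, hw⟩ | ⟨e, hw⟩
        · exact .inl ⟨by rw [e]; rfl, .inr ⟨hadj, hw⟩⟩
        · rw [e, or_iff_left fun h' => hw h'.2]
          exact hd)
  refine key.2.congr ?_
  rw [p1Win_iff hT]
  refine ⟨fun ⟨i, _, h1, h2⟩ => ⟨_, _, h1, h2⟩, ?_⟩
  rintro ⟨u, v, huv, h⟩
  obtain ⟨i, hi, e⟩ := exists_arc_eq hT r huv
  exact ⟨i, hi, by rw [e]; exact ⟨huv, h⟩⟩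

/-! ### The whole program -/

/-- Decide whether Player 1 wins. -/
def decideGame : Stmt := .seq metricStage <| .seq branchStage <| .seq topStage <|
  .seq betweenStage <| .seq faceStage openingStage

theorem run_decideGame (hT : T.IsTree) {a b : ℕ → Fin n} {A : Tables} (h : IsInput T a b A)
    (hA : ∀ k, k ≠ 0 → ∀ i j, A k i j = 0) {r : Fin n} (hr : (r : ℕ) = 0) :
    Decides (decideGame.run (2 * n + 2) [] A 12 0 0) (P1Win T) := by
  obtain ⟨o, h1⟩ := exists_isMetric_run hT h hA
  simp only [decideGame, Stmt.run_seq]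
  have h2 : HasBranches T o (topStage.run (2 * n + 2) [] <| branchStage.run (2 * n + 2) [] <|
      metricStage.run (2 * n + 2) [] A) := by
    have z : metricStage.run (2 * n + 2) [] A 7 = A 7 := Stmt.run_of_not_mem (by decide)
    have hb := run_branchStage h1 fun u v => by rw [z, hA 7 (by decide)]
    have hb' : IsMetric T o (branchStage.run (2 * n + 2) [] (metricStage.run (2 * n + 2) [] A)) := by
      apply h1.congr <;> exact Stmt.run_of_not_mem (by decide)
    refine ⟨?_, ?_, run_topStage hb'.size hb⟩
    · apply hb'.congr <;> exact Stmt.run_of_not_mem (by decide)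
    · rw [Stmt.run_of_not_mem (by decide)]
      exact hb
  have z : ∀ k, k = 9 ∨ k = 12 → topStage.run (2 * n + 2) [] (branchStage.run (2 * n + 2) []
      (metricStage.run (2 * n + 2) [] A)) k = A k := by
    rintro k (rfl | rfl) <;> iterate 3 rw [Stmt.run_of_not_mem (by decide)]
  generalize topStage.run (2 * n + 2) [] (branchStage.run (2 * n + 2) []
    (metricStage.run (2 * n + 2) [] A)) = B at *
  have h3 : HasRays T o (betweenStage.run (2 * n + 2) [] B) := by
    refine ⟨?_, run_betweenStage hT h2 fun i j => by rw [z 9 (.inl rfl), hA 9 (by decide)]⟩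
    apply h2.congr <;> exact Stmt.run_of_not_mem (by decide)
  have h4 : HasFaces T o (faceStage.run (2 * n + 2) [] (betweenStage.run (2 * n + 2) [] B)) := by
    refine ⟨⟨?_, ?_⟩, run_faceStage hT h3⟩
    · apply h3.toHasBranches.congr <;> exact Stmt.run_of_not_mem (by decide)
    · rw [Stmt.run_of_not_mem (by decide)]
      exact h3.between
  refine run_openingStage hT h4 hr ?_
  rw [Stmt.run_of_not_mem (by decide), Stmt.run_of_not_mem (by decide), z 12 (.inr rfl),
    hA 12 (by decide)]

/-! ### The edge list as input table. -/

theorem length_edgeList (hT : T.IsTree) {L : List (Fin n × Fin n)} (hL : IsEdgeList T L) :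
    L.length = n - 1 := by
  classical
  have h1 := hT.card_edgeFinset
  have h2 : T.edgeFinset = (L.map Move.edge).toFinset := by
    ext e
    rw [List.mem_toFinset, hL.2, SimpleGraph.mem_edgeFinset]
  rw [h2, List.toFinset_card_of_nodup hL.1, List.length_map, Fintype.card_fin] at h1
  omega

theorem getD_inputWords (L : List (Fin n × Fin n)) {j : ℕ} (hj : j < L.length) :
    (inputWords n L).getD (2 * j + 1) 0 = L[j].1 ∧ (inputWords n L).getD (2 * j + 2) 0 = L[j].2 := by
  simp only [inputWords, List.getD_cons_succ]
  induction L generalizing j with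
  | nil => simp at hj
  | cons e L ih =>
    cases j with
    | zero => simp
    | succ j => simpa [Nat.mul_add] using ih (by simpa using hj)

theorem isInput_inputTables (hT : T.IsTree) {L : List (Fin n × Fin n)} (hL : IsEdgeList T L)
    (r : Fin n) : IsInput T (fun j => (L.getD j (r, r)).1) (fun j => (L.getD j (r, r)).2)
      (inputTables n L) := by
  have hlen := length_edgeList hT hL
  have hget : ∀ j (hj : j < n - 1), L.getD j (r, r) = L[j]'(by omega) := fun j hj =>
    List.getD_eq_getElem _ _ _
  refine ⟨rfl, fun j hj => ?_, fun j hj => ?_, fun j hj => ?_, fun u v huv => ?_⟩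
  · simp only [hget j hj]
    exact (getD_inputWords L (by omega)).1
  · simp only [hget j hj]
    exact (getD_inputWords L (by omega)).2
  · simp only [hget j hj]
    exact (hL.2 _).1 (List.mem_map_of_mem (List.getElem_mem _))
  · obtain ⟨e, he, hee⟩ := List.mem_map.1 ((hL.2 s(u, v)).2 huv)
    obtain ⟨j, hj, rfl⟩ := List.getElem_of_mem he
    refine ⟨j, by omega, ?_⟩
    simp only [hget j (by omega)]
    exact Sym2.eq_iff.1 hee

end TrailTrap

/-- One fixed program determines the winner of Trail Trap on every tree: given any list of the edges
of a tree on the vertices `0, …, n - 1`, and with words of `c` times as many bits as the binary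
expansion of `n` has, it halts after at most `C * n ^ 2` steps with the number of a player who has
a winning strategy in register `0`. -/
theorem mainTheorem5 :
    ∃ (p : TrailTrap.Prog) (c C : ℕ),
      ∀ (n : ℕ) (T : SimpleGraph (Fin n)), T.IsTree →
        ∀ L : List (Fin n × Fin n), TrailTrap.IsEdgeList T L →
          ∃ (s : TrailTrap.State) (t : ℕ),
            TrailTrap.Exec (c * Nat.size n) p (TrailTrap.initState n L) s t ∧
            t ≤ C * n ^ 2 ∧
            ((s.reg 0 = 1 ∧ TrailTrap.P1Win T) ∨ (s.reg 0 = 2 ∧ TrailTrap.P2Win T)) := by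
  -- The nesting depth of the loops is checked by computation; the output expression turns the table
  -- entry 1 or 0 into the player's number 1 or 2.
  obtain ⟨P, C, h⟩ := TrailTrap.Stmt.exists_prog TrailTrap.decideGame (by decide)
    (.ifeq TrailTrap.Expr.result (.lit 1) (.lit 1) (.lit 2))
  refine ⟨P, 12, C, fun n T hT L hL => ?_⟩
  obtain ⟨r⟩ := hT.connected.nonempty
  have hn : 1 ≤ n := r.pos
  obtain ⟨s, t, hx, ht, hs⟩ := h n hn L (by rw [TrailTrap.length_edgeList hT hL]; omega)
  refine ⟨s, t, hx, ht, ?_⟩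
  have hd := TrailTrap.run_decideGame hT
    (TrailTrap.isInput_inputTables hT hL ⟨0, hn⟩)
    (fun k hk i j => if_neg fun e => hk e.1) (r := ⟨0, hn⟩) rfl
  have hres : TrailTrap.Expr.result.eval (2 * n + 2) (TrailTrap.decideGame.run (2 * n + 2) []
      (TrailTrap.inputTables n L)) [] = TrailTrap.decideGame.run (2 * n + 2) []
      (TrailTrap.inputTables n L) 12 0 0 := rfl
  rw [TrailTrap.Expr.eval, hres] at hs
  rcases hd with ⟨e, hw⟩ | ⟨e, hw⟩
  · exact .inl ⟨by rw [hs, e]; rfl, hw⟩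
  · exact .inr ⟨by rw [hs, e]; rfl, TrailTrap.p2Win_iff_not_p1Win.2 hw⟩
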